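/- Let $R=\mathbb{Z}[\sqrt{-2}]\subset\mathbb{C}$ and let $\mathrm{SL}_2(R)$ act on hyperbolic 3-space $\mathcal{H}^3=\{(z,\zeta)\in\mathbb{C}\times\mathbb{R} : \zeta>0\}$ by $$\begin{pmatrix}a&b\\c&d\end{pmatrix}\cdot(z,\zeta)=\left(\frac{\overline{(cz+d)}(az+b)+\zeta^2\bar c a}{|cz+d|^2+\zeta^2|c|^2},\ \frac{\zeta}{|cz+d|^2+\zeta^2|c|^2}\right).$$ Let $X\subset\mathcal{H}^3$ be Mendoza's $2$-dimensional $\mathrm{SL}_2(R)$-equivariant retract, that is, the $\mathrm{SL}_2(R)$-invariant set of points $(z,\zeta)$ for which the minimum of the distances $\frac{|\mu z-\lambda|^2+|\mu|^2\zeta^2}{\zeta}$ to the cusps $\lambda/\mu\in\mathbb{Q}(\sqrt{-2})\cup\{\infty\}$ ($\lambda,\mu\in R$ coprime) is attained at two or more different cusps. Let $\Gamma_0(\sqrt{-2})$ be the group of matrices $\begin{pmatrix}a&b\\c&d\end{pmatrix}\in\mathrm{SL}_2(R)$ with $c\in(\sqrt{-2})$, let $i:\Gamma_0(\sqrt{-2})\to\mathrm{SL}_2(R)$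 be the inclusion, and let $j:\Gamma_0(\sqrt{-2})\to\mathrm{SL}_2(R)$, $$j\begin{pmatrix}a&b\\c&d\end{pmatrix}=\begin{pmatrix}d&\sqrt{-2}^{\,-1}c\\ b\sqrt{-2}&a\end{pmatrix},$$ be conjugation by $\begin{pmatrix}0&1\\\sqrt{-2}&0\end{pmatrix}$. Then $i$ and $j$ induce maps $i^n, j^n:\mathrm{H}^n(\mathrm{SL}_2(R)\backslash X;\mathbb{F}_2)\to\mathrm{H}^n(\Gamma_0(\sqrt{-2})\backslash X;\mathbb{F}_2)$ on (singular) cohomology for all $n\ge 0$: the map $i^n$ is induced by the projection $\Gamma_0(\sqrt{-2})\backslash X\to\mathrm{SL}_2(R)\backslash X$, and $j^n$ is induced by the map of orbit spaces $\Gamma_0(\sqrt{-2})\backslash X\to\mathrm{SL}_2(R)\backslash X$ coming from any continuous map $J:X\to X$ with $J(\gamma x)=j(\gamma)J(x)$ for all $\gamma\in\Gamma_0(\sqrt{-2})$ and $x\in X$; such maps $J$ exist, and they all induce the same $j^n$. The map $$(i^n,j^n):\ \mathrm{H}^n(\mathrm{SL}_2(R)\backslash X;\mathbb{F}_2)\oplus\mathrm{H}^n(\mathrm{SL}_2(R)\backslash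 X;\mathbb{F}_2)\longrightarrow\mathrm{H}^n(\Gamma_0(\sqrt{-2})\backslash X;\mathbb{F}_2),\qquad (x,y)\mapsto i^n(x)+j^n(y),$$ is injective for every $n\neq 0$ and surjective for every $n\neq 2$, and moreover $\ker(i^0,j^0)\cong\mathbb{F}_2$ and $\operatorname{coker}(i^2,j^2)\cong\mathbb{F}_2$. -/

import Mathlib

open CategoryTheory

noncomputable section

/-! ### Singular cohomology with coefficients in `𝔽₂` -/

/-- The singular cochain functor with coefficients in `𝔽₂`: the complex `Hom(C_*(Y; 𝔽₂), 𝔽₂)`,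
contravariant in the space `Y`. -/
def singularCochainFunctor :
    TopCat.{0}ᵒᵖ ⥤ HomologicalComplex (ModuleCat.{0} (ZMod 2)) (ComplexShape.down ℕ).symm :=
  ((AlgebraicTopology.singularChainComplexFunctor (ModuleCat.{0} (ZMod 2))).obj
      (ModuleCat.of (ZMod 2) (ZMod 2)) ⋙
    ((linearYoneda (ZMod 2) (ModuleCat.{0} (ZMod 2))).obj
      (ModuleCat.of (ZMod 2) (ZMod 2))).rightOp.mapHomologicalComplex (ComplexShape.down ℕ)).op ⋙
  HomologicalComplex.unopFunctor (ModuleCat.{0} (ZMod 2)) (ComplexShape.down ℕ)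

/-- `Hⁿ(-; 𝔽₂)` as a contravariant functor. -/
def singularCohomologyFunctor (n : ℕ) : TopCat.{0}ᵒᵖ ⥤ ModuleCat.{0} (ZMod 2) :=
  singularCochainFunctor ⋙ HomologicalComplex.homologyFunctor _ _ n

/-- `Hⁿ(Y; 𝔽₂)`. -/
abbrev SingularCohomology (n : ℕ) (Y : Type) [TopologicalSpace Y] : ModuleCat.{0} (ZMod 2) :=
  (singularCohomologyFunctor n).obj (Opposite.op (TopCat.of Y))

/-- The pullback `f^* : Hⁿ(Z; 𝔽₂) → Hⁿ(Y; 𝔽₂)` along a continuous map `f : Y → Z`. -/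
def SingularCohomology.map (n : ℕ) {Y Z : Type} [TopologicalSpace Y] [TopologicalSpace Z]
    (f : C(Y, Z)) : SingularCohomology n Z →ₗ[ZMod 2] SingularCohomology n Y :=
  ((singularCohomologyFunctor n).map (TopCat.ofHom f).op).hom

/-! ### Maps of orbit spaces -/

/-- `f` is equivariant along the group homomorphism `φ`. -/
def EquivariantAlong {G H Y Z : Type} [Group G] [Group H] [MulAction G Y] [MulAction H Z]
    (φ : G →* H) (f : Y → Z) : Prop :=
  ∀ (g : G) (y : Y), f (g • y) = φ g • f y

/-- The map of orbit spaces `G\Y → H\Z` induced by a `φ`-equivariant continuous map `Y → Z`. -/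
def orbitSpaceMap {G H Y Z : Type} [Group G] [Group H] [MulAction G Y] [MulAction H Z]
    [TopologicalSpace Y] [TopologicalSpace Z] (φ : G →* H) (f : C(Y, Z))
    (hf : EquivariantAlong φ f) :
    C(MulAction.orbitRel.Quotient G Y, MulAction.orbitRel.Quotient H Z) where
  toFun := Quotient.map f (by
    rintro _ y ⟨g, rfl⟩
    exact ⟨φ g, (hf g y).symm⟩)
  continuous_toFun := f.continuous.quotient_map' _

/-! ### Hyperbolic 3-space -/

/-- The upper half-space model of hyperbolic 3-space. -/
def UpperHalfSpace : Type := {p : ℂ × ℝ // 0 < p.2}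

namespace UpperHalfSpace

instance : TopologicalSpace UpperHalfSpace :=
  inferInstanceAs (TopologicalSpace {p : ℂ × ℝ // 0 < p.2})

/-- The boundary coordinate. -/
def z (p : UpperHalfSpace) : ℂ := p.1.1

/-- The height. -/
def ht (p : UpperHalfSpace) : ℝ := p.1.2

lemma ht_pos (p : UpperHalfSpace) : 0 < p.ht := p.2

lemma ext' {p q : UpperHalfSpace} (hz : p.z = q.z) (ht : p.ht = q.ht) : p = q :=
  Subtype.ext (Prod.ext hz ht)

open Matrix ComplexConjugate

/-- `|cz + d|² + ζ²|c|²`. -/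
def den (g : SpecialLinearGroup (Fin 2) ℂ) (p : UpperHalfSpace) : ℝ :=
  Complex.normSq (g 1 0 * p.z + g 1 1) + p.ht ^ 2 * Complex.normSq (g 1 0)

lemma det_eq (g : SpecialLinearGroup (Fin 2) ℂ) : g 0 0 * g 1 1 - g 0 1 * g 1 0 = 1 := by
  have h := g.det_coe
  rwa [Matrix.det_fin_two] at h

lemma den_pos (g : SpecialLinearGroup (Fin 2) ℂ) (p : UpperHalfSpace) : 0 < den g p := by
  have hp := p.ht_pos
  have hd := det_eq g
  unfold den
  by_cases hc : g 1 0 = 0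
  · have h1 : g 1 1 ≠ 0 := by
      intro h
      simp [hc, h] at hd
    have := Complex.normSq_pos.2 h1
    simpa [hc] using this
  · have := Complex.normSq_pos.2 hc
    have h0 := Complex.normSq_nonneg (g 1 0 * p.z + g 1 1)
    positivity

/-- `conj (cz + d) (az + b) + ζ² (conj c) a`. -/
def num (g : SpecialLinearGroup (Fin 2) ℂ) (p : UpperHalfSpace) : ℂ :=
  conj (g 1 0 * p.z + g 1 1) * (g 0 0 * p.z + g 0 1) + (p.ht : ℂ) ^ 2 * conj (g 1 0) * g 0 0

/-- Poincaré's formulas for the action of `SL₂(ℂ)`. -/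
instance : SMul (SpecialLinearGroup (Fin 2) ℂ) UpperHalfSpace where
  smul g p := ⟨(num g p / (den g p : ℂ), p.ht / den g p), div_pos p.ht_pos (den_pos g p)⟩

lemma smul_z (g : SpecialLinearGroup (Fin 2) ℂ) (p : UpperHalfSpace) :
    (g • p).z = num g p / (den g p : ℂ) := rfl

lemma smul_ht (g : SpecialLinearGroup (Fin 2) ℂ) (p : UpperHalfSpace) :
    (g • p).ht = p.ht / den g p := rfl

lemma den_cast (g : SpecialLinearGroup (Fin 2) ℂ) (p : UpperHalfSpace) :
    (den g p : ℂ) = conj (g 1 0 * p.z + g 1 1) * (g 1 0 * p.z + g 1 1)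
      + (p.ht : ℂ) ^ 2 * (conj (g 1 0) * g 1 0) := by
  unfold den
  push_cast
  rw [Complex.normSq_eq_conj_mul_self, Complex.normSq_eq_conj_mul_self]

lemma num_mul_conj (g : SpecialLinearGroup (Fin 2) ℂ) (p : UpperHalfSpace) :
    num g p * conj (num g p) + (p.ht : ℂ) ^ 2 =
      (den g p : ℂ) * (conj (g 0 0 * p.z + g 0 1) * (g 0 0 * p.z + g 0 1)
        + (p.ht : ℂ) ^ 2 * (conj (g 0 0) * g 0 0)) := by
  have h1 := det_eq g
  have h2 := congrArg conj h1
  rw [den_cast]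
  simp only [num, map_add, map_mul, map_sub, map_one, map_pow, Complex.conj_conj,
    Complex.conj_ofReal] at *
  linear_combination (-(p.ht : ℂ) ^ 2) * (g 0 0 * g 1 1 - g 0 1 * g 1 0) * h2
    - (p.ht : ℂ) ^ 2 * h1

/-- The Hermitian form of a point and its behaviour under the action. -/
lemma form_smul (g : SpecialLinearGroup (Fin 2) ℂ) (p : UpperHalfSpace) (x y : ℂ) :
    (den g p : ℂ) * (conj (x * (g • p).z + y) * (x * (g • p).z + y)
        + ((g • p).ht : ℂ) ^ 2 * (conj x * x)) =
      conj ((x * g 0 0 + y * g 1 0) * p.z + (x * g 0 1 + y * g 1 1)) *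
          ((x * g 0 0 + y * g 1 0) * p.z + (x * g 0 1 + y * g 1 1))
        + (p.ht : ℂ) ^ 2 * (conj (x * g 0 0 + y * g 1 0) * (x * g 0 0 + y * g 1 0)) := by
  have hd : (den g p : ℂ) ≠ 0 := by exact_mod_cast (den_pos g p).ne'
  have hk := num_mul_conj g p
  have e1 : (den g p : ℂ) * (conj (x * (g • p).z + y) * (x * (g • p).z + y)
        + ((g • p).ht : ℂ) ^ 2 * (conj x * x)) =
      conj x * x * ((num g p * conj (num g p) + (p.ht : ℂ) ^ 2) / den g p)
        + conj x * y * conj (num g p) + x * conj y * num g p + conj y * y * den g p := by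
    rw [smul_z, smul_ht]
    simp only [map_add, map_mul, map_div₀, Complex.conj_ofReal, Complex.ofReal_div]
    field_simp
    ring
  rw [e1, hk, mul_div_cancel_left₀ _ hd, den_cast]
  simp only [num, map_add, map_mul, map_pow, Complex.conj_conj, Complex.conj_ofReal]
  ring

lemma mul_entry {R : Type} [CommRing R] (g h : SpecialLinearGroup (Fin 2) R) (i j : Fin 2) :
    (g * h) i j = g i 0 * h 0 j + g i 1 * h 1 j := by
  change ((g : Matrix (Fin 2) (Fin 2) R) * (h : Matrix (Fin 2) (Fin 2) R)) i j = _
  rw [Matrix.mul_apply, Fin.sum_univ_two]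

lemma den_mul (g h : SpecialLinearGroup (Fin 2) ℂ) (p : UpperHalfSpace) :
    den (g * h) p = den h p * den g (h • p) := by
  have := form_smul h p (g 1 0) (g 1 1)
  rw [← den_cast] at this
  apply Complex.ofReal_injective
  rw [Complex.ofReal_mul, this, den_cast]
  simp only [mul_entry]

lemma num_mul (g h : SpecialLinearGroup (Fin 2) ℂ) (p : UpperHalfSpace) :
    num (g * h) p = den h p * num g (h • p) := by
  have hd : (den h p : ℂ) ≠ 0 := by exact_mod_cast (den_pos h p).ne'
  have hk := num_mul_conj h p
  have e1 : (den h p : ℂ) * num g (h • p) =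
      conj (g 1 0) * g 0 0 * ((num h p * conj (num h p) + (p.ht : ℂ) ^ 2) / den h p)
        + conj (g 1 0) * g 0 1 * conj (num h p) + g 0 0 * conj (g 1 1) * num h p
        + conj (g 1 1) * g 0 1 * den h p := by
    rw [num, smul_z, smul_ht]
    simp only [map_add, map_mul, map_div₀, Complex.conj_ofReal, Complex.ofReal_div]
    field_simp
    ring
  rw [e1, hk, mul_div_cancel_left₀ _ hd, den_cast]
  simp only [num, mul_entry, map_add, map_mul, map_pow, Complex.conj_conj, Complex.conj_ofReal]
  ring

instance : MulAction (SpecialLinearGroup (Fin 2) ℂ) UpperHalfSpace where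
  one_smul p := by
    apply ext'
    · simp [smul_z, num, den]
    · simp [smul_ht, den]
  mul_smul g h p := by
    have h1 : (den h p : ℂ) ≠ 0 := by exact_mod_cast (den_pos h p).ne'
    have h1' := (den_pos h p).ne'
    apply ext'
    · rw [smul_z, smul_z, num_mul, den_mul, Complex.ofReal_mul, mul_div_mul_left _ _ h1]
    · rw [smul_ht, smul_ht, smul_ht, den_mul, div_div]

end UpperHalfSpace

/-! ### The groups -/

/-- The embedding `ℤ[√-2] → ℂ` with `√-2 ↦ √2 i`. -/
def toComplex : ℤ√(-2) →+* ℂ :=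
  Zsqrtd.lift ⟨(Real.sqrt 2 : ℂ) * Complex.I, by
    have h : (Real.sqrt 2 : ℂ) * (Real.sqrt 2 : ℂ) = 2 := by
      rw [← Complex.ofReal_mul, Real.mul_self_sqrt (by norm_num)]
      norm_num
    push_cast
    linear_combination (-1 : ℂ) * h + (Real.sqrt 2 : ℂ) * (Real.sqrt 2 : ℂ) * Complex.I_mul_I⟩

/-- The Bianchi group `SL₂(ℤ[√-2])`. -/
abbrev Bianchi : Type := Matrix.SpecialLinearGroup (Fin 2) (ℤ√(-2))

instance : MulAction Bianchi UpperHalfSpace :=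
  MulAction.compHom UpperHalfSpace (Matrix.SpecialLinearGroup.map (n := Fin 2) toComplex)

lemma bianchi_det (g : Bianchi) : g 0 0 * g 1 1 - g 0 1 * g 1 0 = 1 := by
  have h := g.det_coe
  rwa [Matrix.det_fin_two] at h

/-- `Γ₀(√-2)`: the matrices in `SL₂(ℤ[√-2])` whose lower left entry lies in the ideal `(√-2)`. -/
def Gamma0 : Subgroup Bianchi where
  carrier := {g | g 1 0 ∈ Ideal.span {(Zsqrtd.sqrtd : ℤ√(-2))}}
  one_mem' := by simp
  mul_mem' {g h} hg hh := by
    rw [Set.mem_ofPred_eq] at *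
    rw [UpperHalfSpace.mul_entry]
    exact Ideal.add_mem _ (Ideal.mul_mem_right _ _ hg) (Ideal.mul_mem_left _ _ hh)
  inv_mem' {g} hg := by
    rw [Set.mem_ofPred_eq] at *
    rw [Matrix.SpecialLinearGroup.SL2_inv_expl]
    simpa using hg

/-- The natural inclusion `i : Γ₀(√-2) → SL₂(ℤ[√-2])`. -/
abbrev iHom : Gamma0 →* Bianchi := Gamma0.subtype

/-- Division by `√-2` (exact on the ideal `(√-2)`): `(x + y√-2)/√-2 = y - (x/2)√-2`. -/
def divSqrt (c : ℤ√(-2)) : ℤ√(-2) := ⟨c.im, -(c.re / 2)⟩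

lemma sqrtd_mul_divSqrt {c : ℤ√(-2)} (hc : c ∈ Ideal.span {(Zsqrtd.sqrtd : ℤ√(-2))}) :
    Zsqrtd.sqrtd * divSqrt c = c := by
  obtain ⟨t, rfl⟩ := Ideal.mem_span_singleton'.1 hc
  ext <;> simp [divSqrt]
  omega

lemma sqrtd_cancel {x y : ℤ√(-2)} (h : Zsqrtd.sqrtd * x = Zsqrtd.sqrtd * y) : x = y := by
  have h1 := congrArg Zsqrtd.re h
  have h2 := congrArg Zsqrtd.im h
  simp at h1 h2
  ext <;> omega

/-- The injection `j : Γ₀(√-2) → SL₂(ℤ[√-2])`,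
`(a, b; c, d) ↦ (d, c/√-2; b√-2, a)`, i.e. conjugation by `(0, 1; √-2, 0)`. -/
def jHom : Gamma0 →* Bianchi where
  toFun g := ⟨!![g.1 1 1, divSqrt (g.1 1 0); g.1 0 1 * Zsqrtd.sqrtd, g.1 0 0], by
    rw [Matrix.det_fin_two_of]
    linear_combination bianchi_det g.1 - g.1 0 1 * sqrtd_mul_divSqrt g.2⟩
  map_one' := by
    apply Subtype.ext
    refine Matrix.ext fun i j => ?_
    fin_cases i <;> fin_cases j <;> simp [divSqrt] <;> rfl
  map_mul' g h := by
    have hg := sqrtd_mul_divSqrt g.2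
    have hh := sqrtd_mul_divSqrt h.2
    have hgh := sqrtd_mul_divSqrt (g * h).2
    have e : ∀ i j, (g * h).1 i j = g.1 i 0 * h.1 0 j + g.1 i 1 * h.1 1 j :=
      UpperHalfSpace.mul_entry g.1 h.1
    apply Subtype.ext
    refine Matrix.ext fun i j => ?_
    refine Eq.trans ?_ (UpperHalfSpace.mul_entry _ _ i j).symm
    simp only [e] at hgh ⊢
    fin_cases i <;> fin_cases j <;> simp
    · linear_combination -h.1 0 1 * hg
    · apply sqrtd_cancel
      linear_combination hgh - h.1 0 0 * hg - g.1 1 1 * hh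
    · ring
    · linear_combination -g.1 0 1 * hh

/-- `j` is conjugation by `(0, 1; √-2, 0)`. -/
lemma jHom_spec (g : Gamma0) :
    !![0, 1; Zsqrtd.sqrtd, 0] * (g.1 : Matrix (Fin 2) (Fin 2) (ℤ√(-2))) =
      (jHom g : Matrix (Fin 2) (Fin 2) (ℤ√(-2))) * !![0, 1; Zsqrtd.sqrtd, 0] := by
  have hg := sqrtd_mul_divSqrt g.2
  refine Matrix.ext fun i j => ?_
  have h00 : jHom g 0 0 = g.1 1 1 := rfl
  have h01 : jHom g 0 1 = divSqrt (g.1 1 0) := rfl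
  have h10 : jHom g 1 0 = g.1 0 1 * Zsqrtd.sqrtd := rfl
  have h11 : jHom g 1 1 = g.1 0 0 := rfl
  fin_cases i <;> fin_cases j <;>
    simp [Matrix.mul_apply, Fin.sum_univ_two, h00, h01, h10, h11]
  · linear_combination -hg
  · ring
  · ring

/-! ### The 2-dimensional retract -/

/-- The distance of the point `(z, ζ)` from the cusp `l/m`, where `l` and `m` are coprime:
`(|mz - l|² + |m|²ζ²)/ζ`. For the cusp `∞ = 1/0` it is the inverse of the height. -/
def cuspDist (l m : ℤ√(-2)) (p : UpperHalfSpace) : ℝ :=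
  (Complex.normSq (toComplex m * p.z - toComplex l) + Complex.normSq (toComplex m) * p.ht ^ 2) /
    p.ht

/-- `l/m` is a cusp in lowest terms that is nearest to `p` among all cusps. -/
def IsNearestCusp (l m : ℤ√(-2)) (p : UpperHalfSpace) : Prop :=
  IsCoprime l m ∧ ∀ l' m' : ℤ√(-2), IsCoprime l' m' → cuspDist l m p ≤ cuspDist l' m' p

lemma cuspDist_smul (g : Bianchi) (l m : ℤ√(-2)) (p : UpperHalfSpace) :
    cuspDist (g 0 0 * l + g 0 1 * m) (g 1 0 * l + g 1 1 * m) (g • p) = cuspDist l m p := by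
  set G := Matrix.SpecialLinearGroup.map (n := Fin 2) toComplex g with hG
  have hsm : g • p = G • p := rfl
  have hE : ∀ i j, G i j = toComplex (g i j) := fun _ _ => rfl
  have hd := UpperHalfSpace.det_eq G
  have hden := (UpperHalfSpace.den_pos G p).ne'
  have hp := p.ht_pos.ne'
  have key := UpperHalfSpace.form_smul G p (G 1 0 * toComplex l + G 1 1 * toComplex m)
    (-(G 0 0 * toComplex l + G 0 1 * toComplex m))
  have e1 : (G 1 0 * toComplex l + G 1 1 * toComplex m) * G 0 0 +
      -(G 0 0 * toComplex l + G 0 1 * toComplex m) * G 1 0 = toComplex m := by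
    linear_combination toComplex m * hd
  have e2 : (G 1 0 * toComplex l + G 1 1 * toComplex m) * G 0 1 +
      -(G 0 0 * toComplex l + G 0 1 * toComplex m) * G 1 1 = -toComplex l := by
    linear_combination -toComplex l * hd
  rw [e1, e2] at key
  simp only [← Complex.normSq_eq_conj_mul_self, ← sub_eq_add_neg] at key
  norm_cast at key
  unfold cuspDist
  rw [hsm]
  simp only [map_add, map_mul, ← hE]
  rw [UpperHalfSpace.smul_ht] at key ⊢
  rw [div_div_eq_mul_div]
  congr 1
  linear_combination key

lemma isNearestCusp_smul (g : Bianchi) {l m : ℤ√(-2)} {p : UpperHalfSpace}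
    (h : IsNearestCusp l m p) :
    IsNearestCusp (g 0 0 * l + g 0 1 * m) (g 1 0 * l + g 1 1 * m) (g • p) := by
  have hd := bianchi_det g
  refine ⟨?_, fun l' m' h' => ?_⟩
  · obtain ⟨u, v, huv⟩ := h.1
    refine ⟨u * g 1 1 - v * g 1 0, v * g 0 0 - u * g 0 1, ?_⟩
    linear_combination (u * l + v * m) * hd + huv
  · have hc : IsCoprime (g 1 1 * l' - g 0 1 * m') (g 0 0 * m' - g 1 0 * l') := by
      obtain ⟨u, v, huv⟩ := h'
      refine ⟨u * g 0 0 + v * g 1 0, u * g 0 1 + v * g 1 1, ?_⟩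
      linear_combination (u * l' + v * m') * hd + huv
    have e := cuspDist_smul g (g 1 1 * l' - g 0 1 * m') (g 0 0 * m' - g 1 0 * l') p
    have e1 : g 0 0 * (g 1 1 * l' - g 0 1 * m') + g 0 1 * (g 0 0 * m' - g 1 0 * l') = l' := by
      linear_combination l' * hd
    have e2 : g 1 0 * (g 1 1 * l' - g 0 1 * m') + g 1 1 * (g 0 0 * m' - g 1 0 * l') = m' := by
      linear_combination m' * hd
    rw [e1, e2] at e
    rw [cuspDist_smul, e]
    exact h.2 _ _ hc

/-- Mendoza's 2-dimensional `SL₂(ℤ[√-2])`-equivariant retract `X` of hyperbolic 3-space: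
the points that have at least two different nearest cusps. -/
def retractX : SubMulAction Bianchi UpperHalfSpace where
  carrier := {p | ∃ l m l' m' : ℤ√(-2),
    IsNearestCusp l m p ∧ IsNearestCusp l' m' p ∧ l * m' ≠ l' * m}
  smul_mem' g p := by
    rintro ⟨l, m, l', m', h, h', hne⟩
    refine ⟨_, _, _, _, isNearestCusp_smul g h, isNearestCusp_smul g h', fun he => hne ?_⟩
    linear_combination he - (l * m' - l' * m) * bianchi_det g

/-- The orbit space `SL₂(ℤ[√-2])\X`. -/
abbrev BianchiOrbitSpace : Type := MulAction.orbitRel.Quotient Bianchi retractX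

/-- The orbit space `Γ₀(√-2)\X`. -/
abbrev Gamma0OrbitSpace : Type := MulAction.orbitRel.Quotient Gamma0 retractX

lemma id_equivariantAlong_iHom :
    EquivariantAlong iHom (ContinuousMap.id retractX) := fun _ _ => rfl

/-- `i^n : Hⁿ(SL₂(ℤ[√-2])\X; 𝔽₂) → Hⁿ(Γ₀(√-2)\X; 𝔽₂)`, induced by the projection
`Γ₀(√-2)\X → SL₂(ℤ[√-2])\X`. -/
def iStar (n : ℕ) : SingularCohomology n BianchiOrbitSpace →ₗ[ZMod 2]
    SingularCohomology n Gamma0OrbitSpace :=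
  SingularCohomology.map n (orbitSpaceMap iHom (ContinuousMap.id retractX)
    id_equivariantAlong_iHom)

end

/-!
The retract `X` is the `SL₂(ℤ[√-2])`-orbit of its floor, the surface over the plane of the
`x + v√-2` formed by the points whose nearest cusps are `∞` and at least one other. Two points of
the floor in the same orbit differ by translations in `ℤ[√-2]` and possibly a change of the sign
of `x`. Hence `v mod 1` is an invariant of the orbit, and it makes `SL₂(ℤ[√-2])\X` homotopy
equivalent to a circle: the segment `|x| ≤ 1/2` folds up and shrinks. In `Γ₀(√-2)\X` the floor
forms a torus `(x mod 1, v mod 1)`, onto which the remaining part of `Γ₀(√-2)\X` folds up.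

On this torus the projection `Γ₀(√-2)\X → SL₂(ℤ[√-2])\X` is `(x, v) ↦ v`. Given an equivariant `J`,
lift the invariant `v mod 1` to a real function on the simply connected `ℋ³`: since `j` sends the
translation by `u` to a conjugate of the translation by `-u√-2`, the map induced by `J` is
homotopic to `(x, v) ↦ -x`. So `(iⁿ, jⁿ)` is, up to isomorphisms, the map
`(pr₂^*, pr₁^*) : Hⁿ(S¹) ⊕ Hⁿ(S¹) → Hⁿ(S¹ × S¹)`, and the cohomology of `S¹ × Z` is computed by the
long exact sequence of the infinite cyclic cover `ℝ × Z → S¹ × Z`.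
-/

noncomputable section

/-! ### Singular cochains as functions on singular simplices -/

/-- The space of singular `n`-cochains of `Y` with coefficients in `𝔽₂`. -/
abbrev SingularCochain (n : ℕ) (Y : Type) [TopologicalSpace Y] : ModuleCat.{0} (ZMod 2) :=
  (singularCochainFunctor.obj (Opposite.op (TopCat.of Y))).X n

/-- The singular `n`-simplices of `Y`. -/
abbrev SingularSimplex (n : ℕ) (Y : Type) [TopologicalSpace Y] : Type :=
  C(stdSimplex ℝ (Fin (n + 1)), Y)

namespace SingularCochain

variable {Y Z : Type} [TopologicalSpace Y] [TopologicalSpace Z] {n : ℕ}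

/-- A singular cochain is determined by its values on singular simplices, which are arbitrary. -/
def equivFun (n : ℕ) (Y : Type) [TopologicalSpace Y] :
    SingularCochain n Y ≃ₗ[ZMod 2] (SingularSimplex n Y → ZMod 2) where
  toFun φ σ := ((TopCat.toSSet.obj (TopCat.of Y)).ιChainComplex
      ((TopCat.toSSetObjEquiv (TopCat.of Y) (Opposite.op (SimplexCategory.mk n))).symm σ) ≫
    (show ((TopCat.toSSet.obj (TopCat.of Y)).chainComplex (ModuleCat.of (ZMod 2) (ZMod 2))).X n ⟶
      ModuleCat.of (ZMod 2) (ZMod 2) from φ)).hom (1 : ZMod 2)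
  map_add' _ _ := rfl
  map_smul' _ _ := rfl
  invFun u := Limits.Cofan.IsColimit.desc
    ((TopCat.toSSet.obj (TopCat.of Y)).isColimitChainComplexXCofan _ n) fun s =>
      ModuleCat.ofHom (LinearMap.toSpanSingleton (ZMod 2) (ZMod 2)
        (u (TopCat.toSSetObjEquiv _ _ s)))
  left_inv φ := by
    refine SSet.chainComplex_hom_ext (X := TopCat.toSSet.obj (TopCat.of Y))
      (R := ModuleCat.of (ZMod 2) (ZMod 2)) (T := ModuleCat.of (ZMod 2) (ZMod 2)) fun s => ?_
    refine (Limits.Cofan.IsColimit.fac _ _ s).trans ?_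
    apply ModuleCat.hom_ext
    apply LinearMap.ext_ring
    exact (one_smul _ _)
  right_inv u := by
    funext σ
    have fac := Limits.Cofan.IsColimit.fac
      ((TopCat.toSSet.obj (TopCat.of Y)).isColimitChainComplexXCofan
        (ModuleCat.of (ZMod 2) (ZMod 2)) n)
      (fun s => ModuleCat.ofHom (Y := ModuleCat.of (ZMod 2) (ZMod 2))
        (LinearMap.toSpanSingleton (ZMod 2) (ZMod 2) (u (TopCat.toSSetObjEquiv _ _ s))))
      ((TopCat.toSSetObjEquiv _ (Opposite.op (SimplexCategory.mk n))).symm σ)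
    refine (congrArg (fun f => f.hom (1 : ZMod 2)) fac).trans ?_
    exact (one_smul _ _).trans (congrArg u (Equiv.apply_symm_apply _ _))

lemma equivFun_map (f : C(Y, Z)) (φ : SingularCochain n Z) (σ : SingularSimplex n Y) :
    equivFun n Y (((singularCochainFunctor.map (TopCat.ofHom f).op).f n).hom φ) σ =
      equivFun n Z φ (f.comp σ) :=
  congrArg (fun g => (g ≫ (show ((TopCat.toSSet.obj (TopCat.of Z)).chainComplex
      (ModuleCat.of (ZMod 2) (ZMod 2))).X n ⟶ ModuleCat.of (ZMod 2) (ZMod 2) from φ)).hom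
        (1 : ZMod 2))
    (SSet.ι_chainComplexMap_f _ _ (TopCat.toSSet.map (TopCat.ofHom f))
      (ModuleCat.of (ZMod 2) (ZMod 2)) _)

lemma equivFun_d (φ : SingularCochain n Y) (σ : SingularSimplex (n + 1) Y) :
    equivFun (n + 1) Y
      (((singularCochainFunctor.obj (Opposite.op (TopCat.of Y))).d n (n + 1)).hom φ) σ =
        ∑ i : Fin (n + 2), equivFun n Y φ
          (σ.comp ⟨stdSimplex.map (Fin.succAbove i), stdSimplex.continuous_map _⟩) := by
  refine (congrArg (fun g => (g ≫ (show ((TopCat.toSSet.obj (TopCat.of Y)).chainComplex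
      (ModuleCat.of (ZMod 2) (ZMod 2))).X n ⟶ ModuleCat.of (ZMod 2) (ZMod 2) from φ)).hom
        (1 : ZMod 2))
    (SSet.ιChainComplex_d (R := ModuleCat.of (ZMod 2) (ZMod 2)) (TopCat.toSSet.obj _)
      ((TopCat.toSSetObjEquiv _ (Opposite.op (SimplexCategory.mk (n + 1)))).symm σ))).trans ?_
  rw [Preadditive.sum_comp, ModuleCat.hom_sum, LinearMap.sum_apply]
  refine Finset.sum_congr rfl fun i _ => ?_
  have sign_smul (x : ZMod 2) : (-1 : ℤ) ^ i.val • x = x := by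
    rcases neg_one_pow_eq_or ℤ i.val with h | h <;> simp [h]
  rw [Preadditive.zsmul_comp]
  exact sign_smul _

end SingularCochain

namespace SingularCohomology

variable {Y Z W : Type} [TopologicalSpace Y] [TopologicalSpace Z] [TopologicalSpace W]

lemma map_id (n : ℕ) : map n (ContinuousMap.id Y) = LinearMap.id :=
  congrArg ModuleCat.Hom.hom ((singularCohomologyFunctor n).map_id (Opposite.op (TopCat.of Y)))

lemma map_comp (n : ℕ) (f : C(Y, Z)) (g : C(Z, W)) : map n (g.comp f) = map n f ∘ₗ map n g :=
  congrArg ModuleCat.Hom.hom ((singularCohomologyFunctor n).map_comp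
    (TopCat.ofHom g).op (TopCat.ofHom f).op)

lemma map_map (n : ℕ) (f : C(Y, Z)) (g : C(Z, W)) (x : SingularCohomology n W) :
    map n f (map n g x) = map n (g.comp f) x := by
  rw [map_comp, LinearMap.comp_apply]

lemma map_eq_of_homotopic (n : ℕ) {f g : C(Y, Z)} (h : f.Homotopic g) : map n f = map n g := by
  obtain ⟨H⟩ := h
  have chainHomotopy := TopCat.Homotopy.singularChainComplexFunctorObjMap
    (f := TopCat.ofHom f) (g := TopCat.ofHom g) H (ModuleCat.of (ZMod 2) (ZMod 2))
  have cochainHomotopy := (((linearYoneda (ZMod 2) (ModuleCat.{0} (ZMod 2))).obj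
      (ModuleCat.of (ZMod 2) (ZMod 2))).rightOp.mapHomotopy chainHomotopy).unop
  exact congrArg ModuleCat.Hom.hom (cochainHomotopy.homologyMap_eq n)

/-- Homotopy equivalent spaces have isomorphic cohomology. -/
def congr (n : ℕ) (e : ContinuousMap.HomotopyEquiv Y Z) :
    SingularCohomology n Z ≃ₗ[ZMod 2] SingularCohomology n Y :=
  LinearEquiv.ofLinearMap (map n e.toFun) (map n e.invFun)
    (by rw [← map_comp, map_eq_of_homotopic n e.left_inv, map_id])
    (by rw [← map_comp, map_eq_of_homotopic n e.right_inv, map_id])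

lemma map_bijective (n : ℕ) (e : ContinuousMap.HomotopyEquiv Y Z) :
    Function.Bijective (map n e.toFun) :=
  (congr n e).bijective

end SingularCohomology

/-! ### The covering `ℝ × Z → ℝ/ℤ × Z` -/

lemma exists_lift_unitAddCircle {A : Type} [TopologicalSpace A] [SimplyConnectedSpace A]
    [LocallyPathConnectedSpace A] (f : C(A, UnitAddCircle)) :
    ∃ F : C(A, ℝ), ∀ a, (F a : UnitAddCircle) = f a := by
  obtain ⟨a₀⟩ : Nonempty A := inferInstance
  obtain ⟨t₀, ht₀⟩ := QuotientAddGroup.mk_surjective (f a₀)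
  obtain ⟨F, hF, -⟩ := (AddCircle.isCoveringMap_coe (1 : ℝ)).existsUnique_continuousMap_lifts
    f a₀ t₀ ht₀
  exact ⟨F, congrFun hF.2⟩

lemma unitAddCircle_coe_eq_coe_iff {x y : ℝ} :
    (x : UnitAddCircle) = y ↔ ∃ k : ℤ, x = y + k := by
  refine QuotientAddGroup.eq_iff_sub_mem.trans (AddSubgroup.mem_zmultiples_iff.trans ?_)
  simp only [zsmul_eq_mul, mul_one, sub_eq_iff_eq_add', @eq_comm ℝ _ (x - y)]

lemma exists_eq_add_intCast_of_coe_eq {A : Type} [TopologicalSpace A] [PreconnectedSpace A]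
    [Nonempty A] (F G : C(A, ℝ)) (h : ∀ a, (F a : UnitAddCircle) = G a) :
    ∃ k : ℤ, ∀ a, F a = G a + k := by
  choose k hk using fun a => unitAddCircle_coe_eq_coe_iff.1 (h a)
  have hc : Continuous k := by
    refine Int.isClosedEmbedding_coe_real.isEmbedding.continuous_iff.2 ?_
    have : (Int.cast : ℤ → ℝ) ∘ k = fun a => F a - G a :=
      funext fun a => eq_sub_of_add_eq' (hk a).symm
    rw [this]
    fun_prop
  obtain ⟨a₀⟩ : Nonempty A := inferInstance
  exact ⟨k a₀, fun a => PreconnectedSpace.constant inferInstance hc (x := a) (y := a₀) ▸ hk a⟩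

lemma exists_intCast_sub_eq {M : Type*} [AddCommGroup M] (f : ℤ → M) :
    ∃ w : ℤ → M, ∀ k, w (k + 1) - w k = f k := by
  refine ⟨fun k => ∑ i ∈ Finset.Ico 0 k, f i - ∑ i ∈ Finset.Ico k 0, f i, fun k => ?_⟩
  beta_reduce
  rcases le_or_gt 0 k with hk | hk
  · rw [← Finset.insert_Ico_right_eq_Ico_add_one hk, Finset.sum_insert Finset.right_notMem_Ico,
      Finset.Ico_eq_empty_of_le hk, Finset.Ico_eq_empty_of_le (by omega : 0 ≤ k + 1)]
    simp
  · rw [← Finset.insert_Ico_add_one_left_eq_Ico hk, Finset.sum_insert (by simp),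
      Finset.Ico_eq_empty_of_le hk.le, Finset.Ico_eq_empty_of_le (by omega : k + 1 ≤ 0)]
    simp

instance simplyConnectedSpace_stdSimplex (n : ℕ) :
    SimplyConnectedSpace (stdSimplex ℝ (Fin (n + 1))) :=
  have : ContractibleSpace (stdSimplex ℝ (Fin (n + 1))) :=
    (convex_stdSimplex ℝ (Fin (n + 1))).contractibleSpace (Set.nonempty_coe_sort.1 inferInstance)
  inferInstance

instance locallyPathConnectedSpace_stdSimplex (n : ℕ) :
    LocallyPathConnectedSpace (stdSimplex ℝ (Fin (n + 1))) :=
  (convex_stdSimplex ℝ (Fin (n + 1))).locallyPathConnectedSpace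

section CircleCover

variable (Z : Type) [TopologicalSpace Z]

/-- The covering `ℝ × Z → ℝ/ℤ × Z`. -/
def circleCover : C(ℝ × Z, UnitAddCircle × Z) where
  toFun p := ((p.1 : UnitAddCircle), p.2)
  continuous_toFun := ((AddCircle.continuous_mk' 1).comp continuous_fst).prodMk continuous_snd

/-- The deck transformations of `ℝ × Z → ℝ/ℤ × Z`. -/
def deckTranslation (k : ℤ) : C(ℝ × Z, ℝ × Z) where
  toFun p := (p.1 + k, p.2)
  continuous_toFun := by fun_prop

lemma circleCover_comp_deckTranslation (k : ℤ) :
    (circleCover Z).comp (deckTranslation Z k) = circleCover Z := by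
  ext p
  · exact unitAddCircle_coe_eq_coe_iff.2 ⟨k, rfl⟩
  · rfl

lemma deckTranslation_comp_deckTranslation (k l : ℤ) :
    (deckTranslation Z k).comp (deckTranslation Z l) = deckTranslation Z (l + k) := by
  ext p
  · simp [deckTranslation, add_assoc]
  · rfl

lemma deckTranslation_zero : deckTranslation Z 0 = ContinuousMap.id (ℝ × Z) := by
  ext p <;> simp [deckTranslation]

variable {Z}

lemma exists_circleCover_comp_eq {A : Type} [TopologicalSpace A] [SimplyConnectedSpace A]
    [LocallyPathConnectedSpace A] (σ : C(A, UnitAddCircle × Z)) :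
    ∃ τ : C(A, ℝ × Z), (circleCover Z).comp τ = σ := by
  obtain ⟨F, hF⟩ := exists_lift_unitAddCircle (ContinuousMap.fst.comp σ)
  refine ⟨F.prodMk (ContinuousMap.snd.comp σ), ?_⟩
  ext x
  · exact hF x
  · rfl

lemma exists_eq_deckTranslation_comp {A : Type} [TopologicalSpace A] [PreconnectedSpace A]
    [Nonempty A] {τ τ' : C(A, ℝ × Z)} (h : (circleCover Z).comp τ = (circleCover Z).comp τ') :
    ∃ k : ℤ, τ = (deckTranslation Z k).comp τ' := by
  obtain ⟨k, hk⟩ := exists_eq_add_intCast_of_coe_eq (ContinuousMap.fst.comp τ)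
    (ContinuousMap.fst.comp τ') fun x => congrArg Prod.fst (DFunLike.congr_fun h x)
  refine ⟨k, ?_⟩
  ext x
  · exact hk x
  · exact (congrArg Prod.snd (DFunLike.congr_fun h x) :)

lemma exists_comp_circleCover_eq {A M : Type} [TopologicalSpace A] [SimplyConnectedSpace A]
    [LocallyPathConnectedSpace A] {u : C(A, ℝ × Z) → M}
    (hu : ∀ τ, u ((deckTranslation Z 1).comp τ) = u τ) :
    ∃ v : C(A, UnitAddCircle × Z) → M, ∀ τ, v ((circleCover Z).comp τ) = u τ := by
  have hu_int (k : ℤ) (τ : C(A, ℝ × Z)) : u ((deckTranslation Z k).comp τ) = u τ := by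
    induction k with
    | zero => rw [deckTranslation_zero, ContinuousMap.id_comp]
    | succ k ih =>
      rw [← deckTranslation_comp_deckTranslation, ContinuousMap.comp_assoc, hu, ih]
    | pred k ih =>
      rw [← hu, ← ContinuousMap.comp_assoc, deckTranslation_comp_deckTranslation, sub_add_cancel,
        ih]
  choose lift circleCover_lift using exists_circleCover_comp_eq (A := A) (Z := Z)
  refine ⟨fun σ => u (lift σ), fun τ => ?_⟩
  obtain ⟨k, hk⟩ := exists_eq_deckTranslation_comp (circleCover_lift ((circleCover Z).comp τ))
  exact (congrArg u hk).trans (hu_int k τ)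

lemma exists_comp_deckTranslation_sub_eq {A M : Type} [TopologicalSpace A] [Nonempty A]
    [AddCommGroup M] (u : C(A, ℝ × Z) → M) :
    ∃ v : C(A, ℝ × Z) → M, ∀ τ, v ((deckTranslation Z 1).comp τ) - v τ = u τ := by
  obtain ⟨a⟩ := ‹Nonempty A›
  -- Each `ℤ`-orbit has a unique base point `τ₀` with `⌊τ₀ a⌋ = 0`; sum `u` along the orbit from it.
  let N (τ : C(A, ℝ × Z)) : ℤ := ⌊(τ a).1⌋
  let base (τ : C(A, ℝ × Z)) := (deckTranslation Z (-N τ)).comp τ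
  have N_succ (τ) : N ((deckTranslation Z 1).comp τ) = N τ + 1 := by
    simp [N, deckTranslation]
  have base_succ (τ) : base ((deckTranslation Z 1).comp τ) = base τ := by
    simp only [base, N_succ]
    rw [← ContinuousMap.comp_assoc, deckTranslation_comp_deckTranslation]
    ring_nf
  choose w hw using fun τ => exists_intCast_sub_eq fun k => u ((deckTranslation Z k).comp τ)
  refine ⟨fun τ => w (base τ) (N τ), fun τ => ?_⟩
  simp only [base_succ, N_succ, hw]
  rw [← ContinuousMap.comp_assoc, deckTranslation_comp_deckTranslation, neg_add_cancel,
    deckTranslation_zero, ContinuousMap.id_comp]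

variable (Z) (n : ℕ)

/-- The sequence `C^*(ℝ/ℤ × Z) → C^*(ℝ × Z) → C^*(ℝ × Z)` of singular cochain complexes, whose
second map is the difference of the deck translation by `1` and the identity. -/
def coverShortComplex :
    ShortComplex (HomologicalComplex (ModuleCat.{0} (ZMod 2)) (ComplexShape.down ℕ).symm) where
  X₁ := singularCochainFunctor.obj (Opposite.op (TopCat.of (UnitAddCircle × Z)))
  X₂ := singularCochainFunctor.obj (Opposite.op (TopCat.of (ℝ × Z)))
  X₃ := singularCochainFunctor.obj (Opposite.op (TopCat.of (ℝ × Z)))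
  f := singularCochainFunctor.map (TopCat.ofHom (circleCover Z)).op
  g := singularCochainFunctor.map (TopCat.ofHom (deckTranslation Z 1)).op - 𝟙 _
  zero := by
    rw [Preadditive.comp_sub, Category.comp_id, ← Functor.map_comp, ← op_comp,
      ← TopCat.ofHom_comp, circleCover_comp_deckTranslation, sub_self]

open SingularCochain in
lemma equivFun_coverShortComplex_f (φ : SingularCochain n (UnitAddCircle × Z))
    (τ : SingularSimplex n (ℝ × Z)) :
    equivFun n (ℝ × Z) (((coverShortComplex Z).f.f n).hom φ) τ =
      equivFun n (UnitAddCircle × Z) φ ((circleCover Z).comp τ) :=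
  equivFun_map _ _ _

open SingularCochain in
lemma equivFun_coverShortComplex_g (φ : SingularCochain n (ℝ × Z))
    (τ : SingularSimplex n (ℝ × Z)) :
    equivFun n (ℝ × Z) (((coverShortComplex Z).g.f n).hom φ) τ =
      equivFun n (ℝ × Z) φ ((deckTranslation Z 1).comp τ) - equivFun n (ℝ × Z) φ τ :=
  congrArg (· - equivFun n (ℝ × Z) φ τ) (equivFun_map _ _ _)

lemma coverShortComplex_shortExact : (coverShortComplex Z).ShortExact := by
  refine HomologicalComplex.shortExact_of_degreewise_shortExact _ fun n => ?_
  refine ShortComplex.ShortExact.mk' ?exact ?mono ?epi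
  case exact =>
    rw [ShortComplex.moduleCat_exact_iff]
    intro (φ : SingularCochain n (ℝ × Z)) (hφ : ((coverShortComplex Z).g.f n).hom φ = 0)
    obtain ⟨v, hv⟩ := exists_comp_circleCover_eq (u := SingularCochain.equivFun n _ φ) fun τ => by
      rw [← sub_eq_zero, ← equivFun_coverShortComplex_g]
      exact congrArg (SingularCochain.equivFun n (ℝ × Z) · τ) hφ
    refine ⟨(SingularCochain.equivFun n (UnitAddCircle × Z)).symm v,
      (SingularCochain.equivFun n (ℝ × Z)).injective (funext fun τ => ?_)⟩
    refine (equivFun_coverShortComplex_f Z n _ τ).trans ?_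
    rw [LinearEquiv.apply_symm_apply, hv]
  case mono =>
    rw [ModuleCat.mono_iff_injective]
    refine fun φ ψ h => (SingularCochain.equivFun n (UnitAddCircle × Z)).injective
      (funext fun σ => ?_)
    obtain ⟨τ, rfl⟩ := exists_circleCover_comp_eq σ
    refine (equivFun_coverShortComplex_f Z n φ τ).symm.trans
      (Eq.trans ?_ (equivFun_coverShortComplex_f Z n ψ τ))
    exact congrArg (SingularCochain.equivFun n (ℝ × Z) · τ) h
  case epi =>
    rw [ModuleCat.epi_iff_surjective]
    intro (φ : SingularCochain n (ℝ × Z))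
    obtain ⟨v, hv⟩ := exists_comp_deckTranslation_sub_eq (SingularCochain.equivFun n (ℝ × Z) φ)
    refine ⟨(SingularCochain.equivFun n (ℝ × Z)).symm v,
      (SingularCochain.equivFun n (ℝ × Z)).injective (funext fun τ => ?_)⟩
    refine (equivFun_coverShortComplex_g Z n _ τ).trans ?_
    rw [LinearEquiv.apply_symm_apply, hv]

lemma homologyMap_coverShortComplex_g :
    HomologicalComplex.homologyMap (coverShortComplex Z).g n = 0 := by
  have homotopic : (deckTranslation Z 1).Homotopic (ContinuousMap.id (ℝ × Z)) := by
    refine ⟨⟨⟨fun p => (p.2.1 + (1 - (p.1 : ℝ)), p.2.2), by fun_prop⟩, fun p => ?_, fun p => ?_⟩⟩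
    · simp [deckTranslation]
    · simp
  have homologyMap_eq : HomologicalComplex.homologyMap
      (singularCochainFunctor.map (TopCat.ofHom (deckTranslation Z 1)).op) n =
      HomologicalComplex.homologyMap (𝟙 (coverShortComplex Z).X₃) n := by
    refine ModuleCat.hom_ext ((SingularCohomology.map_eq_of_homotopic n homotopic).trans ?_)
    rw [SingularCohomology.map_id, HomologicalComplex.homologyMap_id]
    rfl
  exact (HomologicalComplex.homologyMap_sub _ _ n).trans (sub_eq_zero.2 homologyMap_eq)

lemma complexShape_rel_succ : (ComplexShape.down ℕ).symm.Rel n (n + 1) := rfl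

/-- The connecting homomorphism of `coverShortComplex Z`. -/
def coverConnecting :
    SingularCohomology n (ℝ × Z) →ₗ[ZMod 2] SingularCohomology (n + 1) (UnitAddCircle × Z) :=
  ((coverShortComplex_shortExact Z).δ n (n + 1) (complexShape_rel_succ n)).hom

lemma coverConnecting_injective : Function.Injective (coverConnecting Z n) := by
  rw [injective_iff_map_eq_zero]
  intro x hx
  have exact₃ :=
    (coverShortComplex_shortExact Z).homology_exact₃ n (n + 1) (complexShape_rel_succ n)
  rw [ShortComplex.moduleCat_exact_iff] at exact₃
  obtain ⟨y, rfl⟩ := exact₃ x hx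
  change (HomologicalComplex.homologyMap (coverShortComplex Z).g n).hom y = 0
  rw [homologyMap_coverShortComplex_g]
  rfl

lemma map_circleCover_eq_zero_iff (x : SingularCohomology (n + 1) (UnitAddCircle × Z)) :
    SingularCohomology.map (n + 1) (circleCover Z) x = 0 ↔ ∃ y, coverConnecting Z n y = x := by
  have exact₁ :=
    (coverShortComplex_shortExact Z).homology_exact₁ n (n + 1) (complexShape_rel_succ n)
  refine ⟨(ShortComplex.moduleCat_exact_iff _).1 exact₁ x, ?_⟩
  rintro ⟨y, rfl⟩
  exact congrArg (fun f => f.hom y) ((coverShortComplex_shortExact Z).δ_comp n (n + 1)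
    (complexShape_rel_succ n))

lemma isIso_homologyπ_zero
    (K : HomologicalComplex (ModuleCat.{0} (ZMod 2)) (ComplexShape.down ℕ).symm) :
    IsIso (K.homologyπ 0) :=
  K.isIso_homologyπ _ 0 rfl (K.shape _ _ fun h => Nat.succ_ne_zero _ h)

lemma map_circleCover_zero_injective :
    Function.Injective (SingularCohomology.map 0 (circleCover Z)) := by
  have := (coverShortComplex_shortExact Z).mono_f
  have := isIso_homologyπ_zero (coverShortComplex Z).X₁
  have := isIso_homologyπ_zero (coverShortComplex Z).X₂
  have mono_homologyπ_comp : Mono ((coverShortComplex Z).X₁.homologyπ 0 ≫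
      HomologicalComplex.homologyMap (coverShortComplex Z).f 0) := by
    rw [HomologicalComplex.homologyπ_naturality (coverShortComplex Z).f 0]
    infer_instance
  have mono_homologyMap : Mono (HomologicalComplex.homologyMap (coverShortComplex Z).f 0) := by
    rw [← IsIso.inv_hom_id_assoc ((coverShortComplex Z).X₁.homologyπ 0)
      (HomologicalComplex.homologyMap (coverShortComplex Z).f 0)]
    infer_instance
  exact (ModuleCat.mono_iff_injective _).1 mono_homologyMap

variable {Z} in
lemma map_coverConnecting {W : Type} [TopologicalSpace W] (f : C(Z, W))
    (y : SingularCohomology n (ℝ × W)) :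
    SingularCohomology.map (n + 1) ((ContinuousMap.id UnitAddCircle).prodMap f)
        (coverConnecting W n y) =
      coverConnecting Z n (SingularCohomology.map n ((ContinuousMap.id ℝ).prodMap f) y) := by
  let φ : coverShortComplex W ⟶ coverShortComplex Z :=
    { τ₁ := singularCochainFunctor.map
        (TopCat.ofHom ((ContinuousMap.id UnitAddCircle).prodMap f)).op
      τ₂ := singularCochainFunctor.map (TopCat.ofHom ((ContinuousMap.id ℝ).prodMap f)).op
      τ₃ := singularCochainFunctor.map (TopCat.ofHom ((ContinuousMap.id ℝ).prodMap f)).op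
      comm₁₂ := by
        dsimp only [coverShortComplex]
        rw [← Functor.map_comp, ← Functor.map_comp]
        rfl
      comm₂₃ := by
        dsimp only [coverShortComplex]
        rw [Preadditive.comp_sub, Preadditive.sub_comp, ← Functor.map_comp, ← Functor.map_comp,
          Category.comp_id, Category.id_comp]
        rfl }
  exact congrArg (fun f => f.hom y) (HomologicalComplex.HomologySequence.δ_naturality φ
    (coverShortComplex_shortExact W) (coverShortComplex_shortExact Z) n (n + 1)
    (complexShape_rel_succ n))

end CircleCover

/-! ### The Künneth formula for a product with the circle -/

section Kunneth

open SingularCohomology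

variable {Z : Type} [TopologicalSpace Z] (n : ℕ)

/-- The projection `ℝ × Z → Z` is a homotopy equivalence. -/
def realProdHomotopyEquiv (Z : Type) [TopologicalSpace Z] :
    ContinuousMap.HomotopyEquiv (ℝ × Z) Z where
  toFun := ContinuousMap.snd
  invFun := (ContinuousMap.const Z 0).prodMk (ContinuousMap.id Z)
  left_inv := by
    refine ⟨⟨⟨fun p => ((p.1 : ℝ) * p.2.1, p.2.2), by fun_prop⟩, fun p => ?_, fun p => ?_⟩⟩ <;> simp
  right_inv := ContinuousMap.Homotopic.refl _

/-- The inclusion `Z → ℝ/ℤ × Z` of the fibre over `0`. -/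
def circleFiber (Z : Type) [TopologicalSpace Z] : C(Z, UnitAddCircle × Z) :=
  (ContinuousMap.const Z 0).prodMk (ContinuousMap.id Z)

lemma map_circleFiber_map_snd (x : SingularCohomology n Z) :
    map n (circleFiber Z) (map n ContinuousMap.snd x) = x := by
  rw [map_map]
  exact congrArg (fun f => f x) (map_id n)

lemma map_snd_map_circleFiber (x : SingularCohomology n (UnitAddCircle × Z)) :
    map n (ContinuousMap.snd : C(ℝ × Z, Z)) (map n (circleFiber Z) x) =
      map n (circleCover Z) x := by
  have h := congrArg (fun f => f (map n (circleCover Z) x))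
    (map_eq_of_homotopic n (realProdHomotopyEquiv Z).left_inv)
  simp only [map_id, map_map, LinearMap.id_apply] at h
  rw [← h, map_map]
  rfl

/-- The degree-raising component of the Künneth formula for `ℝ/ℤ × Z`: the connecting homomorphism
of the covering `ℝ × Z → ℝ/ℤ × Z`, with `ℝ × Z` contracted to `Z`. -/
def circleCross (Z : Type) [TopologicalSpace Z] (n : ℕ) :
    SingularCohomology n Z →ₗ[ZMod 2] SingularCohomology (n + 1) (UnitAddCircle × Z) :=
  coverConnecting Z n ∘ₗ map n ContinuousMap.snd

lemma circleCross_injective : Function.Injective (circleCross Z n) :=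
  (coverConnecting_injective Z n).comp (map_bijective n (realProdHomotopyEquiv Z)).1

lemma map_circleFiber_eq_zero_iff (x : SingularCohomology (n + 1) (UnitAddCircle × Z)) :
    map (n + 1) (circleFiber Z) x = 0 ↔ ∃ y, circleCross Z n y = x := by
  have snd_bijective (m : ℕ) := map_bijective m (realProdHomotopyEquiv Z)
  refine (map_eq_zero_iff _ (snd_bijective (n + 1)).1).symm.trans ?_
  refine (iff_of_eq (congrArg (· = 0) (map_snd_map_circleFiber (n + 1) x))).trans ?_
  exact (map_circleCover_eq_zero_iff Z n x).trans (snd_bijective n).2.exists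

lemma map_circleCross {W : Type} [TopologicalSpace W] (f : C(Z, W)) (y : SingularCohomology n W) :
    map (n + 1) ((ContinuousMap.id UnitAddCircle).prodMap f) (circleCross W n y) =
      circleCross Z n (map n f y) := by
  simp only [circleCross, LinearMap.comp_apply, map_coverConnecting, map_map]
  rfl

lemma coprod_map_snd_circleCross_bijective (Z : Type) [TopologicalSpace Z] (n : ℕ) :
    Function.Bijective ((map (n + 1) (ContinuousMap.snd : C(UnitAddCircle × Z, Z))).coprod
      (circleCross Z n)) := by
  have map_circleFiber_circleCross (y) : map (n + 1) (circleFiber Z) (circleCross Z n y) = 0 :=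
    (map_circleFiber_eq_zero_iff n _).2 ⟨y, rfl⟩
  refine ⟨(injective_iff_map_eq_zero _).2 ?_, fun z => ?_⟩
  · rintro ⟨x, y⟩ h
    rw [LinearMap.coprod_apply] at h
    obtain rfl : x = 0 := by
      simpa only [map_add, map_circleFiber_map_snd, map_circleFiber_circleCross, add_zero,
        map_zero] using congrArg (map (n + 1) (circleFiber Z)) h
    rw [map_zero, zero_add] at h
    obtain rfl : y = 0 := (map_eq_zero_iff _ (circleCross_injective n)).1 h
    rfl
  · set x := map (n + 1) (circleFiber Z) z with hx
    obtain ⟨y, hy⟩ := (map_circleFiber_eq_zero_iff n (z - map (n + 1) ContinuousMap.snd x)).1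
      (by rw [map_sub, map_circleFiber_map_snd, hx, sub_self])
    exact ⟨(x, y), by rw [LinearMap.coprod_apply, hy, add_sub_cancel]⟩

lemma map_snd_circle_zero_bijective (Z : Type) [TopologicalSpace Z] :
    Function.Bijective (map 0 (ContinuousMap.snd : C(UnitAddCircle × Z, Z))) := by
  refine ⟨Function.LeftInverse.injective (map_circleFiber_map_snd 0), fun x =>
    ⟨map 0 (circleFiber Z) x, map_circleCover_zero_injective Z ?_⟩⟩
  rw [← map_snd_map_circleFiber, ← map_snd_map_circleFiber, map_circleFiber_map_snd]

lemma circleCross_bijective (Z : Type) [TopologicalSpace Z] (n : ℕ)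
    [Subsingleton (SingularCohomology (n + 1) Z)] : Function.Bijective (circleCross Z n) := by
  refine ⟨circleCross_injective n, fun z => ?_⟩
  exact (map_circleFiber_eq_zero_iff n z).1 (Subsingleton.elim _ _)

instance subsingleton_cohomology_circle_prod (Z : Type) [TopologicalSpace Z] (n : ℕ)
    [Subsingleton (SingularCohomology n Z)] [Subsingleton (SingularCohomology (n + 1) Z)] :
    Subsingleton (SingularCohomology (n + 1) (UnitAddCircle × Z)) :=
  (coprod_map_snd_circleCross_bijective Z n).2.subsingleton

end Kunneth

section Point

open SingularCochain

variable {n : ℕ}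

lemma equivFun_d_of_subsingleton {Y : Type} [TopologicalSpace Y] [Subsingleton Y]
    (φ : SingularCochain n Y) (σ : SingularSimplex (n + 1) Y) (τ : SingularSimplex n Y) :
    equivFun (n + 1) Y
        (((singularCochainFunctor.obj (Opposite.op (TopCat.of Y))).d n (n + 1)).hom φ) σ =
      n * equivFun n Y φ τ := by
  rw [equivFun_d, Finset.sum_congr rfl fun i _ => congrArg (equivFun n Y φ)
    (Subsingleton.elim _ τ)]
  simp only [Finset.sum_const, Finset.card_univ, Fintype.card_fin, nsmul_eq_mul, Nat.cast_add]
  rw [show ((2 : ℕ) : ZMod 2) = 0 from rfl, add_zero]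

instance subsingleton_cohomology_unit : Subsingleton (SingularCohomology (n + 1) Unit) := by
  set K := singularCochainFunctor.obj (Opposite.op (TopCat.of Unit))
  suffices K.ExactAt (n + 1) from ModuleCat.subsingleton_of_isZero this.isZero_homology
  rw [K.exactAt_iff' n (n + 1) (n + 2) (ComplexShape.prev_eq' _ (complexShape_rel_succ n))
    (ComplexShape.next_eq' _ (complexShape_rel_succ (n + 1))), ShortComplex.moduleCat_exact_iff]
  intro (φ : SingularCochain (n + 1) Unit) (hφ : (K.d (n + 1) (n + 2)).hom φ = 0)
  have equivFun_eq_zero (σ) : ((n + 1 : ℕ) : ZMod 2) * equivFun (n + 1) Unit φ σ = 0 :=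
    (equivFun_d_of_subsingleton φ (ContinuousMap.const _ ()) σ).symm.trans
      (congrArg (equivFun (n + 2) Unit · _) hφ)
  rcases Nat.even_or_odd n with hn | hn
  · simp only [ZMod.natCast_eq_one_iff_odd.2 hn.add_one, one_mul] at equivFun_eq_zero
    have : φ = 0 := (equivFun (n + 1) Unit).injective (funext equivFun_eq_zero)
    exact ⟨0, (map_zero _).trans this.symm⟩
  · let u := equivFun (n + 1) Unit φ (ContinuousMap.const _ ())
    refine ⟨(equivFun n Unit).symm fun _ => u,
      (equivFun (n + 1) Unit).injective (funext fun σ => ?_)⟩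
    refine (equivFun_d_of_subsingleton _ σ (ContinuousMap.const _ ())).trans ?_
    rw [ZMod.natCast_eq_one_iff_odd.2 hn, one_mul, LinearEquiv.apply_symm_apply,
      Subsingleton.elim σ (ContinuousMap.const _ ())]

/-- `H⁰` of a point. -/
def cohomologyZeroUnitEquiv : SingularCohomology 0 Unit ≃ₗ[ZMod 2] ZMod 2 :=
  let K := singularCochainFunctor.obj (Opposite.op (TopCat.of Unit))
  have d_zero_one : K.d 0 1 = 0 := by
    ext (φ : SingularCochain 0 Unit)
    refine (equivFun 1 Unit).injective (funext fun σ => ?_)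
    refine (equivFun_d_of_subsingleton φ σ (ContinuousMap.const _ ())).trans ?_
    rw [Nat.cast_zero, zero_mul]
    rfl
  have := isIso_homologyπ_zero K
  have := K.isIso_iCycles 0 1 (ComplexShape.next_eq' _ (complexShape_rel_succ 0)) d_zero_one
  let homologyIso : K.homology 0 ≅ K.X 0 := (asIso (K.homologyπ 0)).symm ≪≫ asIso (K.iCycles 0)
  have : Unique (SingularSimplex 0 Unit) := uniqueOfSubsingleton (ContinuousMap.const _ ())
  homologyIso.toLinearEquiv ≪≫ₗ equivFun 0 Unit ≪≫ₗ LinearEquiv.funUnique _ _ _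

end Point

section Torus

open SingularCohomology

variable (n : ℕ)

lemma map_fst_unit_bijective (Y : Type) [TopologicalSpace Y] :
    Function.Bijective (map n (ContinuousMap.fst : C(Y × Unit, Y))) :=
  map_bijective n (Homeomorph.prodPUnit Y).toHomotopyEquiv

instance subsingleton_cohomology_circle : Subsingleton (SingularCohomology (n + 2) UnitAddCircle) :=
  (map_fst_unit_bijective (n + 2) UnitAddCircle).1.subsingleton

/-- `H⁰` of the circle. -/
def cohomologyZeroCircleEquiv : SingularCohomology 0 UnitAddCircle ≃ₗ[ZMod 2] ZMod 2 :=
  LinearEquiv.ofBijective _ (map_fst_unit_bijective 0 UnitAddCircle) ≪≫ₗ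
    (LinearEquiv.ofBijective _ (map_snd_circle_zero_bijective Unit)).symm ≪≫ₗ
    cohomologyZeroUnitEquiv

/-- `H¹` of the circle. -/
def cohomologyOneCircleEquiv : SingularCohomology 1 UnitAddCircle ≃ₗ[ZMod 2] ZMod 2 :=
  LinearEquiv.ofBijective _ (map_fst_unit_bijective 1 UnitAddCircle) ≪≫ₗ
    (LinearEquiv.ofBijective _ (circleCross_bijective Unit 0)).symm ≪≫ₗ cohomologyZeroUnitEquiv

/-- `H²` of the torus. -/
def cohomologyTwoTorusEquiv :
    SingularCohomology 2 (UnitAddCircle × UnitAddCircle) ≃ₗ[ZMod 2] ZMod 2 :=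
  (LinearEquiv.ofBijective _ (circleCross_bijective UnitAddCircle 1)).symm ≪≫ₗ
    cohomologyOneCircleEquiv

/-- The sum `(x, y) ↦ pr₂^* x + pr₁^* y` of the pullbacks along the projections of the torus. -/
def torusPullback : SingularCohomology n UnitAddCircle × SingularCohomology n UnitAddCircle
    →ₗ[ZMod 2] SingularCohomology n (UnitAddCircle × UnitAddCircle) :=
  (SingularCohomology.map n ContinuousMap.snd).coprod (SingularCohomology.map n ContinuousMap.fst)

lemma map_fst_torus_zero_bijective :
    Function.Bijective
      (map 0 (ContinuousMap.fst : C(UnitAddCircle × UnitAddCircle, UnitAddCircle))) := by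
  have swap_bijective :=
    map_bijective 0 (Homeomorph.prodComm UnitAddCircle UnitAddCircle).toHomotopyEquiv
  have := swap_bijective.comp (map_snd_circle_zero_bijective UnitAddCircle)
  rwa [← LinearMap.coe_comp, ← map_comp] at this

/-- With `c` the constant map from the circle to the point, `H¹(pt) = 0` and naturality of
`circleCross` identify `pr₁^*` with the composite of `circleCross` and `c^* : H⁰(pt) ≅ H⁰(S¹)`. -/
lemma torusPullback_one_bijective : Function.Bijective (torusPullback 1) := by
  let c : C(UnitAddCircle, Unit) := ContinuousMap.const _ ()
  have c_bijective : Function.Bijective (SingularCohomology.map 0 c) := by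
    rw [← (map_fst_unit_bijective 0 UnitAddCircle).of_comp_iff', ← LinearMap.coe_comp, ← map_comp]
    exact map_snd_circle_zero_bijective Unit
  let e := LinearEquiv.ofBijective _ (circleCross_bijective Unit 0) ≪≫ₗ
    (LinearEquiv.ofBijective _ (map_fst_unit_bijective 1 UnitAddCircle)).symm
  have fst_cross (a : SingularCohomology 0 Unit) :
      SingularCohomology.map 1 (ContinuousMap.fst : C(UnitAddCircle × UnitAddCircle, _)) (e a) =
        circleCross UnitAddCircle 0 (SingularCohomology.map 0 c a) := by
    rw [← map_circleCross, ← show _ = circleCross Unit 0 a from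
      LinearEquiv.apply_symm_apply (.ofBijective _ (map_fst_unit_bijective 1 UnitAddCircle)) _,
      LinearEquiv.ofBijective_apply, map_map]
    rfl
  have factor : torusPullback 1 ∘ Prod.map id e =
      (SingularCohomology.map 1 ContinuousMap.snd).coprod (circleCross UnitAddCircle 0) ∘
        Prod.map id (SingularCohomology.map 0 c) := by
    funext ⟨x, a⟩
    simp only [torusPullback, Function.comp_apply, Prod.map_apply, id_eq, LinearMap.coprod_apply,
      fst_cross]
  rw [← (Function.bijective_id.prodMap e.bijective).of_comp_iff, factor]
  exact (coprod_map_snd_circleCross_bijective UnitAddCircle 0).comp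
    (Function.bijective_id.prodMap c_bijective)

lemma torusPullback_injective (hn : n ≠ 0) : Function.Injective (torusPullback n) := by
  match n, hn with
  | 1, _ => exact torusPullback_one_bijective.1
  | n + 2, _ => exact Function.injective_of_subsingleton _

lemma torusPullback_surjective (hn : n ≠ 2) : Function.Surjective (torusPullback n) := by
  match n, hn with
  | 0, _ =>
    intro z
    obtain ⟨y, rfl⟩ := map_fst_torus_zero_bijective.2 z
    exact ⟨(0, y), by rw [torusPullback, LinearMap.coprod_apply, map_zero, zero_add]⟩
  | 1, _ => exact torusPullback_one_bijective.2
  | n + 3, _ => exact Function.surjective_to_subsingleton _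

/-- The kernel in degree `0`: every class on the left component cancels against a unique class on
the right one. -/
def kerTorusPullbackEquiv : LinearMap.ker (torusPullback 0) ≃ₗ[ZMod 2] ZMod 2 :=
  LinearEquiv.ofBijective
    (LinearMap.fst (ZMod 2) _ _ ∘ₗ (LinearMap.ker (torusPullback 0)).subtype)
    (by
      constructor
      · rw [← LinearMap.ker_eq_bot, LinearMap.ker_eq_bot']
        rintro ⟨⟨_, y⟩, hy⟩ rfl
        rw [LinearMap.mem_ker, torusPullback, LinearMap.coprod_apply, map_zero, zero_add] at hy
        rw [map_eq_zero_iff _ map_fst_torus_zero_bijective.1] at hy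
        exact Subtype.ext (Prod.ext rfl hy)
      · intro x
        obtain ⟨y, hy⟩ := map_fst_torus_zero_bijective.2 (-SingularCohomology.map 0 .snd x)
        exact ⟨⟨(x, y), by
          rw [LinearMap.mem_ker, torusPullback, LinearMap.coprod_apply, hy, add_neg_cancel]⟩, rfl⟩)
    ≪≫ₗ cohomologyZeroCircleEquiv

/-- The cokernel in degree `2`: all of `H²` of the torus, as `H²` of the circle vanishes. -/
def cokerTorusPullbackEquiv :
    (SingularCohomology 2 (UnitAddCircle × UnitAddCircle) ⧸ LinearMap.range (torusPullback 2))
      ≃ₗ[ZMod 2] ZMod 2 :=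
  Submodule.quotEquivOfEqBot _ (LinearMap.range_eq_bot.2 (Subsingleton.elim _ _)) ≪≫ₗ
    cohomologyTwoTorusEquiv

end Torus

/-! ### Coordinates on the upper half-space -/

namespace UpperHalfSpace

/-- The coordinate `x` of a point with `z = x + v√-2`. -/
def xCoord (p : UpperHalfSpace) : ℝ := p.z.re

/-- The coordinate `v` of a point with `z = x + v√-2`. -/
def vCoord (p : UpperHalfSpace) : ℝ := p.z.im / Real.sqrt 2

lemma im_z (p : UpperHalfSpace) : p.z.im = Real.sqrt 2 * p.vCoord := by
  unfold vCoord
  field_simp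

lemma ext_coord {p q : UpperHalfSpace} (hx : p.xCoord = q.xCoord) (hv : p.vCoord = q.vCoord)
    (ht : p.ht = q.ht) : p = q :=
  ext' (Complex.ext hx (by rw [im_z, im_z, hv])) ht

lemma continuous_z : Continuous z := continuous_fst.comp continuous_subtype_val

lemma continuous_ht : Continuous ht := continuous_snd.comp continuous_subtype_val

lemma continuous_xCoord : Continuous xCoord := Complex.continuous_re.comp continuous_z

lemma continuous_vCoord : Continuous vCoord := (Complex.continuous_im.comp continuous_z).div_const _

instance : ContinuousConstSMul (Matrix.SpecialLinearGroup (Fin 2) ℂ) UpperHalfSpace where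
  continuous_const_smul g := by
    have := continuous_z
    have := continuous_ht
    have := Complex.continuous_normSq
    have continuous_num : Continuous (num g) := by unfold num; fun_prop
    have continuous_den : Continuous (den g) := by unfold den; fun_prop
    exact ((continuous_num.div (Complex.continuous_ofReal.comp continuous_den)
      fun p => Complex.ofReal_ne_zero.2 (den_pos g p).ne').prodMk
        (continuous_ht.div continuous_den fun p => (den_pos g p).ne')).subtype_mk _

instance : ContinuousConstSMul Bianchi UpperHalfSpace :=
  ⟨fun g => continuous_const_smul (Matrix.SpecialLinearGroup.map (n := Fin 2) toComplex g)⟩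

lemma toComplex_re (c : ℤ√(-2)) : (toComplex c).re = c.re := by
  simp [toComplex, Zsqrtd.lift]

lemma toComplex_im (c : ℤ√(-2)) : (toComplex c).im = Real.sqrt 2 * c.im := by
  simp [toComplex, Zsqrtd.lift, mul_comm]

lemma zsqrtd_norm_eq (c : ℤ√(-2)) : c.norm = c.re ^ 2 + 2 * c.im ^ 2 := by
  rw [Zsqrtd.norm]
  ring

lemma normSq_toComplex (c : ℤ√(-2)) : Complex.normSq (toComplex c) = c.norm := by
  have sqrt_two_sq : Real.sqrt 2 * Real.sqrt 2 = 2 := Real.mul_self_sqrt (by norm_num)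
  rw [Complex.normSq_apply, toComplex_re, toComplex_im, zsqrtd_norm_eq]
  push_cast
  linear_combination (c.im : ℝ) ^ 2 * sqrt_two_sq

/-- The coordinate `x` of `cz + d = x + v√-2`. -/
def rowX (c d : ℤ√(-2)) (p : UpperHalfSpace) : ℝ :=
  c.re * p.xCoord - 2 * c.im * p.vCoord + d.re

/-- The coordinate `v` of `cz + d = x + v√-2`. -/
def rowV (c d : ℤ√(-2)) (p : UpperHalfSpace) : ℝ :=
  c.re * p.vCoord + c.im * p.xCoord + d.im

lemma toComplex_mul_z_add (c d : ℤ√(-2)) (p : UpperHalfSpace) :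
    toComplex c * p.z + toComplex d = ⟨rowX c d p, Real.sqrt 2 * rowV c d p⟩ := by
  have sqrt_two_sq : Real.sqrt 2 * Real.sqrt 2 = 2 := Real.mul_self_sqrt (by norm_num)
  have re_z : p.z.re = p.xCoord := rfl
  apply Complex.ext
  · simp only [Complex.add_re, Complex.mul_re, toComplex_re, toComplex_im, im_z, re_z, rowX]
    linear_combination (-c.im * p.vCoord : ℝ) * sqrt_two_sq
  · simp only [Complex.add_im, Complex.mul_im, toComplex_re, toComplex_im, im_z, re_z, rowV]
    ring

/-- `|cz + d|² + |c|²ζ²`: the squared norm of the row `(c, d)` in the Hermitian form attached to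
the point `(z, ζ)`. Up to the factor `ζ` it is the distance to the cusp `-d/c`. -/
def rowForm (c d : ℤ√(-2)) (p : UpperHalfSpace) : ℝ :=
  Complex.normSq (toComplex c * p.z + toComplex d) + p.ht ^ 2 * Complex.normSq (toComplex c)

lemma rowForm_eq (c d : ℤ√(-2)) (p : UpperHalfSpace) :
    rowForm c d p = rowX c d p ^ 2 + 2 * rowV c d p ^ 2 + c.norm * p.ht ^ 2 := by
  have sqrt_two_sq : Real.sqrt 2 * Real.sqrt 2 = 2 := Real.mul_self_sqrt (by norm_num)
  rw [rowForm, normSq_toComplex, toComplex_mul_z_add, Complex.normSq_mk]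
  linear_combination rowV c d p ^ 2 * sqrt_two_sq

lemma continuous_rowForm (c d : ℤ√(-2)) : Continuous (rowForm c d) := by
  have := continuous_z
  have := continuous_ht
  have := Complex.continuous_normSq
  unfold rowForm
  fun_prop

lemma rowForm_zero_one (p : UpperHalfSpace) : rowForm 0 1 p = 1 := by
  simp [rowForm]

lemma rowForm_one_zero (p : UpperHalfSpace) :
    rowForm 1 0 p = p.xCoord ^ 2 + 2 * p.vCoord ^ 2 + p.ht ^ 2 := by
  simp [rowForm_eq, rowX, rowV]

lemma rowForm_neg (c d : ℤ√(-2)) (p : UpperHalfSpace) : rowForm (-c) (-d) p = rowForm c d p := by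
  rw [rowForm, map_neg, map_neg, neg_mul, ← neg_add, Complex.normSq_neg, Complex.normSq_neg,
    rowForm]

lemma cuspDist_eq (l m : ℤ√(-2)) (p : UpperHalfSpace) :
    cuspDist l m p = rowForm m (-l) p / p.ht := by
  rw [cuspDist, rowForm, map_neg, ← sub_eq_add_neg, mul_comm (p.ht ^ 2)]

lemma rowForm_smul (g : Bianchi) (c d : ℤ√(-2)) (p : UpperHalfSpace) :
    rowForm c d (g • p) * rowForm (g 1 0) (g 1 1) p =
      rowForm (c * g 0 0 + d * g 1 0) (c * g 0 1 + d * g 1 1) p := by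
  have := form_smul (Matrix.SpecialLinearGroup.map (n := Fin 2) toComplex g) p
    (toComplex c) (toComplex d)
  simp only [← Complex.normSq_eq_conj_mul_self] at this
  norm_cast at this
  rw [mul_comm]
  simp only [rowForm, map_add, map_mul]
  exact this

lemma rowForm_mul (g h : Bianchi) (p : UpperHalfSpace) :
    rowForm ((g * h) 1 0) ((g * h) 1 1) p =
      rowForm (g 1 0) (g 1 1) (h • p) * rowForm (h 1 0) (h 1 1) p := by
  rw [rowForm_smul, mul_entry, mul_entry]

lemma rowForm_row_pos (g : Bianchi) (p : UpperHalfSpace) : 0 < rowForm (g 1 0) (g 1 1) p :=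
  den_pos (Matrix.SpecialLinearGroup.map (n := Fin 2) toComplex g) p

lemma ht_smul (g : Bianchi) (p : UpperHalfSpace) :
    (g • p).ht = p.ht / rowForm (g 1 0) (g 1 1) p := rfl

lemma num_coord (g : Bianchi) (p : UpperHalfSpace) :
    num (Matrix.SpecialLinearGroup.map (n := Fin 2) toComplex g) p =
    ⟨rowX (g 1 0) (g 1 1) p * rowX (g 0 0) (g 0 1) p +
        2 * rowV (g 1 0) (g 1 1) p * rowV (g 0 0) (g 0 1) p +
        p.ht ^ 2 * ((g 1 0).re * (g 0 0).re + 2 * (g 1 0).im * (g 0 0).im),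
      Real.sqrt 2 * (rowX (g 1 0) (g 1 1) p * rowV (g 0 0) (g 0 1) p -
        rowV (g 1 0) (g 1 1) p * rowX (g 0 0) (g 0 1) p +
        p.ht ^ 2 * ((g 1 0).re * (g 0 0).im - (g 1 0).im * (g 0 0).re))⟩ := by
  have sqrt_two_sq : Real.sqrt 2 * Real.sqrt 2 = 2 := Real.mul_self_sqrt (by norm_num)
  have map_apply (i j) : Matrix.SpecialLinearGroup.map (n := Fin 2) toComplex g i j =
    toComplex (g i j) := rfl
  rw [num]
  simp only [map_apply, toComplex_mul_z_add]
  rw [← Complex.ofReal_pow]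
  apply Complex.ext <;> simp only [Complex.add_re, Complex.add_im, Complex.mul_re, Complex.mul_im,
    Complex.conj_re, Complex.conj_im, Complex.ofReal_re, Complex.ofReal_im, toComplex_re,
    toComplex_im]
  · linear_combination (rowV (g 1 0) (g 1 1) p * rowV (g 0 0) (g 0 1) p +
      p.ht ^ 2 * (g 1 0).im * (g 0 0).im) * sqrt_two_sq
  · ring

lemma xCoord_smul (g : Bianchi) (p : UpperHalfSpace) :
    (g • p).xCoord = (rowX (g 1 0) (g 1 1) p * rowX (g 0 0) (g 0 1) p +
      2 * rowV (g 1 0) (g 1 1) p * rowV (g 0 0) (g 0 1) p +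
      p.ht ^ 2 * ((g 1 0).re * (g 0 0).re + 2 * (g 1 0).im * (g 0 0).im)) /
        rowForm (g 1 0) (g 1 1) p := by
  change (num (Matrix.SpecialLinearGroup.map (n := Fin 2) toComplex g) p /
    ((rowForm (g 1 0) (g 1 1) p : ℝ) : ℂ)).re = _
  rw [Complex.div_ofReal_re, num_coord]

lemma vCoord_smul (g : Bianchi) (p : UpperHalfSpace) :
    (g • p).vCoord = (rowX (g 1 0) (g 1 1) p * rowV (g 0 0) (g 0 1) p -
      rowV (g 1 0) (g 1 1) p * rowX (g 0 0) (g 0 1) p +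
      p.ht ^ 2 * ((g 1 0).re * (g 0 0).im - (g 1 0).im * (g 0 0).re)) /
        rowForm (g 1 0) (g 1 1) p := by
  change (num (Matrix.SpecialLinearGroup.map (n := Fin 2) toComplex g) p /
    ((rowForm (g 1 0) (g 1 1) p : ℝ) : ℂ)).im / Real.sqrt 2 = _
  rw [Complex.div_ofReal_im, num_coord]
  field_simp

lemma bianchi_neg_smul (g : Bianchi) (p : UpperHalfSpace) : (-g) • p = g • p := by
  have neg_apply (i j) : (-g) i j = -g i j := rfl
  apply ext_coord
  · simp only [xCoord_smul, neg_apply, rowForm_neg, rowX, rowV, Zsqrtd.re_neg, Zsqrtd.im_neg,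
      Int.cast_neg]
    ring
  · simp only [vCoord_smul, neg_apply, rowForm_neg, rowX, rowV, Zsqrtd.re_neg, Zsqrtd.im_neg,
      Int.cast_neg]
    ring
  · simp only [ht_smul, neg_apply, rowForm_neg]

/-! ### Nearest cusps -/

/-- The row `(c, d)` is shortest among the coprime rows, i.e. the cusp `-d/c` is nearest to `p`. -/
def IsMinimalRow (c d : ℤ√(-2)) (p : UpperHalfSpace) : Prop :=
  ∀ a b : ℤ√(-2), IsCoprime a b → rowForm c d p ≤ rowForm a b p

/-- The cusp `∞` is nearest to `p`. -/
abbrev AboveFloor (p : UpperHalfSpace) : Prop := IsMinimalRow 0 1 p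

lemma aboveFloor_iff (p : UpperHalfSpace) :
    AboveFloor p ↔ ∀ c d : ℤ√(-2), IsCoprime c d → 1 ≤ rowForm c d p := by
  simp only [AboveFloor, IsMinimalRow, rowForm_zero_one]

lemma isMinimalRow_iff_forall_bianchi {c d : ℤ√(-2)} {p : UpperHalfSpace} :
    IsMinimalRow c d p ↔ ∀ k : Bianchi, rowForm c d p ≤ rowForm (k 1 0) (k 1 1) p := by
  refine ⟨fun h k => h _ _ (k.isCoprime_row 1), fun h a b hab => ?_⟩
  obtain ⟨k, rfl, rfl⟩ := hab.exists_SL2_row 1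
  exact h k

lemma aboveFloor_smul_iff (g : Bianchi) (p : UpperHalfSpace) :
    AboveFloor (g • p) ↔ IsMinimalRow (g 1 0) (g 1 1) p := by
  rw [AboveFloor, isMinimalRow_iff_forall_bianchi, isMinimalRow_iff_forall_bianchi,
    rowForm_zero_one]
  refine (Equiv.mulRight g).forall_congr fun k => ?_
  rw [Equiv.coe_mulRight, rowForm_mul, le_mul_iff_one_le_left (rowForm_row_pos g p)]

lemma isClosed_setOf_isMinimalRow (c d : ℤ√(-2)) : IsClosed {p | IsMinimalRow c d p} := by
  simp only [IsMinimalRow, Set.ofPred_forall]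
  exact isClosed_iInter fun a => isClosed_iInter fun b => isClosed_iInter fun _ =>
    isClosed_le (continuous_rowForm c d) (continuous_rowForm a b)

lemma finite_setOf_norm_le (M : ℝ) : {c : ℤ√(-2) | (c.norm : ℝ) ≤ M}.Finite := by
  refine Set.Finite.of_injOn (f := fun c : ℤ√(-2) => (c.re, c.im)) (fun c hc => ?_)
    (fun c _ d _ h => Zsqrtd.ext (congrArg Prod.fst h) (congrArg Prod.snd h))
    ((Set.finite_Icc (-⌈M⌉) ⌈M⌉).prod (Set.finite_Icc (-⌈M⌉) ⌈M⌉))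
  have norm_le : c.norm ≤ ⌈M⌉ := by exact_mod_cast le_trans hc (Int.le_ceil M)
  rw [zsqrtd_norm_eq] at norm_le
  refine ⟨⟨?_, ?_⟩, ⟨?_, ?_⟩⟩ <;> nlinarith [Int.le_self_sq c.re, Int.le_self_sq c.im,
    Int.le_self_sq (-c.re), Int.le_self_sq (-c.im)]

lemma norm_le_of_rowForm_le_one {c d : ℤ√(-2)} {p : UpperHalfSpace} (h : rowForm c d p ≤ 1)
    {ε B : ℝ} (hε : 0 < ε) (hp : ε ≤ p.ht) (hB : Complex.normSq p.z ≤ B) :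
    (c.norm : ℝ) ≤ 1 / ε ^ 2 ∧ (d.norm : ℝ) ≤ 2 + 2 * (1 / ε ^ 2 * B) := by
  have height_nonneg : 0 ≤ p.ht ^ 2 * Complex.normSq (toComplex c) :=
    mul_nonneg (sq_nonneg _) (Complex.normSq_nonneg _)
  have norm_c_le : (c.norm : ℝ) ≤ 1 / ε ^ 2 := by
    rw [← normSq_toComplex, le_div_iff₀ (by positivity), mul_comm]
    calc ε ^ 2 * Complex.normSq (toComplex c) ≤ p.ht ^ 2 * Complex.normSq (toComplex c) := by
          have := Complex.normSq_nonneg (toComplex c)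
          gcongr
      _ ≤ rowForm c d p := le_add_of_nonneg_left (Complex.normSq_nonneg _)
      _ ≤ 1 := h
  have normSq_row_le : Complex.normSq (toComplex c * p.z + toComplex d) ≤ 1 :=
    (le_add_of_nonneg_right height_nonneg).trans h
  have normSq_mul_le : Complex.normSq (toComplex c * p.z) ≤ 1 / ε ^ 2 * B := by
    rw [map_mul, normSq_toComplex]
    have := Complex.normSq_nonneg p.z
    gcongr
  have parallelogram (w : ℂ) : Complex.normSq (toComplex d) ≤
      2 * Complex.normSq (w + toComplex d) + 2 * Complex.normSq w := by
    simp only [Complex.normSq_apply, Complex.add_re, Complex.add_im]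
    nlinarith [sq_nonneg ((toComplex d).re + 2 * w.re), sq_nonneg ((toComplex d).im + 2 * w.im)]
  refine ⟨norm_c_le, ?_⟩
  rw [← normSq_toComplex d]
  linarith [parallelogram (toComplex c * p.z)]

lemma finite_setOf_rowForm_le_one {ε B : ℝ} (hε : 0 < ε) :
    {r : ℤ√(-2) × ℤ√(-2) | ∃ p : UpperHalfSpace, ε ≤ p.ht ∧ Complex.normSq p.z ≤ B ∧
      rowForm r.1 r.2 p ≤ 1}.Finite := by
  refine ((finite_setOf_norm_le (1 / ε ^ 2)).prod
    (finite_setOf_norm_le (2 + 2 * (1 / ε ^ 2 * B)))).subset ?_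
  rintro ⟨c, d⟩ ⟨p, le_ht, normSq_le, rowForm_le⟩
  exact norm_le_of_rowForm_le_one rowForm_le hε le_ht normSq_le

lemma exists_isMinimalRow (p : UpperHalfSpace) : ∃ c d, IsCoprime c d ∧ IsMinimalRow c d p := by
  have finite_rows : {r : ℤ√(-2) × ℤ√(-2) | IsCoprime r.1 r.2 ∧ rowForm r.1 r.2 p ≤ 1}.Finite :=
    (finite_setOf_rowForm_le_one p.ht_pos).subset fun r hr => ⟨p, le_rfl, le_rfl, hr.2⟩
  obtain ⟨⟨c, d⟩, ⟨coprime, rowForm_le⟩, minimal⟩ :=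
    finite_rows.exists_minimalFor (fun r => rowForm r.1 r.2 p) _
      ⟨(0, 1), isCoprime_zero_left.2 isUnit_one, (rowForm_zero_one p).le⟩
  refine ⟨c, d, coprime, fun a b hab => ?_⟩
  by_cases h : rowForm a b p ≤ 1
  · exact (le_total (rowForm c d p) (rowForm a b p)).elim id (@minimal (a, b) ⟨hab, h⟩)
  · exact rowForm_le.trans (not_le.1 h).le

lemma locallyFinite_isMinimalRow :
    LocallyFinite fun r : ℤ√(-2) × ℤ√(-2) => {p | IsMinimalRow r.1 r.2 p} := by
  intro p
  refine ⟨{q | p.ht / 2 < q.ht ∧ Complex.normSq q.z < Complex.normSq p.z + 1},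
    IsOpen.mem_nhds ?_ ⟨half_lt_self p.ht_pos, lt_add_one _⟩,
    (finite_setOf_rowForm_le_one (ε := p.ht / 2) (B := Complex.normSq p.z + 1)
      (half_pos p.ht_pos)).subset ?_⟩
  · exact (isOpen_lt continuous_const continuous_ht).inter
      (isOpen_lt (Complex.continuous_normSq.comp continuous_z) continuous_const)
  · rintro ⟨c, d⟩ ⟨q, minimal, lt_ht, normSq_lt⟩
    exact ⟨q, lt_ht.le, normSq_lt.le,
      (minimal 0 1 (isCoprime_zero_left.2 isUnit_one)).trans_eq (rowForm_zero_one q)⟩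

lemma exists_aboveFloor_smul (p : UpperHalfSpace) : ∃ g : Bianchi, AboveFloor (g • p) := by
  obtain ⟨c, d, coprime, minimal⟩ := exists_isMinimalRow p
  obtain ⟨g, rfl, rfl⟩ := coprime.exists_SL2_row 1
  exact ⟨g, (aboveFloor_smul_iff g p).2 minimal⟩

lemma exists_glue {Y : Type} [TopologicalSpace Y] (ψ : Bianchi → UpperHalfSpace → Y)
    (hψ : ∀ g, Continuous (ψ g))
    (compatible : ∀ (g k : Bianchi) (p : UpperHalfSpace), AboveFloor p → AboveFloor (k • p) →
      ψ (k * g) (k • p) = ψ g p) :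
    ∃ Φ : C(UpperHalfSpace, Y), ∀ (g : Bianchi) (p : UpperHalfSpace), AboveFloor (g • p) →
      Φ p = ψ g (g • p) := by
  choose rep aboveFloor_rep using exists_aboveFloor_smul
  have independent (g : Bianchi) (p : UpperHalfSpace) (hg : AboveFloor (g • p)) :
      ψ (rep p) (rep p • p) = ψ g (g • p) := by
    have := compatible g (rep p * g⁻¹) (g • p) hg (by
      rw [mul_smul, inv_smul_smul]
      exact aboveFloor_rep p)
    rwa [mul_smul, inv_smul_smul, inv_mul_cancel_right] at this
  refine ⟨⟨fun p => ψ (rep p) (rep p • p), ?_⟩, independent⟩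
  refine (locallyFinite_isMinimalRow.comp_injective (Subtype.val_injective
    (p := fun r : ℤ√(-2) × ℤ√(-2) => IsCoprime r.1 r.2))).continuous
      (Set.eq_univ_of_forall fun p => ?_) (fun r => isClosed_setOf_isMinimalRow _ _) fun r => ?_
  · obtain ⟨c, d, coprime, minimal⟩ := exists_isMinimalRow p
    exact Set.mem_iUnion.2 ⟨⟨(c, d), coprime⟩, minimal⟩
  · obtain ⟨g, bottom_left, bottom_right⟩ := r.2.exists_SL2_row 1
    refine ContinuousOn.congr ((hψ g).comp (continuous_const_smul g)).continuousOn fun p hp => ?_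
    refine independent g p ((aboveFloor_smul_iff g p).2 ?_)
    rw [bottom_left, bottom_right]
    exact hp

end UpperHalfSpace

/-! ### The floor -/

/-- The distance to the nearest integer. -/
def intDist (x : ℝ) : ℝ := ‖(x : UnitAddCircle)‖

lemma intDist_eq (x : ℝ) : intDist x = |x - round x| := UnitAddCircle.norm_eq

lemma continuous_intDist : Continuous intDist :=
  continuous_norm.comp (AddCircle.continuous_mk' 1)

lemma intDist_add_int (x : ℝ) (n : ℤ) : intDist (x + n) = intDist x := by
  rw [intDist, unitAddCircle_coe_eq_coe_iff.2 ⟨n, rfl⟩, intDist]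

lemma intDist_neg (x : ℝ) : intDist (-x) = intDist x := by
  rw [intDist, AddCircle.coe_neg, norm_neg, intDist]

lemma intDist_nonneg (x : ℝ) : 0 ≤ intDist x := norm_nonneg _

lemma intDist_le_half (x : ℝ) : intDist x ≤ 1 / 2 := by
  rw [intDist_eq]
  exact abs_sub_round x

lemma intDist_of_abs_le {x : ℝ} (h : |x| ≤ 1 / 2) : intDist x = |x| :=
  (AddCircle.norm_coe_eq_abs_iff (1 : ℝ) one_ne_zero).2 (by rwa [abs_one])

/-- The squared height of the floor, the boundary of the region of points to which the cusp `∞`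
is nearest, above `z = x + v√-2`. -/
def floorSq (x v : ℝ) : ℝ := 1 - intDist x ^ 2 - 2 * intDist v ^ 2

lemma floorSq_pos (x v : ℝ) : 0 < floorSq x v := by
  have := intDist_nonneg x
  have := intDist_nonneg v
  have := intDist_le_half x
  have := intDist_le_half v
  unfold floorSq
  nlinarith

lemma continuous_floorSq : Continuous fun q : ℝ × ℝ => floorSq q.1 q.2 := by
  unfold floorSq
  have := continuous_intDist
  fun_prop

lemma floorSq_add_int (x v : ℝ) (n m : ℤ) : floorSq (x + n) (v + m) = floorSq x v := by
  rw [floorSq, floorSq, intDist_add_int, intDist_add_int]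

lemma floorSq_neg (x v : ℝ) : floorSq (-x) v = floorSq x v := by
  rw [floorSq, floorSq, intDist_neg]

lemma floorSq_of_abs_le {x v : ℝ} (hx : |x| ≤ 1 / 2) (hv : |v| ≤ 1 / 2) :
    floorSq x v = 1 - x ^ 2 - 2 * v ^ 2 := by
  rw [floorSq, intDist_of_abs_le hx, intDist_of_abs_le hv, sq_abs, sq_abs]

namespace UpperHalfSpace

/-- The translation `z ↦ z + u`. -/
def translation (u : ℤ√(-2)) : Bianchi := ⟨!![1, u; 0, 1], by simp [Matrix.det_fin_two_of]⟩

/-- The inversion `z ↦ -1/z`. -/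
def inversion : Bianchi := ⟨!![0, -1; 1, 0], by simp [Matrix.det_fin_two_of]⟩

/-- The half-turn about the geodesic `{x + √-2/2 : x² + ζ² = 1/2}`, which lies on the floor. -/
def floorRotation : Bianchi := ⟨!![1, -Zsqrtd.sqrtd; -Zsqrtd.sqrtd, -1], by
  rw [Matrix.det_fin_two_of]
  ext <;> simp⟩

@[simp] lemma translation_00 (u : ℤ√(-2)) : translation u 0 0 = 1 := rfl
@[simp] lemma translation_01 (u : ℤ√(-2)) : translation u 0 1 = u := rfl
@[simp] lemma translation_10 (u : ℤ√(-2)) : translation u 1 0 = 0 := rfl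
@[simp] lemma translation_11 (u : ℤ√(-2)) : translation u 1 1 = 1 := rfl
@[simp] lemma inversion_00 : inversion 0 0 = 0 := rfl
@[simp] lemma inversion_01 : inversion 0 1 = -1 := rfl
@[simp] lemma inversion_10 : inversion 1 0 = 1 := rfl
@[simp] lemma inversion_11 : inversion 1 1 = 0 := rfl
@[simp] lemma floorRotation_00 : floorRotation 0 0 = 1 := rfl
@[simp] lemma floorRotation_01 : floorRotation 0 1 = -Zsqrtd.sqrtd := rfl
@[simp] lemma floorRotation_10 : floorRotation 1 0 = -Zsqrtd.sqrtd := rfl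
@[simp] lemma floorRotation_11 : floorRotation 1 1 = -1 := rfl

@[simp] lemma xCoord_translation_smul (u : ℤ√(-2)) (p : UpperHalfSpace) :
    (translation u • p).xCoord = p.xCoord + u.re := by
  simp [xCoord_smul, rowX, rowV, rowForm_zero_one]

@[simp] lemma vCoord_translation_smul (u : ℤ√(-2)) (p : UpperHalfSpace) :
    (translation u • p).vCoord = p.vCoord + u.im := by
  simp [vCoord_smul, rowX, rowV, rowForm_zero_one]

@[simp] lemma ht_translation_smul (u : ℤ√(-2)) (p : UpperHalfSpace) :
    (translation u • p).ht = p.ht := by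
  simp [ht_smul, rowForm_zero_one]

lemma inversion_smul_of_rowForm_eq_one {p : UpperHalfSpace} (h : rowForm 1 0 p = 1) :
    (inversion • p).xCoord = -p.xCoord ∧ (inversion • p).vCoord = p.vCoord ∧
      (inversion • p).ht = p.ht := by
  simp [xCoord_smul, vCoord_smul, ht_smul, h, rowX, rowV]

lemma floorRotation_smul_of_aboveFloor {p : UpperHalfSpace} (hp : AboveFloor p)
    (h : rowForm (-Zsqrtd.sqrtd) (-1) p = 1) : floorRotation • p = p := by
  rw [aboveFloor_iff] at hp
  have one_le_zero := hp 1 0 isCoprime_one_left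
  have one_le_sqrt := hp 1 (-Zsqrtd.sqrtd) isCoprime_one_left
  have vCoord_eq : p.vCoord = 1 / 2 := by
    simp [rowForm_eq, zsqrtd_norm_eq, rowX, rowV] at h one_le_zero one_le_sqrt
    nlinarith
  have floor_eq : p.xCoord ^ 2 + p.ht ^ 2 = 1 / 2 := by
    simp [rowForm_eq, zsqrtd_norm_eq, rowX, rowV, vCoord_eq] at h
    linarith
  apply ext_coord
  · rw [xCoord_smul, floorRotation_10, floorRotation_11, h]
    simp [rowX, rowV, vCoord_eq]
    ring
  · rw [vCoord_smul, floorRotation_10, floorRotation_11, h]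
    simp [rowX, rowV, vCoord_eq]
    linear_combination floor_eq
  · rw [ht_smul, floorRotation_10, floorRotation_11, h, div_one]

lemma abs_add_abs_lt_norm_add_norm {c d : ℤ√(-2)} (h : c ≠ 0 ∨ d ≠ 0) :
    |c.re * d.re + 2 * c.im * d.im| + 2 * |c.re * d.im - c.im * d.re| < c.norm + d.norm := by
  have abs_eq_sign_mul (m : ℤ) : ∃ e : ℤ, e ^ 2 = 1 ∧ |m| = e * m :=
    (abs_choice m).elim (fun hm => ⟨1, by norm_num, by rw [hm, one_mul]⟩)
      fun hm => ⟨-1, by norm_num, by rw [hm, neg_one_mul]⟩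
  obtain ⟨e, he, abs_re⟩ := abs_eq_sign_mul (c.re * d.re + 2 * c.im * d.im)
  obtain ⟨f, hf, abs_im⟩ := abs_eq_sign_mul (c.re * d.im - c.im * d.re)
  rw [abs_re, abs_im]
  by_contra! hle
  have sum_sq : (2 * d.re - e * c.re + 2 * f * c.im) ^ 2 +
      2 * (2 * d.im - e * c.im - f * c.re) ^ 2 + c.norm ≤ 0 := by
    rw [zsqrtd_norm_eq, zsqrtd_norm_eq] at *
    linear_combination 4 * hle + (c.re ^ 2 + 2 * c.im ^ 2) * he +
      (2 * c.re ^ 2 + 4 * c.im ^ 2) * hf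
  have c_eq_zero : c = 0 := (Zsqrtd.norm_eq_zero_iff (by norm_num) c).1 <|
    le_antisymm (by nlinarith) (Zsqrtd.norm_nonneg (by norm_num) c)
  have d_eq_zero : d = 0 := (Zsqrtd.norm_eq_zero_iff (by norm_num) d).1 <|
    le_antisymm (by simpa [c_eq_zero] using hle) (Zsqrtd.norm_nonneg (by norm_num) d)
  exact h.elim (· c_eq_zero) (· d_eq_zero)

lemma rowForm_eq_expand (c d : ℤ√(-2)) (p : UpperHalfSpace) :
    rowForm c d p = c.norm * (p.xCoord ^ 2 + 2 * p.vCoord ^ 2 + p.ht ^ 2) + d.norm +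
      2 * p.xCoord * (c.re * d.re + 2 * c.im * d.im : ℤ) +
      4 * p.vCoord * (c.re * d.im - c.im * d.re : ℤ) := by
  rw [rowForm_eq, rowX, rowV, zsqrtd_norm_eq, zsqrtd_norm_eq]
  push_cast
  ring

lemma one_le_rowForm_of_abs_le {c d : ℤ√(-2)} (h : IsCoprime c d) {p : UpperHalfSpace}
    (hx : |p.xCoord| ≤ 1 / 2) (hv : |p.vCoord| ≤ 1 / 2)
    (ht : 1 - p.xCoord ^ 2 - 2 * p.vCoord ^ 2 ≤ p.ht ^ 2) : 1 ≤ rowForm c d p := by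
  have integral := Int.add_one_le_iff.2 (abs_add_abs_lt_norm_add_norm h.ne_zero_or_ne_zero)
  have norm_nonneg : (0 : ℝ) ≤ c.norm := Int.cast_nonneg (Zsqrtd.norm_nonneg (by norm_num) c)
  rw [rowForm_eq_expand]
  generalize (c.re * d.re + 2 * c.im * d.im : ℤ) = A at *
  generalize (c.re * d.im - c.im * d.re : ℤ) = B at *
  rify at integral
  have mul_ge {r : ℝ} (hr : |r| ≤ 1 / 2) (m : ℝ) : -(1 / 2 * |m|) ≤ r * m :=
    (abs_le.1 ((abs_mul r m).trans_le (by gcongr))).1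
  nlinarith [mul_ge hx A, mul_ge hv B]

lemma aboveFloor_translation_smul_iff (u : ℤ√(-2)) (p : UpperHalfSpace) :
    AboveFloor (translation u • p) ↔ AboveFloor p := by
  rw [aboveFloor_smul_iff, translation_10, translation_11]

lemma exists_abs_translation_smul_le (p : UpperHalfSpace) :
    ∃ u : ℤ√(-2), |(translation u • p).xCoord| ≤ 1 / 2 ∧ |(translation u • p).vCoord| ≤ 1 / 2 := by
  refine ⟨⟨-round p.xCoord, -round p.vCoord⟩, ?_, ?_⟩
  · rw [xCoord_translation_smul, Int.cast_neg, ← sub_eq_add_neg]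
    exact abs_sub_round _
  · rw [vCoord_translation_smul, Int.cast_neg, ← sub_eq_add_neg]
    exact abs_sub_round _

lemma floorSq_translation_smul (u : ℤ√(-2)) (p : UpperHalfSpace) :
    floorSq (translation u • p).xCoord (translation u • p).vCoord = floorSq p.xCoord p.vCoord := by
  rw [xCoord_translation_smul, vCoord_translation_smul, floorSq_add_int]

lemma aboveFloor_iff_floorSq_le (p : UpperHalfSpace) :
    AboveFloor p ↔ floorSq p.xCoord p.vCoord ≤ p.ht ^ 2 := by
  obtain ⟨u, hx, hv⟩ := exists_abs_translation_smul_le p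
  rw [← aboveFloor_translation_smul_iff u, ← floorSq_translation_smul u, ← ht_translation_smul u p,
    floorSq_of_abs_le hx hv]
  refine ⟨fun h => ?_, fun h => (aboveFloor_iff _).2 fun c d hcd =>
    one_le_rowForm_of_abs_le hcd hx hv h⟩
  have := (aboveFloor_iff _).1 h 1 0 isCoprime_one_left
  rw [rowForm_one_zero] at this
  linarith

/-- The point of the floor above `z = x + v√-2`. -/
def floorPoint (x v : ℝ) : UpperHalfSpace :=
  ⟨(⟨x, Real.sqrt 2 * v⟩, Real.sqrt (floorSq x v)), Real.sqrt_pos.2 (floorSq_pos x v)⟩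

@[simp] lemma xCoord_floorPoint (x v : ℝ) : (floorPoint x v).xCoord = x := rfl

@[simp] lemma vCoord_floorPoint (x v : ℝ) : (floorPoint x v).vCoord = v :=
  mul_div_cancel_left₀ v (by positivity : Real.sqrt 2 ≠ 0)

lemma ht_floorPoint (x v : ℝ) : (floorPoint x v).ht = Real.sqrt (floorSq x v) := rfl

lemma ht_floorPoint_sq (x v : ℝ) : (floorPoint x v).ht ^ 2 = floorSq x v :=
  Real.sq_sqrt (floorSq_pos x v).le

lemma continuous_floorPoint : Continuous fun q : ℝ × ℝ => floorPoint q.1 q.2 :=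
  ((Complex.equivRealProdCLM.symm.continuous.comp
    (continuous_fst.prodMk (continuous_const.mul continuous_snd))).prodMk
      (Real.continuous_sqrt.comp continuous_floorSq)).subtype_mk _

lemma aboveFloor_floorPoint (x v : ℝ) : AboveFloor (floorPoint x v) := by
  rw [aboveFloor_iff_floorSq_le, ht_floorPoint_sq, xCoord_floorPoint, vCoord_floorPoint]

lemma floorPoint_eq {p : UpperHalfSpace} (h : p.ht ^ 2 = floorSq p.xCoord p.vCoord) :
    floorPoint p.xCoord p.vCoord = p := by
  refine ext_coord (xCoord_floorPoint _ _) (vCoord_floorPoint _ _) ?_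
  rw [ht_floorPoint, ← h, Real.sqrt_sq p.ht_pos.le]

lemma ht_sq_eq_floorSq_of_rowForm_eq_one {p : UpperHalfSpace} (hp : AboveFloor p) {c d : ℤ√(-2)}
    (hcd : IsCoprime c d) (hc : c ≠ 0) (h : rowForm c d p = 1) :
    p.ht ^ 2 = floorSq p.xCoord p.vCoord := by
  refine le_antisymm ?_ ((aboveFloor_iff_floorSq_le p).1 hp)
  have norm_pos : (0 : ℝ) < c.norm := Int.cast_pos.2 <|
    (Zsqrtd.norm_nonneg (by norm_num) c).lt_of_ne'
      ((Zsqrtd.norm_eq_zero_iff (by norm_num) c).not.2 hc)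
  have le_floor := (aboveFloor_iff _).1 (aboveFloor_floorPoint p.xCoord p.vCoord) c d hcd
  rw [← h, rowForm_eq, rowForm_eq, ht_floorPoint_sq] at le_floor
  simp only [rowX, rowV, xCoord_floorPoint, vCoord_floorPoint, add_le_add_iff_left] at le_floor
  exact le_of_mul_le_mul_left le_floor norm_pos

lemma translation_smul_floorPoint (u : ℤ√(-2)) (x v : ℝ) :
    translation u • floorPoint x v = floorPoint (x + u.re) (v + u.im) := by
  apply ext_coord
  · simp
  · simp
  · rw [ht_translation_smul, ht_floorPoint, ht_floorPoint, floorSq_add_int]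

lemma inversion_smul_floorPoint {x v : ℝ} (hx : |x| ≤ 1 / 2) (hv : |v| ≤ 1 / 2) :
    inversion • floorPoint x v = floorPoint (-x) v := by
  have rowForm_eq_one : rowForm 1 0 (floorPoint x v) = 1 := by
    rw [rowForm_one_zero, ht_floorPoint_sq, xCoord_floorPoint, vCoord_floorPoint,
      floorSq_of_abs_le hx hv]
    ring
  obtain ⟨xCoord_eq, vCoord_eq, ht_eq⟩ := inversion_smul_of_rowForm_eq_one rowForm_eq_one
  apply ext_coord
  · rw [xCoord_eq, xCoord_floorPoint, xCoord_floorPoint]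
  · rw [vCoord_eq, vCoord_floorPoint, vCoord_floorPoint]
  · rw [ht_eq, ht_floorPoint, ht_floorPoint, floorSq_neg]

end UpperHalfSpace

/-! ### Functions on the floor compatible with the group -/

namespace UpperHalfSpace

/-- Reduction modulo `√-2`. -/
def residue : ℤ√(-2) →+* ZMod 2 := Zsqrtd.lift ⟨0, rfl⟩

lemma residue_apply (c : ℤ√(-2)) : residue c = (c.re : ZMod 2) := by
  simp [residue, Zsqrtd.lift]

/-- Families `φ a c` of functions of the floor coordinates, labelled by columns `(a, c)` over `𝔽₂`,
that are invariant under the translations and the inversion, which act on the labels through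
reduction modulo `√-2`. A single function corresponds to a constant family. A function of points
of the floor that is only `Γ₀(√-2)`-invariant gives a family when the label records the coset, since
the cosets of `Γ₀(√-2)` correspond to the nonzero columns. -/
structure IsFloorCompatible {Y : Type*} (φ : ZMod 2 → ZMod 2 → ℝ → ℝ → Y) : Prop where
  shift_one : ∀ a c x v, φ (a + c) c (x + 1) v = φ a c x v
  shift_sqrt : ∀ a c x v, φ a c x (v + 1) = φ a c x v
  flip : ∀ a c x v, |x| ≤ 1 / 2 → |v| ≤ 1 / 2 → φ c a (-x) v = φ a c x v

/-- The family `φ` is invariant under the passage from `p` to `k • p`. -/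
def IsCompatibleAt {Y : Type*} (φ : ZMod 2 → ZMod 2 → ℝ → ℝ → Y) (k : Bianchi)
    (p : UpperHalfSpace) : Prop :=
  ∀ a c, φ (residue (k 0 0) * a + residue (k 0 1) * c) (residue (k 1 0) * a + residue (k 1 1) * c)
    (k • p).xCoord (k • p).vCoord = φ a c p.xCoord p.vCoord

variable {Y : Type*} {φ : ZMod 2 → ZMod 2 → ℝ → ℝ → Y} {k l : Bianchi} {p : UpperHalfSpace}

lemma IsCompatibleAt.mul (hl : IsCompatibleAt φ l (k • p)) (hk : IsCompatibleAt φ k p) :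
    IsCompatibleAt φ (l * k) p := by
  intro a c
  rw [← hk a c, ← hl, mul_smul]
  simp only [mul_entry, map_add, map_mul]
  congr 1 <;> ring

lemma isCompatibleAt_neg_iff : IsCompatibleAt φ (-k) p ↔ IsCompatibleAt φ k p := by
  simp only [IsCompatibleAt, bianchi_neg_smul, Matrix.SpecialLinearGroup.coe_neg, Matrix.neg_apply,
    map_neg, ZMod.neg_eq_self_mod_two]

namespace IsFloorCompatible

lemma shift (hφ : IsFloorCompatible φ) (a c : ZMod 2) (x v : ℝ) (n m : ℤ) :
    φ (a + n * c) c (x + n) (v + m) = φ a c x v := by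
  have periodic_sqrt (a x) : Function.Periodic (φ a c x) 1 := hφ.shift_sqrt a c x
  have periodic_one : Function.Periodic (fun q : ZMod 2 × ℝ => φ q.1 c q.2 v) (c, 1) :=
    fun q => hφ.shift_one q.1 c q.2 v
  calc φ (a + n * c) c (x + n) (v + m) = φ (a + n * c) c (x + n) v := by
        simpa using (periodic_sqrt (a + n * c) (x + n)).int_mul m v
    _ = φ a c x v := by simpa using periodic_one.zsmul n (a, x)

lemma isCompatibleAt_translation (hφ : IsFloorCompatible φ) (u : ℤ√(-2)) (p : UpperHalfSpace) :
    IsCompatibleAt φ (translation u) p := by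
  intro a c
  rw [xCoord_translation_smul, vCoord_translation_smul, ← hφ.shift a c p.xCoord p.vCoord u.re u.im]
  simp [residue_apply]

lemma isCompatibleAt_inversion (hφ : IsFloorCompatible φ) (hp : AboveFloor p)
    (h : rowForm 1 0 p = 1) : IsCompatibleAt φ inversion p := by
  intro a c
  obtain ⟨xCoord_eq, vCoord_eq, -⟩ := inversion_smul_of_rowForm_eq_one h
  have one_le (d : ℤ√(-2)) : 1 ≤ rowForm 1 d p := (aboveFloor_iff p).1 hp 1 d isCoprime_one_left
  have one_le_one := one_le 1
  have one_le_neg_one := one_le (-1)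
  have one_le_sqrt := one_le Zsqrtd.sqrtd
  have one_le_neg_sqrt := one_le (-Zsqrtd.sqrtd)
  rw [rowForm_eq_expand] at h one_le_one one_le_neg_one one_le_sqrt one_le_neg_sqrt
  simp [zsqrtd_norm_eq] at h one_le_one one_le_neg_one one_le_sqrt one_le_neg_sqrt
  have hx : |p.xCoord| ≤ 1 / 2 := abs_le.2 ⟨by linarith, by linarith⟩
  have hv : |p.vCoord| ≤ 1 / 2 := abs_le.2 ⟨by linarith, by linarith⟩
  rw [xCoord_eq, vCoord_eq, ← hφ.flip a c _ _ hx hv]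
  simp

end IsFloorCompatible

lemma isCompatibleAt_floorRotation (h : floorRotation • p = p) :
    IsCompatibleAt φ floorRotation p := by
  intro a c
  rw [h]
  simp [residue_apply]

lemma bianchi_ext (h00 : k 0 0 = l 0 0) (h01 : k 0 1 = l 0 1) (h10 : k 1 0 = l 1 0)
    (h11 : k 1 1 = l 1 1) : k = l := by
  ext i j : 1
  fin_cases i <;> fin_cases j <;> assumption

lemma rowForm_row_eq_one (hp : AboveFloor p) (hk : AboveFloor (k • p)) :
    rowForm (k 1 0) (k 1 1) p = 1 := by
  refine le_antisymm ?_ ((aboveFloor_iff p).1 hp _ _ (k.isCoprime_row 1))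
  have := (aboveFloor_smul_iff k p).1 hk 0 1 (isCoprime_zero_left.2 isUnit_one)
  rwa [rowForm_zero_one] at this

lemma rowForm_translation_smul (c d u : ℤ√(-2)) (p : UpperHalfSpace) :
    rowForm c d (translation u • p) = rowForm c (c * u + d) p := by
  simpa [rowForm_zero_one] using rowForm_smul (translation u) c d p

lemma ne_zero_of_add_eq_abs_add_abs {M N A B : ℤ} (hM : 3 ≤ M) (hmul : A ^ 2 + 2 * B ^ 2 = M * N)
    (hadd : M + N = |A| + 2 * |B| + 1) : A ≠ 0 ∧ B ≠ 0 := by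
  have sq_eq : (M + N - 1) ^ 2 = A ^ 2 + 4 * |A * B| + 4 * B ^ 2 := by
    rw [hadd, ← sq_abs A, ← sq_abs B, abs_mul]
    ring
  constructor
  · rintro rfl
    rw [zero_mul, abs_zero] at sq_eq
    nlinarith [sq_nonneg (N - 1)]
  · rintro rfl
    rw [mul_zero, abs_zero] at sq_eq
    nlinarith [sq_nonneg (2 * N + M - 2)]

lemma abs_coord_eq_half_of_rowForm_eq_one {c d : ℤ√(-2)} (hcd : IsCoprime c d)
    (hx : |p.xCoord| ≤ 1 / 2) (hv : |p.vCoord| ≤ 1 / 2)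
    (hfloor : p.xCoord ^ 2 + 2 * p.vCoord ^ 2 + p.ht ^ 2 = 1) (h : rowForm c d p = 1)
    (hc : 3 ≤ c.norm) : |p.xCoord| = 1 / 2 ∧ |p.vCoord| = 1 / 2 := by
  have integral := Int.add_one_le_iff.2 (abs_add_abs_lt_norm_add_norm hcd.ne_zero_or_ne_zero)
  rw [rowForm_eq_expand, hfloor, mul_one] at h
  have norm_mul_norm : (c.re * d.re + 2 * c.im * d.im) ^ 2 +
      2 * (c.re * d.im - c.im * d.re) ^ 2 = c.norm * d.norm := by
    rw [zsqrtd_norm_eq, zsqrtd_norm_eq]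
    ring
  generalize c.re * d.re + 2 * c.im * d.im = A at *
  generalize c.re * d.im - c.im * d.re = B at *
  have integral' : |(A : ℝ)| + 2 * |(B : ℝ)| + 1 ≤ c.norm + d.norm := by exact_mod_cast integral
  have hA := neg_le_of_abs_le (abs_mul p.xCoord A).le
  have hB := neg_le_of_abs_le (abs_mul p.vCoord B).le
  have slackA : 0 ≤ (1 / 2 - |p.xCoord|) * |(A : ℝ)| := mul_nonneg (by linarith) (abs_nonneg _)
  have slackB : 0 ≤ (1 / 2 - |p.vCoord|) * |(B : ℝ)| := mul_nonneg (by linarith) (abs_nonneg _)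
  have norm_add_norm : c.norm + d.norm = |A| + 2 * |B| + 1 := by
    have : (c.norm + d.norm : ℝ) = |(A : ℝ)| + 2 * |(B : ℝ)| + 1 := by linarith
    exact_mod_cast this
  obtain ⟨hA0, hB0⟩ := ne_zero_of_add_eq_abs_add_abs hc norm_mul_norm norm_add_norm
  have eqA : (1 / 2 - |p.xCoord|) * |(A : ℝ)| = 0 := by linarith
  have eqB : (1 / 2 - |p.vCoord|) * |(B : ℝ)| = 0 := by linarith
  rw [mul_eq_zero_iff_right (by simpa using hA0)] at eqA
  rw [mul_eq_zero_iff_right (by simpa using hB0)] at eqB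
  constructor <;> linarith

lemma exists_eq_half_add_intCast {x : ℝ} {m : ℤ} (h : |x + m| = 1 / 2) :
    ∃ n : ℤ, x = 1 / 2 + n := by
  rcases (abs_eq (by norm_num)).1 h with h | h
  · exact ⟨-m, by push_cast; linarith⟩
  · exact ⟨-m - 1, by push_cast; linarith⟩

lemma exists_coord_eq_half_add_intCast {c d : ℤ√(-2)} (hcd : IsCoprime c d) (hp : AboveFloor p)
    (h : rowForm c d p = 1) (hc : 3 ≤ c.norm) :
    ∃ n m : ℤ, p.xCoord = 1 / 2 + n ∧ p.vCoord = 1 / 2 + m := by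
  obtain ⟨u, hx, hv⟩ := exists_abs_translation_smul_le p
  have hcd' : IsCoprime c (d + c * -u) := hcd.add_mul_left_right (-u)
  have h' : rowForm c (d + c * -u) (translation u • p) = 1 := by
    rw [rowForm_translation_smul, ← h]
    congr 1
    ring
  have hc0 : c ≠ 0 := by
    rintro rfl
    simp at hc
  have hfloor := ht_sq_eq_floorSq_of_rowForm_eq_one
    ((aboveFloor_translation_smul_iff u p).2 hp) hcd' hc0 h'
  rw [floorSq_of_abs_le hx hv] at hfloor
  obtain ⟨hx', hv'⟩ := abs_coord_eq_half_of_rowForm_eq_one hcd' hx hv (by linarith) h' hc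
  rw [xCoord_translation_smul] at hx'
  rw [vCoord_translation_smul] at hv'
  obtain ⟨n, hn⟩ := exists_eq_half_add_intCast hx'
  obtain ⟨m, hm⟩ := exists_eq_half_add_intCast hv'
  exact ⟨n, m, hn, hm⟩

lemma eq_one_or_neg_one_of_norm_eq_one {c : ℤ√(-2)} (h : c.norm = 1) : c = 1 ∨ c = -1 := by
  rw [zsqrtd_norm_eq] at h
  have im_eq_zero : c.im = 0 := by nlinarith
  rw [im_eq_zero] at h
  refine (sq_eq_one_iff.1 (by linarith : c.re ^ 2 = 1)).imp ?_ ?_ <;>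
    exact fun re_eq => Zsqrtd.ext re_eq (by simpa using im_eq_zero)

lemma eq_sqrtd_or_neg_sqrtd_of_norm_eq_two {c : ℤ√(-2)} (h : c.norm = 2) :
    c = Zsqrtd.sqrtd ∨ c = -Zsqrtd.sqrtd := by
  rw [zsqrtd_norm_eq] at h
  have re_eq_zero : c.re = 0 := by
    have : c.re ≤ 1 := by nlinarith
    have : -1 ≤ c.re := by nlinarith
    interval_cases c.re <;> omega
  rw [re_eq_zero] at h
  refine (sq_eq_one_iff.1 (by linarith : c.im ^ 2 = 1)).imp ?_ ?_ <;>
    exact fun im_eq => Zsqrtd.ext (by simpa using re_eq_zero) im_eq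

lemma eq_translation_or_neg_eq_translation (h : k 1 0 = 0) :
    ∃ u, k = translation u ∨ -k = translation u := by
  have det := bianchi_det k
  rw [h, mul_zero, sub_zero] at det
  have norm_eq_one : (k 1 1).norm = 1 := by
    rw [← Int.natAbs_of_nonneg (Zsqrtd.norm_nonneg (by norm_num) (k 1 1)),
      Zsqrtd.norm_eq_one_iff.2 (.of_mul_eq_one_right _ det), Nat.cast_one]
  rcases eq_one_or_neg_one_of_norm_eq_one norm_eq_one with h11 | h11 <;> rw [h11] at det
  · exact ⟨k 0 1, Or.inl <| bianchi_ext (by simpa using det) rfl h h11⟩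
  · refine ⟨-k 0 1, Or.inr <| bianchi_ext ?_ rfl ?_ ?_⟩
    · simpa using det
    · simp [h]
    · simp [h11]

lemma eq_translation_mul_inversion_mul_translation (h : k 1 0 = 1) :
    k = translation (k 0 0) * (inversion * translation (k 1 1)) := by
  have det := bianchi_det k
  rw [h, mul_one] at det
  apply bianchi_ext <;> simp only [mul_entry]
  · simp
  · simp only [translation_00, translation_01, translation_11, inversion_00, inversion_01,
      inversion_10, inversion_11]
    linear_combination -det
  · simp [h]
  · simp

lemma exists_sqrtd_mul_eq {c : ℤ√(-2)} (h : residue c = 0) : ∃ u, Zsqrtd.sqrtd * u = c := by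
  rw [residue_apply, ZMod.intCast_zmod_eq_zero_iff_dvd] at h
  obtain ⟨m, hm⟩ := h
  exact ⟨⟨c.im, -m⟩, by ext <;> simp [hm]⟩

lemma exists_eq_translation_mul_floorRotation_mul_translation (h : k 1 0 = -Zsqrtd.sqrtd) :
    ∃ u w, k = translation u * (floorRotation * translation w) := by
  have det := bianchi_det k
  rw [h] at det
  have residue_sqrtd : residue Zsqrtd.sqrtd = 0 := by simp [residue_apply]
  have residue_mul : residue (k 0 0) * residue (k 1 1) = 1 := by
    simpa [residue_sqrtd] using congrArg residue det
  have eq_one_of_mul_eq_one : ∀ a b : ZMod 2, a * b = 1 → a = 1 ∧ b = 1 := by decide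
  obtain ⟨residue_00, residue_11⟩ := eq_one_of_mul_eq_one _ _ residue_mul
  obtain ⟨u, hu⟩ : ∃ u, Zsqrtd.sqrtd * u = 1 - k 0 0 :=
    exists_sqrtd_mul_eq (by rw [map_sub, residue_00, map_one, sub_self])
  obtain ⟨w, hw⟩ : ∃ w, Zsqrtd.sqrtd * w = -1 - k 1 1 :=
    exists_sqrtd_mul_eq (by rw [map_sub, map_neg, residue_11, map_one]; rfl)
  have sqrtd_mul_sqrtd : (Zsqrtd.sqrtd * Zsqrtd.sqrtd : ℤ√(-2)) = -2 := by ext <;> simp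
  refine ⟨u, w, bianchi_ext ?_ ?_ ?_ ?_⟩ <;>
    simp only [mul_entry, translation_00, translation_01, translation_10, translation_11,
      floorRotation_00, floorRotation_01, floorRotation_10, floorRotation_11]
  · linear_combination hu
  · apply sqrtd_cancel
    linear_combination det - k 0 0 * hw + (1 + Zsqrtd.sqrtd * w) * hu + sqrtd_mul_sqrtd
  · linear_combination h
  · linear_combination hw

namespace IsFloorCompatible

lemma isCompatibleAt_translation_mul_mul_translation (hφ : IsFloorCompatible φ) {u w : ℤ√(-2)}
    {g : Bianchi} (h : IsCompatibleAt φ g (translation w • p)) :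
    IsCompatibleAt φ (translation u * (g * translation w)) p :=
  (hφ.isCompatibleAt_translation _ _).mul (h.mul (hφ.isCompatibleAt_translation _ _))

lemma isCompatibleAt_of_row_one (hφ : IsFloorCompatible φ) (hp : AboveFloor p)
    (hk : AboveFloor (k • p)) (h : k 1 0 = 1) : IsCompatibleAt φ k p := by
  have h1 := rowForm_row_eq_one hp hk
  simp only [h] at h1
  rw [eq_translation_mul_inversion_mul_translation h]
  refine hφ.isCompatibleAt_translation_mul_mul_translation <|
    hφ.isCompatibleAt_inversion ((aboveFloor_translation_smul_iff _ _).2 hp) ?_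
  rwa [rowForm_translation_smul, one_mul, add_zero]

lemma isCompatibleAt_of_row_neg_sqrtd (hφ : IsFloorCompatible φ) (hp : AboveFloor p)
    (hk : AboveFloor (k • p)) (h : k 1 0 = -Zsqrtd.sqrtd) : IsCompatibleAt φ k p := by
  have h1 := rowForm_row_eq_one hp hk
  obtain ⟨u, w, rfl⟩ := exists_eq_translation_mul_floorRotation_mul_translation h
  refine hφ.isCompatibleAt_translation_mul_mul_translation <| isCompatibleAt_floorRotation <|
    floorRotation_smul_of_aboveFloor ((aboveFloor_translation_smul_iff _ _).2 hp) ?_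
  rw [rowForm_translation_smul, ← h1]
  simp [mul_entry]

lemma eq_at_corner (hφ : IsFloorCompatible φ) (a c : ZMod 2) :
    φ a c (1 / 2) (1 / 2) =
      if a = 0 ∧ c = 0 then φ 0 0 (1 / 2) (1 / 2) else φ 1 0 (1 / 2) (1 / 2) := by
  have flip_shift (a c : ZMod 2) : φ (a + c) a (1 / 2) (1 / 2) = φ a c (1 / 2) (1 / 2) := by
    rw [← hφ.flip a c (1 / 2) (1 / 2) (by norm_num) (by norm_num), ← hφ.shift_one c a]
    norm_num [add_comm]
  have eq_one_one : φ 1 1 (1 / 2) (1 / 2) = φ 1 0 (1 / 2) (1 / 2) := flip_shift 1 0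
  have eq_zero_one : φ 0 1 (1 / 2) (1 / 2) = φ 1 0 (1 / 2) (1 / 2) :=
    (flip_shift 1 1).trans eq_one_one
  have eq_zero_or_one : ∀ b : ZMod 2, b = 0 ∨ b = 1 := by decide
  rcases eq_zero_or_one a with rfl | rfl <;> rcases eq_zero_or_one c with rfl | rfl
  · rw [if_pos ⟨rfl, rfl⟩]
  · rw [if_neg (by decide), eq_zero_one]
  · rw [if_neg (by decide)]
  · rw [if_neg (by decide), eq_one_one]

lemma isCompatibleAt_of_corner (hφ : IsFloorCompatible φ) {n m n' m' : ℤ}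
    (hx : p.xCoord = 1 / 2 + n) (hv : p.vCoord = 1 / 2 + m)
    (hx' : (k • p).xCoord = 1 / 2 + n') (hv' : (k • p).vCoord = 1 / 2 + m') :
    IsCompatibleAt φ k p := by
  intro a c
  have shift_corner (a c : ZMod 2) (n m : ℤ) :
      φ a c (1 / 2 + n) (1 / 2 + m) = φ (a - n * c) c (1 / 2) (1 / 2) := by
    rw [← hφ.shift (a - n * c) c (1 / 2) (1 / 2) n m, sub_add_cancel]
  rw [hx, hv, hx', hv', shift_corner, shift_corner, hφ.eq_at_corner, hφ.eq_at_corner (a - n * c)]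
  have det := congrArg residue (bianchi_det k)
  simp only [map_sub, map_mul, map_one] at det
  refine if_congr ?_ rfl rfl
  generalize residue (k 0 0) = k00 at *
  generalize residue (k 0 1) = k01 at *
  generalize residue (k 1 0) = k10 at *
  generalize residue (k 1 1) = k11 at *
  generalize (n : ZMod 2) = n at *
  generalize (n' : ZMod 2) = n' at *
  revert k00 k01 k10 k11 n n' a c
  decide

theorem isCompatibleAt_of_aboveFloor (hφ : IsFloorCompatible φ) (hp : AboveFloor p)
    (hk : AboveFloor (k • p)) : IsCompatibleAt φ k p := by
  have neg_iff : IsCompatibleAt φ (-k) p ↔ IsCompatibleAt φ k p := isCompatibleAt_neg_iff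
  have hk' : AboveFloor (-k • p) := by rwa [bianchi_neg_smul]
  have neg_10 : (-k) 1 0 = -k 1 0 := rfl
  have norm_nonneg := Zsqrtd.norm_nonneg (by norm_num : (-2 : ℤ) ≤ 0) (k 1 0)
  rcases lt_or_ge (k 1 0).norm 3 with h | h
  · interval_cases norm_eq : (k 1 0).norm
    · rw [Zsqrtd.norm_eq_zero_iff (by norm_num)] at norm_eq
      obtain ⟨u, hu | hu⟩ := eq_translation_or_neg_eq_translation norm_eq
      · rw [hu]
        exact hφ.isCompatibleAt_translation u p
      · rw [← neg_iff, hu]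
        exact hφ.isCompatibleAt_translation u p
    · rcases eq_one_or_neg_one_of_norm_eq_one norm_eq with h10 | h10
      · exact hφ.isCompatibleAt_of_row_one hp hk h10
      · exact neg_iff.1 <| hφ.isCompatibleAt_of_row_one hp hk' (by rw [neg_10, h10, neg_neg])
    · rcases eq_sqrtd_or_neg_sqrtd_of_norm_eq_two norm_eq with h10 | h10
      · exact neg_iff.1 <| hφ.isCompatibleAt_of_row_neg_sqrtd hp hk' (by rw [neg_10, h10])
      · exact hφ.isCompatibleAt_of_row_neg_sqrtd hp hk h10
  · obtain ⟨n, m, hx, hv⟩ := exists_coord_eq_half_add_intCast (k.isCoprime_row 1) hp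
      (rowForm_row_eq_one hp hk) h
    obtain ⟨n', m', hx', hv'⟩ := exists_coord_eq_half_add_intCast (k⁻¹.isCoprime_row 1) hk
      (rowForm_row_eq_one hk (by rwa [inv_smul_smul])) (by
        rw [Matrix.SpecialLinearGroup.SL2_inv_expl]
        simpa using h)
    exact hφ.isCompatibleAt_of_corner hx hv hx' hv'

end IsFloorCompatible

lemma exists_glue_family {Y : Type} [TopologicalSpace Y] {φ : ZMod 2 → ZMod 2 → ℝ → ℝ → Y}
    (hφ : IsFloorCompatible φ) (continuous_φ : ∀ a c, Continuous fun q : ℝ × ℝ => φ a c q.1 q.2) :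
    ∃ Φ : C(UpperHalfSpace, Y), ∀ (g : Bianchi) (p : UpperHalfSpace), AboveFloor (g • p) →
      Φ p = φ (residue (g 0 0)) (residue (g 1 0)) (g • p).xCoord (g • p).vCoord := by
  refine exists_glue
    (fun g p => φ (residue (g 0 0)) (residue (g 1 0)) p.xCoord p.vCoord)
    (fun g => (continuous_φ _ _).comp (continuous_xCoord.prodMk continuous_vCoord))
    fun g k p hp hk => ?_
  rw [← hφ.isCompatibleAt_of_aboveFloor hp hk]
  simp only [mul_entry, map_add, map_mul]

/-! ### The retract -/

lemma isNearestCusp_iff (l m : ℤ√(-2)) (p : UpperHalfSpace) :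
    IsNearestCusp l m p ↔ IsCoprime l m ∧ IsMinimalRow m (-l) p := by
  simp only [IsNearestCusp, cuspDist_eq, div_le_div_iff_of_pos_right p.ht_pos]
  refine and_congr_right fun _ => ⟨fun h c d hcd => ?_, fun h l' m' h' => ?_⟩
  · simpa using h (-d) c hcd.symm.neg_left
  · exact h m' (-l') h'.symm.neg_right

lemma floorPoint_mem_retractX (x v : ℝ) : floorPoint x v ∈ retractX := by
  obtain ⟨u, hx, hv⟩ := exists_abs_translation_smul_le (floorPoint x v)
  suffices translation u • floorPoint x v ∈ retractX by
    simpa using retractX.smul_mem (translation u)⁻¹ this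
  rw [translation_smul_floorPoint] at *
  rw [xCoord_floorPoint] at hx
  rw [vCoord_floorPoint] at hv
  have nearest_infty := aboveFloor_floorPoint (x + u.re) (v + u.im)
  have rowForm_eq_one : rowForm 1 0 (floorPoint (x + u.re) (v + u.im)) = 1 := by
    rw [rowForm_one_zero, ht_floorPoint_sq, xCoord_floorPoint, vCoord_floorPoint,
      floorSq_of_abs_le hx hv]
    ring
  refine ⟨-1, 0, 0, 1, (isNearestCusp_iff _ _ _).2 ⟨isCoprime_one_left.neg_left, ?_⟩,
    (isNearestCusp_iff _ _ _).2 ⟨isCoprime_one_right, ?_⟩, by simp⟩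
  · rwa [neg_neg]
  · rw [neg_zero]
    intro c d hcd
    rw [rowForm_eq_one]
    exact (aboveFloor_iff _).1 nearest_infty c d hcd

/-- The floor as a surface in the retract. -/
def floorX (x v : ℝ) : retractX := ⟨floorPoint x v, floorPoint_mem_retractX x v⟩

lemma continuous_floorX : Continuous fun q : ℝ × ℝ => floorX q.1 q.2 :=
  continuous_floorPoint.subtype_mk _

instance : ContinuousConstSMul Bianchi retractX :=
  ⟨fun g => ((continuous_const_smul g).comp continuous_subtype_val).subtype_mk _⟩

lemma ht_sq_eq_floorSq_of_mem_retractX {p : UpperHalfSpace} (mem : p ∈ retractX)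
    (hp : AboveFloor p) : p.ht ^ 2 = floorSq p.xCoord p.vCoord := by
  obtain ⟨l, m, l', m', h, h', ne⟩ := mem
  rw [isNearestCusp_iff] at h h'
  have of_ne_zero {l m : ℤ√(-2)} (h : IsCoprime l m ∧ IsMinimalRow m (-l) p) (hm : m ≠ 0) :
      p.ht ^ 2 = floorSq p.xCoord p.vCoord := by
    have coprime : IsCoprime m (-l) := h.1.symm.neg_right
    refine ht_sq_eq_floorSq_of_rowForm_eq_one hp coprime hm <|
      le_antisymm ?_ ((aboveFloor_iff p).1 hp _ _ coprime)
    exact (h.2 0 1 (isCoprime_zero_left.2 isUnit_one)).trans (rowForm_zero_one p).le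
  rcases eq_or_ne m 0 with hm | hm
  · refine of_ne_zero h' fun hm' => ne ?_
    rw [hm, hm', mul_zero, mul_zero]
  · exact of_ne_zero h hm

lemma smul_eq_floorX {g : Bianchi} {p : retractX} (h : AboveFloor (g • p.1)) :
    g • p = floorX (g • p.1).xCoord (g • p.1).vCoord :=
  Subtype.ext (floorPoint_eq
    (ht_sq_eq_floorSq_of_mem_retractX (retractX.smul_mem g p.2) h)).symm

lemma translation_smul_floorX (u : ℤ√(-2)) (x v : ℝ) :
    translation u • floorX x v = floorX (x + u.re) (v + u.im) :=
  Subtype.ext (translation_smul_floorPoint u x v)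

lemma smul_floorX {k : Bianchi} {p : UpperHalfSpace} (hp : AboveFloor p)
    (hk : AboveFloor (k • p)) :
    k • floorX p.xCoord p.vCoord = floorX (k • p).xCoord (k • p).vCoord := by
  have translation_case (u : ℤ√(-2)) : translation u • floorX p.xCoord p.vCoord =
      floorX (translation u • p).xCoord (translation u • p).vCoord := by
    rw [translation_smul_floorX, xCoord_translation_smul, vCoord_translation_smul]
  by_cases h10 : k 1 0 = 0
  · obtain ⟨u, rfl | hu⟩ := eq_translation_or_neg_eq_translation h10
    · exact translation_case u
    · have neg_smul : -k • floorX p.xCoord p.vCoord = k • floorX p.xCoord p.vCoord :=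
        Subtype.ext (bianchi_neg_smul k _)
      rw [← neg_smul, ← bianchi_neg_smul k p, hu, translation_case]
  · have p_eq := floorPoint_eq <| ht_sq_eq_floorSq_of_rowForm_eq_one hp (k.isCoprime_row 1) h10
      (rowForm_row_eq_one hp hk)
    have smul_eq := smul_eq_floorX (g := k) (p := floorX p.xCoord p.vCoord)
    simp only [floorX, p_eq] at smul_eq ⊢
    exact smul_eq hk

lemma exists_retraction :
    ∃ r : C(UpperHalfSpace, retractX), ∀ (g : Bianchi) (p : UpperHalfSpace),
      r (g • p) = g • r p := by
  obtain ⟨r, r_eq⟩ := exists_glue (Y := retractX) (fun g p => g⁻¹ • floorX p.xCoord p.vCoord)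
    (fun g => (continuous_const_smul g⁻¹).comp
      (continuous_floorX.comp (continuous_xCoord.prodMk continuous_vCoord)))
    fun g k p hp hk => by rw [← smul_floorX hp hk, mul_inv_rev, mul_smul, inv_smul_smul]
  refine ⟨r, fun g p => ?_⟩
  obtain ⟨k, hk⟩ := exists_aboveFloor_smul p
  have smul_eq : (k * g⁻¹) • g • p = k • p := by rw [mul_smul, inv_smul_smul]
  rw [r_eq k p hk, r_eq (k * g⁻¹) (g • p) (by rwa [smul_eq]), smul_eq, mul_inv_rev, inv_inv,
    mul_smul]

end UpperHalfSpace

open UpperHalfSpace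

lemma exists_sq_eq_neg_sqrtd : ∃ s : ℂ, s ≠ 0 ∧ s ^ 2 = -toComplex Zsqrtd.sqrtd := by
  obtain ⟨s, hs⟩ := IsAlgClosed.exists_pow_nat_eq (-toComplex Zsqrtd.sqrtd) two_pos
  refine ⟨s, ?_, hs⟩
  rintro rfl
  have := congrArg Complex.im hs
  simp [toComplex_im] at this

lemma exists_map_jHom_conj : ∃ A : Matrix.SpecialLinearGroup (Fin 2) ℂ, ∀ g : Gamma0,
    A * Matrix.SpecialLinearGroup.map (n := Fin 2) toComplex g.1 =
      Matrix.SpecialLinearGroup.map (n := Fin 2) toComplex (jHom g) * A := by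
  obtain ⟨s, s_ne_zero, s_sq⟩ := exists_sq_eq_neg_sqrtd
  -- `(0, 1; √-2, 0)` scaled to determinant `1`.
  refine ⟨⟨s⁻¹ • toComplex.mapMatrix !![0, 1; Zsqrtd.sqrtd, 0], ?_⟩, fun g => Subtype.ext ?_⟩
  · simp [Matrix.det_fin_two, ← s_sq, s_ne_zero]
  · change s⁻¹ • toComplex.mapMatrix _ * toComplex.mapMatrix g.1.1 =
      toComplex.mapMatrix (jHom g).1 * s⁻¹ • toComplex.mapMatrix _
    rw [smul_mul_assoc, mul_smul_comm, ← map_mul, jHom_spec, map_mul]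

lemma exists_equivariantAlong_jHom : ∃ J : C(retractX, retractX), EquivariantAlong jHom J := by
  obtain ⟨r, r_smul⟩ := exists_retraction
  obtain ⟨A, A_conj⟩ := exists_map_jHom_conj
  refine ⟨⟨fun p => r (A • p.1), r.continuous.comp
    ((continuous_const_smul A).comp continuous_subtype_val)⟩, fun g p => ?_⟩
  change r (A • (Matrix.SpecialLinearGroup.map (n := Fin 2) toComplex g.1) • p.1) = _
  rw [← mul_smul, A_conj, mul_smul]
  exact r_smul (jHom g) (A • p.1)

/-! ### The orbit space of `SL₂(ℤ[√-2])` -/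

namespace UpperHalfSpace

lemma exists_invariant_extension {Y : Type} [TopologicalSpace Y] {ψ : ℝ → ℝ → Y}
    (hψ : IsFloorCompatible fun _ _ => ψ) (continuous_ψ : Continuous fun q : ℝ × ℝ => ψ q.1 q.2) :
    ∃ Φ : C(UpperHalfSpace, Y), (∀ (g : Bianchi) (p : UpperHalfSpace), Φ (g • p) = Φ p) ∧
      ∀ x v, Φ (floorPoint x v) = ψ x v := by
  obtain ⟨Φ, Φ_eq⟩ := exists_glue_family hψ fun _ _ => continuous_ψ
  refine ⟨Φ, fun g p => ?_, fun x v => ?_⟩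
  · obtain ⟨k, hk⟩ := exists_aboveFloor_smul p
    have smul_eq : (k * g⁻¹) • g • p = k • p := by rw [mul_smul, inv_smul_smul]
    rw [Φ_eq k p hk, Φ_eq (k * g⁻¹) (g • p) (by rwa [smul_eq]), smul_eq]
  · rw [Φ_eq 1 _ (by simpa only [one_smul] using aboveFloor_floorPoint x v), one_smul,
      xCoord_floorPoint, vCoord_floorPoint]

lemma exists_circleHeight : ∃ q : C(UpperHalfSpace, UnitAddCircle),
    (∀ (g : Bianchi) (p : UpperHalfSpace), q (g • p) = q p) ∧
      ∀ x v, q (floorPoint x v) = (v : UnitAddCircle) :=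
  exists_invariant_extension (ψ := fun _ v => (v : UnitAddCircle))
    ⟨fun _ _ _ _ => rfl, fun _ _ _ v => AddCircle.coe_add_period 1 v, fun _ _ _ _ _ _ => rfl⟩
    ((AddCircle.continuous_mk' 1).comp continuous_snd)

/-- The invariant map to the circle whose value at the point of the floor above `x + v√-2` is the
class of `v`. -/
def circleHeight : C(UpperHalfSpace, UnitAddCircle) := exists_circleHeight.choose

lemma circleHeight_smul (g : Bianchi) (p : UpperHalfSpace) :
    circleHeight (g • p) = circleHeight p := exists_circleHeight.choose_spec.1 g p

lemma circleHeight_floorPoint (x v : ℝ) : circleHeight (floorPoint x v) = (v : UnitAddCircle) :=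
  exists_circleHeight.choose_spec.2 x v

end UpperHalfSpace

/-- The class of a point of the retract modulo `SL₂(ℤ[√-2])`. -/
def bianchiOrbit : C(retractX, BianchiOrbitSpace) := ⟨Quotient.mk _, continuous_quotient_mk'⟩

lemma bianchiOrbit_smul (g : Bianchi) (p : retractX) : bianchiOrbit (g • p) = bianchiOrbit p :=
  Quotient.sound ⟨g, rfl⟩

lemma exists_bianchiOrbit_floorX_eq (P : BianchiOrbitSpace) :
    ∃ x v, bianchiOrbit (floorX x v) = P := by
  obtain ⟨p, rfl⟩ := Quotient.exists_rep P
  obtain ⟨k, hk⟩ := exists_aboveFloor_smul p.1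
  exact ⟨_, _, by rw [← smul_eq_floorX hk, bianchiOrbit_smul]; rfl⟩

lemma exists_bianchiOrbit_lift {Y : Type} [TopologicalSpace Y] {ψ : ℝ → ℝ → Y}
    (hψ : IsFloorCompatible fun _ _ => ψ) (continuous_ψ : Continuous fun q : ℝ × ℝ => ψ q.1 q.2) :
    ∃ Ψ : C(BianchiOrbitSpace, Y), ∀ x v, Ψ (bianchiOrbit (floorX x v)) = ψ x v := by
  obtain ⟨Φ, Φ_smul, Φ_floorPoint⟩ := exists_invariant_extension hψ continuous_ψ
  refine ⟨⟨Quotient.lift (fun p : retractX => Φ p.1) ?_,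
    (Φ.continuous.comp continuous_subtype_val).quotient_lift _⟩, Φ_floorPoint⟩
  rintro _ p ⟨g, rfl⟩
  exact Φ_smul g p.1

/-- The map of `SL₂(ℤ[√-2])\X` to the circle induced by `circleHeight`. -/
def orbitSpaceToCircle : C(BianchiOrbitSpace, UnitAddCircle) where
  toFun := Quotient.lift (fun p : retractX => circleHeight p.1) (by
    rintro _ p ⟨g, rfl⟩
    exact circleHeight_smul g p.1)
  continuous_toFun := (circleHeight.continuous.comp continuous_subtype_val).quotient_lift _

lemma orbitSpaceToCircle_bianchiOrbit_floorX (x v : ℝ) :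
    orbitSpaceToCircle (bianchiOrbit (floorX x v)) = (v : UnitAddCircle) :=
  circleHeight_floorPoint x v

lemma bianchiOrbit_floorX_add_int (x v : ℝ) (n m : ℤ) :
    bianchiOrbit (floorX (x + n) (v + m)) = bianchiOrbit (floorX x v) := by
  rw [← bianchiOrbit_smul (translation ⟨n, m⟩) (floorX x v), translation_smul_floorX]

lemma inversion_smul_floorX {x v : ℝ} (hx : |x| ≤ 1 / 2) (hv : |v| ≤ 1 / 2) :
    inversion • floorX x v = floorX (-x) v := Subtype.ext (inversion_smul_floorPoint hx hv)

lemma bianchiOrbit_floorX_neg {x : ℝ} (hx : |x| ≤ 1 / 2) (v : ℝ) :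
    bianchiOrbit (floorX (-x) v) = bianchiOrbit (floorX x v) := by
  have shift (x : ℝ) : bianchiOrbit (floorX x (v - round v)) = bianchiOrbit (floorX x v) := by
    simpa [sub_eq_add_neg] using bianchiOrbit_floorX_add_int x v 0 (-round v)
  rw [← shift, ← shift, ← inversion_smul_floorX hx (abs_sub_round v), bianchiOrbit_smul]

lemma bianchiOrbit_floorX_intDist (x v : ℝ) :
    bianchiOrbit (floorX (intDist x) v) = bianchiOrbit (floorX x v) := by
  have shift : bianchiOrbit (floorX (x - round x) v) = bianchiOrbit (floorX x v) := by
    simpa [sub_eq_add_neg] using bianchiOrbit_floorX_add_int x v (-round x) 0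
  rw [← shift, intDist_eq]
  rcases abs_choice (x - round x) with h | h
  · rw [h]
  · rw [h, bianchiOrbit_floorX_neg (abs_sub_round x)]

/-- The circle in `SL₂(ℤ[√-2])\X` that is the image of the line `x = 0` on the floor. -/
def circleToOrbitSpace : C(UnitAddCircle, BianchiOrbitSpace) where
  toFun := Quotient.lift (fun v : ℝ => bianchiOrbit (floorX 0 v)) fun v w h => by
    obtain ⟨k, rfl⟩ := unitAddCircle_coe_eq_coe_iff.1 (Quotient.sound h : (v : UnitAddCircle) = w)
    simpa using bianchiOrbit_floorX_add_int 0 w 0 k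
  continuous_toFun := (bianchiOrbit.continuous.comp (continuous_floorX.comp
    (continuous_const.prodMk continuous_id))).quotient_lift _

lemma circleToOrbitSpace_coe (v : ℝ) :
    circleToOrbitSpace (v : UnitAddCircle) = bianchiOrbit (floorX 0 v) := rfl

lemma orbitSpaceToCircle_comp_circleToOrbitSpace :
    orbitSpaceToCircle.comp circleToOrbitSpace = .id _ := by
  ext v
  obtain ⟨v, rfl⟩ := QuotientAddGroup.mk_surjective v
  exact circleHeight_floorPoint 0 v

open unitInterval in
lemma circleToOrbitSpace_comp_orbitSpaceToCircle_homotopic :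
    (circleToOrbitSpace.comp orbitSpaceToCircle).Homotopic (.id BianchiOrbitSpace) := by
  -- `intDist x` is a representative of the orbit of `x` that can be shrunk to `0` continuously.
  have continuous_shrink : Continuous fun q : (ℝ × ℝ) × I =>
      ((q.2 : ℝ) * intDist q.1.1, q.1.2) := by
    have := continuous_intDist
    fun_prop
  let H : C((ℝ × ℝ) × I, BianchiOrbitSpace) :=
    ⟨fun q => bianchiOrbit (floorX (q.2 * intDist q.1.1) q.1.2),
      bianchiOrbit.continuous.comp (continuous_floorX.comp continuous_shrink)⟩
  have H_apply (x v : ℝ) (t : I) :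
      H.curry (x, v) t = bianchiOrbit (floorX (t * intDist x) v) := rfl
  obtain ⟨Ψ, Ψ_floorX⟩ := exists_bianchiOrbit_lift (ψ := fun x v => H.curry (x, v))
    ⟨fun _ _ x v => by
        ext t
        rw [H_apply, H_apply, ← Int.cast_one, intDist_add_int],
      fun _ _ x v => by
        ext t
        simpa only [H_apply, Int.cast_zero, Int.cast_one, add_zero] using
          bianchiOrbit_floorX_add_int (t * intDist x) v 0 1,
      fun _ _ x v _ _ => by
        ext t
        rw [H_apply, H_apply, intDist_neg]⟩ H.curry.continuous
  refine ⟨⟨Ψ.uncurry.comp ContinuousMap.prodSwap, fun P => ?_, fun P => ?_⟩⟩ <;>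
    obtain ⟨x, v, rfl⟩ := exists_bianchiOrbit_floorX_eq P
  · change Ψ (bianchiOrbit (floorX x v)) 0 =
      circleToOrbitSpace (orbitSpaceToCircle (bianchiOrbit (floorX x v)))
    rw [Ψ_floorX, H_apply, orbitSpaceToCircle_bianchiOrbit_floorX, circleToOrbitSpace_coe,
      Set.Icc.coe_zero, zero_mul]
  · change Ψ (bianchiOrbit (floorX x v)) 1 = bianchiOrbit (floorX x v)
    rw [Ψ_floorX, H_apply, Set.Icc.coe_one, one_mul, bianchiOrbit_floorX_intDist]

/-- The orbit space `SL₂(ℤ[√-2])\X` is homotopy equivalent to a circle. -/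
def bianchiOrbitSpaceHomotopyEquiv :
    ContinuousMap.HomotopyEquiv BianchiOrbitSpace UnitAddCircle where
  toFun := orbitSpaceToCircle
  invFun := circleToOrbitSpace
  left_inv := circleToOrbitSpace_comp_orbitSpaceToCircle_homotopic
  right_inv := by rw [orbitSpaceToCircle_comp_circleToOrbitSpace]

/-! ### The orbit space of `Γ₀(√-2)` -/

lemma mem_Gamma0_iff (g : Bianchi) : g ∈ Gamma0 ↔ residue (g 1 0) = 0 := by
  change g 1 0 ∈ Ideal.span {(Zsqrtd.sqrtd : ℤ√(-2))} ↔ _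
  rw [Ideal.mem_span_singleton]
  refine ⟨?_, fun h => (exists_sqrtd_mul_eq h).imp fun _ => Eq.symm⟩
  rintro ⟨u, hu⟩
  rw [hu, map_mul, residue_apply Zsqrtd.sqrtd, Zsqrtd.re_sqrtd, Int.cast_zero, zero_mul]

lemma inversion_inv : inversion⁻¹ = -inversion :=
  inv_eq_of_mul_eq_one_right <| by
    apply bianchi_ext <;> simp [Matrix.mul_apply]

/-- The class of a point of the retract modulo `Γ₀(√-2)`. -/
def gamma0Orbit : C(retractX, Gamma0OrbitSpace) := ⟨Quotient.mk _, continuous_quotient_mk'⟩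

lemma gamma0Orbit_smul {g : Bianchi} (hg : g ∈ Gamma0) (p : retractX) :
    gamma0Orbit (g • p) = gamma0Orbit p :=
  Quotient.sound ⟨(⟨g, hg⟩ : Gamma0), rfl⟩

/-- The map from the plane to `Γ₀(√-2)\X` given by the floor. -/
def floorOrbit : C(ℝ × ℝ, Gamma0OrbitSpace) :=
  gamma0Orbit.comp ⟨fun q => floorX q.1 q.2, continuous_floorX⟩

/-- The map from the plane to `Γ₀(√-2)\X` given by the image of the floor under the inversion. -/
def stripOrbit : C(ℝ × ℝ, Gamma0OrbitSpace) :=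
  gamma0Orbit.comp ⟨fun q => inversion⁻¹ • floorX q.1 q.2,
    continuous_floorX.const_smul inversion⁻¹⟩

lemma floorOrbit_apply (x v : ℝ) : floorOrbit (x, v) = gamma0Orbit (floorX x v) := rfl

lemma stripOrbit_apply (x v : ℝ) :
    stripOrbit (x, v) = gamma0Orbit (inversion⁻¹ • floorX x v) := rfl

/-- The relations between the values of `floorOrbit` (in the role of `T`) and of `stripOrbit`
(in the role of `S`): a pair of maps that satisfies them descends to `Γ₀(√-2)\X`. -/
structure IsGamma0Compatible {Y : Type*} [TopologicalSpace Y] (T S : C(ℝ × ℝ, Y)) : Prop where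
  floor_add_one : ∀ x v, T (x + 1, v) = T (x, v)
  floor_add_sqrt : ∀ x v, T (x, v + 1) = T (x, v)
  strip_add_two : ∀ x v, S (x + 2, v) = S (x, v)
  strip_add_sqrt : ∀ x v, S (x, v + 1) = S (x, v)
  strip_neg : ∀ x v, |x| ≤ 1 / 2 → S (-x, v) = T (x, v)
  strip_fold : ∀ x v, |x| ≤ 1 / 2 → S (1 + x, v) = S (1 - x, v)

/-- The family on the floor that is given by `T` on the label `(1, 0)`, by `S` on `(0, 1)` and by
the translate of `S` on `(1, 1)`. Its value on the label `(0, 0)` is irrelevant. -/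
def floorFamily {Y : Type*} [TopologicalSpace Y] (T S : C(ℝ × ℝ, Y)) (a c : ZMod 2) (x v : ℝ) : Y :=
  if c = 0 then if a = 0 then T 0 else T (x, v) else if a = 0 then S (x, v) else S (x - 1, v)

lemma continuous_floorFamily {Y : Type*} [TopologicalSpace Y] (T S : C(ℝ × ℝ, Y)) (a c : ZMod 2) :
    Continuous fun q : ℝ × ℝ => floorFamily T S a c q.1 q.2 := by
  unfold floorFamily
  split_ifs <;> fun_prop

namespace IsGamma0Compatible

variable {Y : Type*} [TopologicalSpace Y] {T S : C(ℝ × ℝ, Y)}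

lemma isFloorCompatible_floorFamily (h : IsGamma0Compatible T S) :
    IsFloorCompatible (floorFamily T S) where
  shift_one a c x v := by
    fin_cases a <;> fin_cases c
    · rfl
    · change S (x + 1 - 1, v) = S (x, v)
      rw [add_sub_cancel_right]
    · exact h.floor_add_one x v
    · change S (x + 1, v) = S (x - 1, v)
      rw [← h.strip_add_two (x - 1)]
      ring_nf
  shift_sqrt a c x v := by
    simp only [floorFamily, h.floor_add_sqrt, h.strip_add_sqrt]
  flip a c x v hx _ := by
    fin_cases a <;> fin_cases c
    · rfl
    · change T (-x, v) = S (x, v)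
      rw [← h.strip_neg (-x) v (by rwa [abs_neg]), neg_neg]
    · exact h.strip_neg x v hx
    · change S (-x - 1, v) = S (x - 1, v)
      rw [← h.strip_add_two (-x - 1), ← h.strip_add_two (x - 1)]
      convert (h.strip_fold x v hx).symm using 3 <;> ring

end IsGamma0Compatible

lemma residue_eq_one_of_mem_Gamma0 {g : Bianchi} (hg : g ∈ Gamma0) : residue (g 0 0) = 1 := by
  have det_eq := congrArg residue (bianchi_det g)
  rw [map_sub, map_mul, map_mul, (mem_Gamma0_iff g).1 hg, mul_zero, sub_zero, map_one] at det_eq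
  exact Fin.eq_one_of_ne_zero _ (left_ne_zero_of_mul_eq_one det_eq)

lemma residue_mul_of_mem_Gamma0 (k : Bianchi) {g : Bianchi} (hg : g ∈ Gamma0) (i : Fin 2) :
    residue ((k * g) i 0) = residue (k i 0) := by
  simp only [mul_entry, map_add, map_mul, residue_eq_one_of_mem_Gamma0 hg,
    (mem_Gamma0_iff g).1 hg, mul_one, mul_zero, add_zero]

lemma IsGamma0Compatible.exists_lift {Y : Type} [TopologicalSpace Y] {T S : C(ℝ × ℝ, Y)}
    (h : IsGamma0Compatible T S) :
    ∃ Φ : C(Gamma0OrbitSpace, Y), (∀ q, Φ (floorOrbit q) = T q) ∧ ∀ q, Φ (stripOrbit q) = S q := by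
  obtain ⟨Φ, Φ_eq⟩ :=
    exists_glue_family h.isFloorCompatible_floorFamily (continuous_floorFamily T S)
  have Φ_smul (g : Bianchi) (hg : g ∈ Gamma0) (p : UpperHalfSpace) : Φ (g • p) = Φ p := by
    obtain ⟨k, hk⟩ := exists_aboveFloor_smul p
    have smul_eq : (k * g⁻¹) • g • p = k • p := by rw [mul_smul, inv_smul_smul]
    rw [Φ_eq k p hk, Φ_eq (k * g⁻¹) (g • p) (by rwa [smul_eq]), smul_eq]
    simp only [residue_mul_of_mem_Gamma0 k (inv_mem hg)]
  let Ψ : C(Gamma0OrbitSpace, Y) :=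
    ⟨Quotient.lift (fun p : retractX => Φ p.1) fun _ p ⟨g, hg⟩ => hg ▸ Φ_smul g.1 g.2 p.1,
      (Φ.continuous.comp continuous_subtype_val).quotient_lift _⟩
  have Ψ_eq (g : Bianchi) (x v : ℝ) : Ψ (gamma0Orbit (g⁻¹ • floorX x v)) =
      floorFamily T S (residue (g 0 0)) (residue (g 1 0)) x v := by
    have smul_eq : g • (g⁻¹ • floorX x v).1 = floorPoint x v := smul_inv_smul g (floorPoint x v)
    refine (Φ_eq g _ (smul_eq ▸ aboveFloor_floorPoint x v)).trans ?_
    rw [smul_eq, xCoord_floorPoint, vCoord_floorPoint]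
  refine ⟨Ψ, fun ⟨x, v⟩ => ?_, fun ⟨x, v⟩ => ?_⟩
  · simpa [floorFamily, floorOrbit_apply] using Ψ_eq 1 x v
  · simpa [floorFamily, stripOrbit_apply] using Ψ_eq inversion x v

lemma mem_range_floorOrbit_or_mem_range_stripOrbit (P : Gamma0OrbitSpace) :
    P ∈ Set.range floorOrbit ∨ P ∈ Set.range stripOrbit := by
  obtain ⟨p, rfl⟩ := Quotient.exists_rep P
  obtain ⟨g, hg⟩ := exists_aboveFloor_smul p.1
  have mem_strip {g : Bianchi} (hg : AboveFloor (g • p.1)) (h00 : residue (g 0 0) = 0) :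
      gamma0Orbit p ∈ Set.range stripOrbit := by
    have mem : inversion⁻¹ * g ∈ Gamma0 := by
      simp [mem_Gamma0_iff, inversion_inv, Matrix.mul_apply, h00]
    refine ⟨((g • p.1).xCoord, (g • p.1).vCoord), ?_⟩
    rw [stripOrbit_apply, ← smul_eq_floorX hg, ← mul_smul, gamma0Orbit_smul mem]
  by_cases h10 : residue (g 1 0) = 0
  · refine .inl ⟨((g • p.1).xCoord, (g • p.1).vCoord), ?_⟩
    rw [floorOrbit_apply, ← smul_eq_floorX hg, gamma0Orbit_smul ((mem_Gamma0_iff g).2 h10)]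
    rfl
  by_cases h00 : residue (g 0 0) = 0
  · exact .inr (mem_strip hg h00)
  · refine .inr (mem_strip (g := translation 1 * g) ?_ ?_)
    · rwa [mul_smul, aboveFloor_translation_smul_iff]
    · rw [mul_entry, map_add, map_mul, map_mul, Fin.eq_one_of_ne_zero _ h00,
        Fin.eq_one_of_ne_zero _ h10, translation_00, translation_01, map_one]
      rfl

lemma floorOrbit_add_int (x v : ℝ) (n m : ℤ) :
    floorOrbit (x + n, v + m) = floorOrbit (x, v) := by
  have mem : translation ⟨n, m⟩ ∈ Gamma0 := by simp [mem_Gamma0_iff]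
  rw [floorOrbit_apply, floorOrbit_apply, ← gamma0Orbit_smul mem (floorX x v),
    translation_smul_floorX]

lemma stripOrbit_add_two_mul (x v : ℝ) (n m : ℤ) :
    stripOrbit (x + 2 * n, v + m) = stripOrbit (x, v) := by
  have mem : inversion⁻¹ * translation ⟨2 * n, m⟩ * inversion ∈ Gamma0 := by
    simp [mem_Gamma0_iff, inversion_inv, Matrix.mul_apply, residue_apply,
      CharTwo.two_eq_zero]
  have floorX_eq := translation_smul_floorX ⟨2 * n, m⟩ x v
  push_cast at floorX_eq
  rw [stripOrbit_apply, stripOrbit_apply, ← gamma0Orbit_smul mem (inversion⁻¹ • floorX x v),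
    mul_smul, smul_inv_smul, mul_smul, floorX_eq]

lemma stripOrbit_sub_round (x v : ℝ) : stripOrbit (x, v - round v) = stripOrbit (x, v) := by
  simpa [sub_eq_add_neg] using stripOrbit_add_two_mul x v 0 (-round v)

lemma stripOrbit_neg {x : ℝ} (hx : |x| ≤ 1 / 2) (v : ℝ) :
    stripOrbit (-x, v) = floorOrbit (x, v) := by
  have floorOrbit_sub_round : floorOrbit (x, v - round v) = floorOrbit (x, v) := by
    simpa [sub_eq_add_neg] using floorOrbit_add_int x v 0 (-round v)
  rw [← stripOrbit_sub_round, ← floorOrbit_sub_round, stripOrbit_apply, floorOrbit_apply,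
    ← inversion_smul_floorX hx (abs_sub_round v), inv_smul_smul]

lemma stripOrbit_one_add {x : ℝ} (hx : |x| ≤ 1 / 2) (v : ℝ) :
    stripOrbit (1 + x, v) = stripOrbit (1 - x, v) := by
  let g := inversion⁻¹ * translation 1 * inversion * translation (-1) * inversion
  have mem : g ∈ Gamma0 := by
    simp [g, mem_Gamma0_iff, inversion_inv, Matrix.mul_apply, residue_apply,
      CharTwo.two_eq_zero]
  have of_abs_le {v : ℝ} (hv : |v| ≤ 1 / 2) : stripOrbit (1 + x, v) = stripOrbit (1 - x, v) := by
    have shift_back : translation (-1) • floorX (1 - x) v = floorX (-x) v := by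
      rw [translation_smul_floorX]
      simp [sub_eq_add_neg]
    have shift : translation 1 • floorX x v = floorX (1 + x) v := by
      simp [translation_smul_floorX, add_comm]
    rw [stripOrbit_apply (1 - x), ← gamma0Orbit_smul mem]
    simp only [g, mul_smul, smul_inv_smul, shift_back]
    rw [inversion_smul_floorX (by rwa [abs_neg]) hv, neg_neg, shift, stripOrbit_apply]
  rw [← stripOrbit_sub_round, ← stripOrbit_sub_round (1 - x)]
  exact of_abs_le (abs_sub_round v)

lemma isGamma0Compatible_floorOrbit_stripOrbit : IsGamma0Compatible floorOrbit stripOrbit where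
  floor_add_one x v := by simpa using floorOrbit_add_int x v 1 0
  floor_add_sqrt x v := by simpa using floorOrbit_add_int x v 0 1
  strip_add_two x v := by simpa using stripOrbit_add_two_mul x v 1 0
  strip_add_sqrt x v := by simpa using stripOrbit_add_two_mul x v 0 1
  strip_neg x v hx := stripOrbit_neg hx v
  strip_fold x v hx := stripOrbit_one_add hx v

lemma exists_torus_lift {Y : Type*} [TopologicalSpace Y] (f : C(ℝ × ℝ, Y))
    (add_one_left : ∀ x v, f (x + 1, v) = f (x, v))
    (add_one_right : ∀ x v, f (x, v + 1) = f (x, v)) :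
    ∃ F : C(UnitAddCircle × UnitAddCircle, Y), ∀ x v : ℝ, F (x, v) = f (x, v) := by
  have isOpenQuotientMap : IsOpenQuotientMap
      (Prod.map ((↑) : ℝ → UnitAddCircle) ((↑) : ℝ → UnitAddCircle)) :=
    QuotientAddGroup.isOpenQuotientMap_mk.prodMap QuotientAddGroup.isOpenQuotientMap_mk
  let π : C(ℝ × ℝ, UnitAddCircle × UnitAddCircle) := ⟨_, isOpenQuotientMap.continuous⟩
  have factorsThrough : Function.FactorsThrough f π := by
    rintro ⟨x, v⟩ ⟨y, w⟩ h
    obtain ⟨n, rfl⟩ := unitAddCircle_coe_eq_coe_iff.1 (congrArg Prod.fst h)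
    obtain ⟨m, rfl⟩ := unitAddCircle_coe_eq_coe_iff.1 (congrArg Prod.snd h)
    have periodic_left : Function.Periodic (fun x => f (x, w + m)) 1 := (add_one_left · _)
    have periodic_right : Function.Periodic (fun v => f (y, v)) 1 := add_one_right y
    have left_eq := periodic_left.int_mul n y
    have right_eq := periodic_right.int_mul m w
    rw [mul_one] at left_eq right_eq
    exact left_eq.trans right_eq
  have isQuotientMap : Topology.IsQuotientMap π := isOpenQuotientMap.isQuotientMap
  exact ⟨isQuotientMap.lift f factorsThrough,
    fun x v => DFunLike.congr_fun (isQuotientMap.lift_comp f factorsThrough) (x, v)⟩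

lemma exists_torusToOrbitSpace : ∃ F : C(UnitAddCircle × UnitAddCircle, Gamma0OrbitSpace),
    ∀ x v : ℝ, F (x, v) = floorOrbit (x, v) :=
  exists_torus_lift floorOrbit isGamma0Compatible_floorOrbit_stripOrbit.floor_add_one
    isGamma0Compatible_floorOrbit_stripOrbit.floor_add_sqrt

/-- The torus in `Γ₀(√-2)\X` formed by the floor. -/
def torusToOrbitSpace : C(UnitAddCircle × UnitAddCircle, Gamma0OrbitSpace) :=
  exists_torusToOrbitSpace.choose

lemma torusToOrbitSpace_coe (x v : ℝ) : torusToOrbitSpace (x, v) = floorOrbit (x, v) :=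
  exists_torusToOrbitSpace.choose_spec x v

/-- The piecewise linear function that is the identity on `[-1/2, 1/2]`, constant on
`[1/2, 3/2]`, and grows by `1` under the shift by `2`. -/
def stair (x : ℝ) : ℝ := x / 2 + Real.arcsin (Real.sin (Real.pi * x)) / (2 * Real.pi)

/-- The distance to the nearest even integer. -/
def evenDist (x : ℝ) : ℝ := 2 * intDist (x / 2)

lemma continuous_stair : Continuous stair := by
  unfold stair
  fun_prop

lemma continuous_evenDist : Continuous evenDist :=
  continuous_const.mul (continuous_intDist.comp (continuous_id.div_const 2))

lemma stair_neg (x : ℝ) : stair (-x) = -stair x := by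
  unfold stair
  rw [mul_neg, Real.sin_neg, Real.arcsin_neg]
  ring

lemma stair_add_two_mul (x : ℝ) (k : ℤ) : stair (x + 2 * k) = stair x + k := by
  unfold stair
  rw [mul_add, show Real.pi * (2 * k) = k * (2 * Real.pi) by ring, Real.sin_add_int_mul_two_pi]
  ring

lemma evenDist_add_two_mul (x : ℝ) (k : ℤ) : evenDist (x + 2 * k) = evenDist x := by
  rw [evenDist, add_div, mul_div_cancel_left₀ _ two_ne_zero, intDist_add_int, evenDist]

lemma stair_of_abs_le {x : ℝ} (hx : |x| ≤ 1 / 2) : stair x = x := by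
  obtain ⟨neg_half_le, le_half⟩ := abs_le.1 hx
  have pi_pos := Real.pi_pos
  rw [stair, Real.arcsin_sin (by nlinarith) (by nlinarith)]
  field

lemma stair_one_add {x : ℝ} (hx : |x| ≤ 1 / 2) : stair (1 + x) = 1 / 2 := by
  obtain ⟨neg_half_le, le_half⟩ := abs_le.1 hx
  have pi_pos := Real.pi_pos
  have sin_eq : Real.sin (Real.pi * (1 + x)) = Real.sin (-(Real.pi * x)) := by
    rw [mul_add, mul_one, add_comm, Real.sin_add_pi, Real.sin_neg]
  rw [stair, sin_eq, Real.arcsin_sin (by nlinarith) (by nlinarith)]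
  field

lemma evenDist_of_abs_le {x : ℝ} (hx : |x| ≤ 1) : evenDist x = |x| := by
  have abs_half : |x / 2| = |x| / 2 := by rw [abs_div, abs_two]
  rw [evenDist, intDist_of_abs_le (by linarith), abs_half]
  ring

lemma evenDist_one_add {x : ℝ} (hx : |x| ≤ 1) : evenDist (1 + x) = 1 - |x| := by
  obtain ⟨neg_one_le, le_one⟩ := abs_le.1 hx
  rcases abs_cases x with ⟨abs_eq, nonneg⟩ | ⟨abs_eq, neg⟩
  · rw [← evenDist_add_two_mul (1 + x) (-1), evenDist_of_abs_le, abs_of_nonpos, abs_eq]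
    all_goals push_cast
    · ring
    · linarith
    · exact abs_le.2 ⟨by linarith, by linarith⟩
  · rw [evenDist_of_abs_le (abs_le.2 ⟨by linarith, by linarith⟩), abs_of_nonneg (by linarith),
      abs_eq, sub_neg_eq_add]

lemma exists_near_even_or_odd (x : ℝ) :
    ∃ (k : ℤ) (y : ℝ), |y| ≤ 1 / 2 ∧ (x = y + 2 * k ∨ x = 1 + y + 2 * k) := by
  obtain ⟨k, hk | hk⟩ := Int.even_or_odd' (round x)
  all_goals
    refine ⟨k, x - round x, abs_sub_round x, ?_⟩
    rw [hk]
    push_cast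
  · exact .inl (by ring)
  · exact .inr (by ring)

lemma coe_stair_add_two (x : ℝ) : (stair (x + 2) : UnitAddCircle) = stair x := by
  simpa using congrArg ((↑) : ℝ → UnitAddCircle) (stair_add_two_mul x 1)

lemma isGamma0Compatible_torusCoordinates : IsGamma0Compatible
    (T := ⟨fun q => ((q.1 : UnitAddCircle), (q.2 : UnitAddCircle)), by fun_prop⟩)
    (S := ⟨fun q => (-(stair q.1 : UnitAddCircle), (q.2 : UnitAddCircle)), by
      have := continuous_stair
      fun_prop⟩) where
  floor_add_one x v := by simp
  floor_add_sqrt x v := by simp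
  strip_add_two x v := by simp [coe_stair_add_two]
  strip_add_sqrt x v := by simp
  strip_neg x v hx := by simp [stair_neg, stair_of_abs_le hx]
  strip_fold x v hx := by
    simp [stair_one_add hx, sub_eq_add_neg, stair_one_add ((abs_neg x).trans_le hx)]

/-- The retraction of `Γ₀(√-2)\X` to the torus. -/
def orbitSpaceToTorus : C(Gamma0OrbitSpace, UnitAddCircle × UnitAddCircle) :=
  isGamma0Compatible_torusCoordinates.exists_lift.choose

lemma orbitSpaceToTorus_floorOrbit (x v : ℝ) :
    orbitSpaceToTorus (floorOrbit (x, v)) = ((x : UnitAddCircle), (v : UnitAddCircle)) :=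
  isGamma0Compatible_torusCoordinates.exists_lift.choose_spec.1 (x, v)

lemma orbitSpaceToTorus_stripOrbit (x v : ℝ) :
    orbitSpaceToTorus (stripOrbit (x, v)) = (-(stair x : UnitAddCircle), (v : UnitAddCircle)) :=
  isGamma0Compatible_torusCoordinates.exists_lift.choose_spec.2 (x, v)

lemma orbitSpaceToTorus_comp_torusToOrbitSpace :
    orbitSpaceToTorus.comp torusToOrbitSpace = .id _ := by
  ext1 ⟨x, v⟩
  obtain ⟨x, rfl⟩ := QuotientAddGroup.mk_surjective x
  obtain ⟨v, rfl⟩ := QuotientAddGroup.mk_surjective v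
  exact (congrArg orbitSpaceToTorus (torusToOrbitSpace_coe x v)).trans
    (orbitSpaceToTorus_floorOrbit x v)

/-- The deformation of `stripOrbit` into the torus: one half of the strip lies in the torus already,
the other half is folded and is pushed to its boundary. -/
def stripHomotopy (x v t : ℝ) : Gamma0OrbitSpace :=
  if evenDist x ≤ 1 / 2 then torusToOrbitSpace (-(stair x : UnitAddCircle), v)
  else stripOrbit (t * evenDist x + (1 - t) * (1 / 2), v)

lemma stripOrbit_half (v : ℝ) :
    stripOrbit (1 / 2, v) = torusToOrbitSpace (-((1 / 2 : ℝ) : UnitAddCircle), v) := by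
  have floorOrbit_eq := stripOrbit_neg (x := -(1 / 2)) (by norm_num) v
  rw [neg_neg] at floorOrbit_eq
  rw [floorOrbit_eq, ← torusToOrbitSpace_coe, AddCircle.coe_neg]

lemma coe_stair_of_half_le_evenDist {x : ℝ} (h : 1 / 2 ≤ evenDist x) :
    (stair x : UnitAddCircle) = (1 / 2 : ℝ) := by
  obtain ⟨k, y, hy, rfl | rfl⟩ := exists_near_even_or_odd x
  · rw [evenDist_add_two_mul, evenDist_of_abs_le (by linarith)] at h
    rw [stair_add_two_mul, stair_of_abs_le hy]
    obtain rfl | rfl := eq_or_eq_neg_of_abs_eq (hy.antisymm h)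
    · simp
    · exact unitAddCircle_coe_eq_coe_iff.2 ⟨k - 1, by push_cast; ring⟩
  · rw [stair_add_two_mul, stair_one_add hy]
    simp

lemma stripHomotopy_of_half_le_evenDist {x : ℝ} (h : 1 / 2 ≤ evenDist x) (v t : ℝ) :
    stripHomotopy x v t = stripOrbit (t * evenDist x + (1 - t) * (1 / 2), v) := by
  unfold stripHomotopy
  split_ifs with h'
  · rw [coe_stair_of_half_le_evenDist h, ← stripOrbit_half, h'.antisymm h]
    ring_nf
  · rfl

lemma continuous_stripHomotopy :
    Continuous fun q : (ℝ × ℝ) × unitInterval => stripHomotopy q.1.1 q.1.2 q.2 := by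
  have := continuous_stair
  have := continuous_evenDist
  have continuous_torus : Continuous fun q : (ℝ × ℝ) × unitInterval =>
      torusToOrbitSpace (-(stair q.1.1 : UnitAddCircle), q.1.2) := by fun_prop
  have continuous_strip : Continuous fun q : (ℝ × ℝ) × unitInterval =>
      stripOrbit (q.2 * evenDist q.1.1 + (1 - q.2) * (1 / 2), q.1.2) := by fun_prop
  refine continuous_torus.if_le continuous_strip (by fun_prop) continuous_const fun q hq => ?_
  rw [← stripHomotopy_of_half_le_evenDist hq.ge, stripHomotopy, if_pos hq.le]

lemma stripHomotopy_zero (x v : ℝ) :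
    stripHomotopy x v 0 = torusToOrbitSpace (-(stair x : UnitAddCircle), v) := by
  by_cases h : evenDist x ≤ 1 / 2
  · rw [stripHomotopy, if_pos h]
  · rw [stripHomotopy, if_neg h, zero_mul, zero_add, sub_zero, one_mul, stripOrbit_half,
      coe_stair_of_half_le_evenDist (not_le.1 h).le]

lemma stripHomotopy_of_abs_le {x : ℝ} (hx : |x| ≤ 1 / 2) (v t : ℝ) :
    stripHomotopy x v t = floorOrbit (-x, v) := by
  rw [stripHomotopy, if_pos (by rwa [evenDist_of_abs_le (by linarith)]), stair_of_abs_le hx,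
    ← AddCircle.coe_neg, torusToOrbitSpace_coe]

lemma stripHomotopy_add_two_mul (x v t : ℝ) (k : ℤ) :
    stripHomotopy (x + 2 * k) v t = stripHomotopy x v t := by
  simp [stripHomotopy, evenDist_add_two_mul, stair_add_two_mul]

lemma stripHomotopy_one_add {x : ℝ} (hx : |x| ≤ 1 / 2) (v t : ℝ) :
    stripHomotopy (1 + x) v t = stripOrbit (t * (1 - |x|) + (1 - t) * (1 / 2), v) := by
  have evenDist_eq := evenDist_one_add (x := x) (by linarith)
  rw [stripHomotopy_of_half_le_evenDist (by linarith), evenDist_eq]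

lemma stripHomotopy_one (x v : ℝ) : stripHomotopy x v 1 = stripOrbit (x, v) := by
  obtain ⟨k, y, hy, rfl | rfl⟩ := exists_near_even_or_odd x
  all_goals
    have stripOrbit_add (y : ℝ) : stripOrbit (y + 2 * k, v) = stripOrbit (y, v) := by
      simpa using stripOrbit_add_two_mul y v k 0
    rw [stripHomotopy_add_two_mul, stripOrbit_add]
  · rw [stripHomotopy_of_abs_le hy, ← stripOrbit_neg (by rwa [abs_neg]), neg_neg]
  · rw [stripHomotopy_one_add hy, one_mul, sub_self, zero_mul, add_zero]
    rcases abs_choice y with h | h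
    · rw [h, stripOrbit_one_add hy]
    · rw [h, sub_neg_eq_add]

open unitInterval in
lemma isGamma0Compatible_homotopy : IsGamma0Compatible
    (T := (⟨fun q : (ℝ × ℝ) × I => floorOrbit q.1, by fun_prop⟩ : C((ℝ × ℝ) × I, _)).curry)
    (S := (⟨_, continuous_stripHomotopy⟩ : C((ℝ × ℝ) × I, _)).curry) where
  floor_add_one x v := ContinuousMap.ext fun _ =>
    isGamma0Compatible_floorOrbit_stripOrbit.floor_add_one x v
  floor_add_sqrt x v := ContinuousMap.ext fun _ =>
    isGamma0Compatible_floorOrbit_stripOrbit.floor_add_sqrt x v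
  strip_add_two x v := by
    ext t
    simpa using stripHomotopy_add_two_mul x v t 1
  strip_add_sqrt x v := by
    ext t
    simp [stripHomotopy, isGamma0Compatible_floorOrbit_stripOrbit.strip_add_sqrt]
  strip_neg x v hx := by
    ext t
    simpa using stripHomotopy_of_abs_le ((abs_neg x).trans_le hx) v t
  strip_fold x v hx := by
    ext t
    have fold_eq := stripHomotopy_one_add ((abs_neg x).trans_le hx) v t
    rw [abs_neg, ← stripHomotopy_one_add hx] at fold_eq
    exact fold_eq.symm

open unitInterval in
lemma torusToOrbitSpace_comp_orbitSpaceToTorus_homotopic :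
    (torusToOrbitSpace.comp orbitSpaceToTorus).Homotopic (.id Gamma0OrbitSpace) := by
  obtain ⟨Φ, Φ_floorOrbit, Φ_stripOrbit⟩ := isGamma0Compatible_homotopy.exists_lift
  refine ⟨⟨Φ.uncurry.comp ContinuousMap.prodSwap, fun P => ?_, fun P => ?_⟩⟩ <;>
    obtain ⟨⟨x, v⟩, rfl⟩ | ⟨⟨x, v⟩, rfl⟩ := mem_range_floorOrbit_or_mem_range_stripOrbit P
  · change Φ (floorOrbit (x, v)) 0 = torusToOrbitSpace (orbitSpaceToTorus (floorOrbit (x, v)))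
    rw [Φ_floorOrbit, orbitSpaceToTorus_floorOrbit, torusToOrbitSpace_coe]
    rfl
  · change Φ (stripOrbit (x, v)) 0 = torusToOrbitSpace (orbitSpaceToTorus (stripOrbit (x, v)))
    rw [Φ_stripOrbit, orbitSpaceToTorus_stripOrbit]
    exact stripHomotopy_zero x v
  · exact DFunLike.congr_fun (Φ_floorOrbit (x, v)) 1
  · exact (DFunLike.congr_fun (Φ_stripOrbit (x, v)) 1).trans (stripHomotopy_one x v)

/-- The orbit space `Γ₀(√-2)\X` is homotopy equivalent to a torus. -/
def gamma0OrbitSpaceHomotopyEquiv :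
    ContinuousMap.HomotopyEquiv Gamma0OrbitSpace (UnitAddCircle × UnitAddCircle) where
  toFun := orbitSpaceToTorus
  invFun := torusToOrbitSpace
  left_inv := torusToOrbitSpace_comp_orbitSpaceToTorus_homotopic
  right_inv := by rw [orbitSpaceToTorus_comp_torusToOrbitSpace]

/-! ### The maps on cohomology -/

namespace UpperHalfSpace

lemma convex_upperHalfSpace : Convex ℝ {p : ℂ × ℝ | 0 < p.2} :=
  (convex_Ioi (0 : ℝ)).linear_preimage (LinearMap.snd ℝ ℂ ℝ)

instance : SimplyConnectedSpace UpperHalfSpace := by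
  have : ContractibleSpace {p : ℂ × ℝ // 0 < p.2} :=
    convex_upperHalfSpace.contractibleSpace ⟨(0, 1), show (0 : ℝ) < 1 from one_pos⟩
  exact inferInstanceAs (SimplyConnectedSpace {p : ℂ × ℝ // 0 < p.2})

instance : LocallyPathConnectedSpace UpperHalfSpace :=
  convex_upperHalfSpace.locallyPathConnectedSpace

/-- A lift of `circleHeight` to the line. -/
def lineHeight : C(UpperHalfSpace, ℝ) := (exists_lift_unitAddCircle circleHeight).choose

lemma coe_lineHeight (p : UpperHalfSpace) : (lineHeight p : UnitAddCircle) = circleHeight p :=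
  (exists_lift_unitAddCircle circleHeight).choose_spec p

lemma exists_lineHeight_smul (g : Bianchi) :
    ∃ k : ℤ, ∀ p, lineHeight (g • p) = lineHeight p + k :=
  exists_eq_add_intCast_of_coe_eq (lineHeight.comp ⟨(g • ·), continuous_const_smul g⟩) lineHeight
    fun p => by
      rw [coe_lineHeight, ← circleHeight_smul g]
      exact coe_lineHeight (g • p)

lemma exists_lineHeight_floorPoint : ∃ k : ℤ, ∀ x v, lineHeight (floorPoint x v) = v + k := by
  obtain ⟨k, hk⟩ := exists_eq_add_intCast_of_coe_eq (A := ℝ × ℝ)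
    (lineHeight.comp ⟨_, continuous_floorPoint⟩) .snd
    fun q => (coe_lineHeight _).trans (circleHeight_floorPoint q.1 q.2)
  exact ⟨k, fun x v => hk (x, v)⟩

lemma lineHeight_translation_smul (u : ℤ√(-2)) (p : UpperHalfSpace) :
    lineHeight (translation u • p) = lineHeight p + u.im := by
  obtain ⟨k, hk⟩ := exists_lineHeight_smul (translation u)
  obtain ⟨l, hl⟩ := exists_lineHeight_floorPoint
  have at_origin := hk (floorPoint 0 0)
  rw [translation_smul_floorPoint, hl, hl] at at_origin
  rw [hk]
  linarith

lemma lineHeight_inversion_smul (p : UpperHalfSpace) :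
    lineHeight (inversion • p) = lineHeight p := by
  obtain ⟨k, hk⟩ := exists_lineHeight_smul inversion
  have at_origin := hk (floorPoint 0 0)
  rw [inversion_smul_floorPoint (by norm_num) (by norm_num), neg_zero] at at_origin
  rw [hk]
  linarith

lemma lineHeight_inversion_inv_smul (p : UpperHalfSpace) :
    lineHeight (inversion⁻¹ • p) = lineHeight p := by
  rw [← lineHeight_inversion_smul (inversion⁻¹ • p), smul_inv_smul]

end UpperHalfSpace

/-- Translations as elements of `Γ₀(√-2)`. -/
def gamma0Translation (u : ℤ√(-2)) : Gamma0 :=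
  ⟨translation u, (mem_Gamma0_iff _).2 (by rw [translation_10, map_zero])⟩

lemma jHom_gamma0Translation (u : ℤ√(-2)) :
    jHom (gamma0Translation u) = inversion * translation (-(u * Zsqrtd.sqrtd)) * inversion⁻¹ := by
  have j00 : jHom (gamma0Translation u) 0 0 = 1 := rfl
  have j01 : jHom (gamma0Translation u) 0 1 = 0 := show divSqrt 0 = 0 from rfl
  have j10 : jHom (gamma0Translation u) 1 0 = u * Zsqrtd.sqrtd := rfl
  have j11 : jHom (gamma0Translation u) 1 1 = 1 := rfl
  rw [eq_mul_inv_iff_mul_eq]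
  apply bianchi_ext <;> simp [mul_entry, j00, j01, j10, j11]

lemma lineHeight_jHom_gamma0Translation_smul (u : ℤ√(-2)) (p : UpperHalfSpace) :
    lineHeight (jHom (gamma0Translation u) • p) = lineHeight p - u.re := by
  rw [jHom_gamma0Translation, mul_smul, mul_smul, lineHeight_inversion_smul,
    lineHeight_translation_smul, lineHeight_inversion_inv_smul]
  simp [sub_eq_add_neg]

lemma lineHeight_equivariantAlong_jHom {J : C(retractX, retractX)} (hJ : EquivariantAlong jHom J)
    (u : ℤ√(-2)) (x v : ℝ) :
    lineHeight (J (floorX (x + u.re) (v + u.im))).1 = lineHeight (J (floorX x v)).1 - u.re := by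
  rw [← translation_smul_floorX, ← lineHeight_jHom_gamma0Translation_smul u (J (floorX x v)).1]
  exact congrArg (fun p : retractX => lineHeight p.1) (hJ (gamma0Translation u) (floorX x v))

lemma exists_lineHeight_add_descend {J : C(retractX, retractX)} (hJ : EquivariantAlong jHom J) :
    ∃ D : C(UnitAddCircle × UnitAddCircle, ℝ),
      ∀ x v : ℝ, D (x, v) = lineHeight (J (floorX x v)).1 + x := by
  refine exists_torus_lift ⟨fun q => lineHeight (J (floorX q.1 q.2)).1 + q.1,
    (lineHeight.continuous.comp (continuous_subtype_val.comp
      (J.continuous.comp continuous_floorX))).add continuous_fst⟩ (fun x v => ?_) fun x v => ?_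
  · have shift := lineHeight_equivariantAlong_jHom hJ 1 x v
    simp only [Zsqrtd.re_one, Zsqrtd.im_one, Int.cast_one, Int.cast_zero, add_zero] at shift
    simp only [ContinuousMap.coe_mk, shift]
    ring
  · have shift := lineHeight_equivariantAlong_jHom hJ Zsqrtd.sqrtd x v
    simp only [Zsqrtd.re_sqrtd, Zsqrtd.im_sqrtd, Int.cast_one, Int.cast_zero, add_zero,
      sub_zero] at shift
    simp only [ContinuousMap.coe_mk, shift]

lemma orbitSpaceToCircle_comp_iMap_comp_torusToOrbitSpace :
    (orbitSpaceToCircle.comp (orbitSpaceMap iHom (.id retractX) id_equivariantAlong_iHom)).comp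
      torusToOrbitSpace = .snd := by
  ext ⟨x, v⟩
  obtain ⟨x, rfl⟩ := QuotientAddGroup.mk_surjective x
  obtain ⟨v, rfl⟩ := QuotientAddGroup.mk_surjective v
  exact (congrArg (orbitSpaceToCircle ∘ orbitSpaceMap _ _ id_equivariantAlong_iHom)
    (torusToOrbitSpace_coe x v)).trans (circleHeight_floorPoint x v)

lemma orbitSpaceToCircle_comp_jMap_comp_torusToOrbitSpace {J : C(retractX, retractX)}
    (hJ : EquivariantAlong jHom J) :
    ((orbitSpaceToCircle.comp (orbitSpaceMap jHom J hJ)).comp torusToOrbitSpace).Homotopic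
      (ContinuousMap.comp (Homeomorph.neg UnitAddCircle) .fst) := by
  obtain ⟨D, hD⟩ := exists_lineHeight_add_descend hJ
  have continuous_homotopy : Continuous fun q : unitInterval × (UnitAddCircle × UnitAddCircle) =>
      (((1 - (q.1 : ℝ)) * D q.2 : ℝ) : UnitAddCircle) + -q.2.1 :=
    ((AddCircle.continuous_mk' 1).comp (by fun_prop)).add (continuous_snd.fst.neg)
  refine ⟨⟨⟨_, continuous_homotopy⟩, fun ⟨x, v⟩ => ?_, fun ⟨a, b⟩ => ?_⟩⟩
  · obtain ⟨x, rfl⟩ := QuotientAddGroup.mk_surjective x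
    obtain ⟨v, rfl⟩ := QuotientAddGroup.mk_surjective v
    have eq_circleHeight : orbitSpaceToCircle (orbitSpaceMap jHom J hJ
        (torusToOrbitSpace ((x : UnitAddCircle), (v : UnitAddCircle)))) =
          circleHeight (J (floorX x v)).1 := by
      rw [torusToOrbitSpace_coe]
      rfl
    refine Eq.trans ?_ eq_circleHeight.symm
    change (((1 - (0 : ℝ)) * D (x, v) : ℝ) : UnitAddCircle) + -(x : UnitAddCircle) = _
    rw [hD, ← coe_lineHeight, ← AddCircle.coe_neg, ← AddCircle.coe_add]
    congr 1
    ring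
  · change (((1 - (1 : ℝ)) * D (a, b) : ℝ) : UnitAddCircle) + -a = -a
    rw [sub_self, zero_mul, AddCircle.coe_zero, zero_add]

section

variable {J : C(retractX, retractX)} (hJ : EquivariantAlong jHom J) (n : ℕ)

lemma map_torusToOrbitSpace_comp_iStar :
    SingularCohomology.map n torusToOrbitSpace ∘ₗ iStar n ∘ₗ
        SingularCohomology.map n orbitSpaceToCircle =
      SingularCohomology.map n .snd := by
  rw [iStar, ← SingularCohomology.map_comp, ← SingularCohomology.map_comp,
    orbitSpaceToCircle_comp_iMap_comp_torusToOrbitSpace]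

lemma map_torusToOrbitSpace_comp_jMap :
    SingularCohomology.map n torusToOrbitSpace ∘ₗ
        SingularCohomology.map n (orbitSpaceMap jHom J hJ) ∘ₗ
        SingularCohomology.map n orbitSpaceToCircle =
      SingularCohomology.map n .fst ∘ₗ SingularCohomology.map n (Homeomorph.neg UnitAddCircle) := by
  rw [← SingularCohomology.map_comp, ← SingularCohomology.map_comp, ← SingularCohomology.map_comp,
    SingularCohomology.map_eq_of_homotopic n
      (orbitSpaceToCircle_comp_jMap_comp_torusToOrbitSpace hJ)]

lemma map_orbitSpaceMap_jHom_eq {J' : C(retractX, retractX)} (hJ' : EquivariantAlong jHom J') :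
    SingularCohomology.map n (orbitSpaceMap jHom J hJ) =
      SingularCohomology.map n (orbitSpaceMap jHom J' hJ') := by
  have torus_injective := (SingularCohomology.map_bijective n
    gamma0OrbitSpaceHomotopyEquiv.symm).injective
  have circle_surjective := (SingularCohomology.map_bijective n
    bianchiOrbitSpaceHomotopyEquiv).surjective
  rw [← LinearMap.cancel_right circle_surjective, ← LinearMap.cancel_left torus_injective]
  exact (map_torusToOrbitSpace_comp_jMap hJ n).trans (map_torusToOrbitSpace_comp_jMap hJ' n).symm

end

section ArrowEquiv

variable {R V W V' W' : Type*} [Ring R] [AddCommGroup V] [AddCommGroup W] [AddCommGroup V']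
  [AddCommGroup W'] [Module R V] [Module R W] [Module R V'] [Module R W']
  {g : V →ₗ[R] W} {g' : V' →ₗ[R] W'} {e : V ≃ₗ[R] V'} {f : W ≃ₗ[R] W'}

/-- Isomorphic linear maps have isomorphic kernels. -/
def kerEquivOfComm (h : f.toLinearMap ∘ₗ g = g' ∘ₗ e.toLinearMap) :
    LinearMap.ker g ≃ₗ[R] LinearMap.ker g' :=
  e.ofSubmodules _ _ <| by
    rw [← LinearEquiv.ker_comp f g, h, LinearMap.ker_comp,
      Submodule.map_comap_eq_of_surjective e.surjective]

/-- Isomorphic linear maps have isomorphic cokernels. -/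
def cokerEquivOfComm (h : f.toLinearMap ∘ₗ g = g' ∘ₗ e.toLinearMap) :
    (W ⧸ LinearMap.range g) ≃ₗ[R] W' ⧸ LinearMap.range g' :=
  Submodule.Quotient.equiv _ _ f <| by
    rw [← LinearMap.range_comp, h, LinearMap.range_comp_of_range_eq_top _ e.range]

lemma injective_of_comm (h : f.toLinearMap ∘ₗ g = g' ∘ₗ e.toLinearMap)
    (hg' : Function.Injective g') : Function.Injective g :=
  have comm : f ∘ g = g' ∘ e := congrArg DFunLike.coe h
  (comm ▸ hg'.comp e.injective : Function.Injective (f ∘ g)).of_comp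

lemma surjective_of_comm (h : f.toLinearMap ∘ₗ g = g' ∘ₗ e.toLinearMap)
    (hg' : Function.Surjective g') : Function.Surjective g :=
  have comm : f ∘ g = g' ∘ e := congrArg DFunLike.coe h
  (comm ▸ hg'.comp e.surjective : Function.Surjective (f ∘ g)).of_comp_left f.injective

end ArrowEquiv

variable {J : C(retractX, retractX)} (hJ : EquivariantAlong jHom J) (n : ℕ)

/-- The restriction of the cohomology of `Γ₀(√-2)\X` to the torus. -/
def gamma0CohomologyEquiv : SingularCohomology n Gamma0OrbitSpace ≃ₗ[ZMod 2]
    SingularCohomology n (UnitAddCircle × UnitAddCircle) :=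
  SingularCohomology.congr n gamma0OrbitSpaceHomotopyEquiv.symm

/-- Two copies of the cohomology of `SL₂(ℤ[√-2])\X` as the cohomology of two circles. The second
circle is reflected because `J` reverses the first coordinate of the torus. -/
def bianchiCohomologyEquiv :
    (SingularCohomology n BianchiOrbitSpace × SingularCohomology n BianchiOrbitSpace) ≃ₗ[ZMod 2]
      SingularCohomology n UnitAddCircle × SingularCohomology n UnitAddCircle :=
  let toCircle := (SingularCohomology.congr n bianchiOrbitSpaceHomotopyEquiv).symm
  toCircle.prodCongr
    (toCircle ≪≫ₗ SingularCohomology.congr n (Homeomorph.neg UnitAddCircle).toHomotopyEquiv)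

lemma gamma0CohomologyEquiv_comp_coprod :
    (gamma0CohomologyEquiv n).toLinearMap ∘ₗ
        (iStar n).coprod (SingularCohomology.map n (orbitSpaceMap jHom J hJ)) =
      torusPullback n ∘ₗ (bianchiCohomologyEquiv n).toLinearMap := by
  have circle_surjective : Function.Surjective (SingularCohomology.map n orbitSpaceToCircle) :=
    (SingularCohomology.congr n bianchiOrbitSpaceHomotopyEquiv).surjective
  have congr_symm (x : SingularCohomology n UnitAddCircle) :
      (SingularCohomology.congr n bianchiOrbitSpaceHomotopyEquiv).symm
        (SingularCohomology.map n orbitSpaceToCircle x) = x :=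
    (SingularCohomology.congr n bianchiOrbitSpaceHomotopyEquiv).symm_apply_apply x
  refine LinearMap.ext fun ⟨y, z⟩ => ?_
  obtain ⟨y, rfl⟩ := circle_surjective y
  obtain ⟨z, rfl⟩ := circle_surjective z
  simp only [bianchiCohomologyEquiv, torusPullback, LinearMap.comp_apply, LinearMap.coprod_apply,
    LinearEquiv.coe_coe, LinearEquiv.prodCongr_apply, LinearEquiv.trans_apply, congr_symm, map_add]
  exact congrArg₂ _ (LinearMap.congr_fun (map_torusToOrbitSpace_comp_iStar n) y)
    (LinearMap.congr_fun (map_torusToOrbitSpace_comp_jMap hJ n) z)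

end

theorem mainTheorem4 :
    ∃ jStar : ∀ n : ℕ, SingularCohomology n BianchiOrbitSpace →ₗ[ZMod 2]
        SingularCohomology n Gamma0OrbitSpace,
      (∃ J : C(retractX, retractX), EquivariantAlong jHom J) ∧
      (∀ (J : C(retractX, retractX)) (hJ : EquivariantAlong jHom J) (n : ℕ),
        SingularCohomology.map n (orbitSpaceMap jHom J hJ) = jStar n) ∧
      (∀ n : ℕ, n ≠ 0 → Function.Injective ((iStar n).coprod (jStar n))) ∧
      (∀ n : ℕ, n ≠ 2 → Function.Surjective ((iStar n).coprod (jStar n))) ∧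
      Nonempty (LinearMap.ker ((iStar 0).coprod (jStar 0)) ≃ₗ[ZMod 2] ZMod 2) ∧
      Nonempty ((SingularCohomology 2 Gamma0OrbitSpace ⧸
        LinearMap.range ((iStar 2).coprod (jStar 2))) ≃ₗ[ZMod 2] ZMod 2) := by
  obtain ⟨J, hJ⟩ := exists_equivariantAlong_jHom
  exact ⟨fun n => SingularCohomology.map n (orbitSpaceMap jHom J hJ), ⟨J, hJ⟩,
    fun J' hJ' n => map_orbitSpaceMap_jHom_eq hJ' n hJ,
    fun n hn => injective_of_comm (gamma0CohomologyEquiv_comp_coprod hJ n)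
      (torusPullback_injective n hn),
    fun n hn => surjective_of_comm (gamma0CohomologyEquiv_comp_coprod hJ n)
      (torusPullback_surjective n hn),
    ⟨kerEquivOfComm (gamma0CohomologyEquiv_comp_coprod hJ 0) ≪≫ₗ kerTorusPullbackEquiv⟩,
    ⟨cokerEquivOfComm (gamma0CohomologyEquiv_comp_coprod hJ 2) ≪≫ₗ cokerTorusPullbackEquiv⟩⟩
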